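/- **Model.** In the MapReduce model, an input graph $G$ with vertex set $\{0,\dots,n-1\}$ and $m$ edges is distributed over $M=\max\{1,\lceil m/n^{1+\mu}\rceil\}$ machines: each edge is initially held by exactly one machine, the distribution being arbitrary (adversarial) except that no machine holds more than $\lceil n^{1+\mu}\rceil$ edges. Every machine is a word RAM with words of $O(\log n)$ bits, $O(n^{1+\mu})$ words of memory and independent fair random bits. All machines run the same program. In each round, every machine starts from the key-value pairs (pairs of words) delivered to it, together with $n$, $M$, its own number and the number of the round; it computes for a number of steps polynomial in $n$, and sends key-value pairs to other machines, where the total size of the pairs received and that of the pairs sent by a machine are $O(n^{1+\mu})$ words; the pairs sent are delivered at the start of the next round. Nothing is kept between rounds except what a machine sends to itself. **Statement.** There are absolute constants $A,K,b,d\in\mathbb N$ such that for every fixed real $\mu$ with $0<\mu\le 1$ there are a program and a number of rounds $r\le A/\mu$, depending only on $\mu$, with the following property. For every $\kappa\in\mathbb N$ there is $n_0$ such that for all $n\ge n_0$, every graph $G$ on $n$ vertices and every such distribution of its edges, with probability at least $1-n^{-\kappa}$: the program executes $r$ rounds on all machines, with words of $b(\lfloor\log_2 n\rfloor+1)$ bits,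 at most $K n^{1+\mu}$ words of memory, of received pairs and of sent pairs per machine, and at most $n^{d}$ steps per machine and round; and the keys of the pairs delivered after the last round are exactly the vertices of a maximal (with respect to inclusion) clique of $G$. In short: there is a MapReduce algorithm that finds a maximal clique in $O(1/\mu)$ rounds with $O(n^{1+\mu})$ space per machine, w.h.p. -/

import Mathlib

open MeasureTheory

namespace MapReduce

/-! ### The local machine: a randomized word RAM

A program is a finite command over finitely many registers and a random access memory.
Registers, memory cells and all intermediate results are words: arithmetic is performed
modulo `W`, the number of distinct words. -/

/-- Arithmetic expressions over the registers. -/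
inductive Expr where
  | const (c : ℕ)
  | reg (x : ℕ)
  | add (a b : Expr)
  | sub (a b : Expr)
  | mul (a b : Expr)
  | div (a b : Expr)
  | mod (a b : Expr)
  | lt (a b : Expr)
  | eq (a b : Expr)

/-- The value of an expression in words `{0, …, W - 1}`. Subtraction is truncated at `0`, division
is integer division, and comparisons return `1` for true and `0` for false. -/
def Expr.eval (W : ℕ) (reg : ℕ → ℕ) : Expr → ℕ
  | .const c => c % W
  | .reg x => reg x % W
  | .add a b => (a.eval W reg + b.eval W reg) % W
  | .sub a b => (a.eval W reg - b.eval W reg) % W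
  | .mul a b => (a.eval W reg * b.eval W reg) % W
  | .div a b => (a.eval W reg / b.eval W reg) % W
  | .mod a b => (a.eval W reg % b.eval W reg) % W
  | .lt a b => (if a.eval W reg < b.eval W reg then 1 else 0) % W
  | .eq a b => (if a.eval W reg = b.eval W reg then 1 else 0) % W

/-- Programs of the local machine. -/
inductive Program where
  /-- do nothing -/
  | skip
  /-- `x := e` -/
  | assign (x : ℕ) (e : Expr)
  /-- `x := memory[a]` -/
  | load (x : ℕ) (a : Expr)
  /-- `memory[a] := e` -/
  | store (a e : Expr)
  /-- `x :=` a fresh fair random bit -/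
  | flip (x : ℕ)
  /-- send the key-value pair `(key, val)` to machine number `dest` -/
  | send (dest key val : Expr)
  /-- first `p`, then `q` -/
  | seq (p q : Program)
  /-- if `e ≠ 0` then `p` else `q` -/
  | ite (e : Expr) (p q : Program)
  /-- while `e ≠ 0` do `p` -/
  | loop (e : Expr) (p : Program)

/-- A key-value pair of words, addressed to a machine. -/
structure Message where
  dest : ℕ
  key : ℕ
  val : ℕ

/-- The state of a machine during its local computation: registers, memory, the messages sent so
far, and the number of random bits used so far. -/
structure LocalState where
  reg : ℕ → ℕ
  mem : ℕ → ℕ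
  out : List Message
  used : ℕ

/-- `Exec W S coin p σ t σ'`: with words `{0, …, W - 1}`, memory cells `{0, …, S - 1}` and random
bits `coin`, the program `p` started in state `σ` halts after `t` steps in state `σ'`. A program
that accesses a memory cell outside of `{0, …, S - 1}` does not halt. -/
inductive Exec (W S : ℕ) (coin : ℕ → Bool) : Program → LocalState → ℕ → LocalState → Prop
  | skip (σ : LocalState) : Exec W S coin .skip σ 1 σ
  | assign (σ : LocalState) (x : ℕ) (e : Expr) :
      Exec W S coin (.assign x e) σ 1 { σ with reg := Function.update σ.reg x (e.eval W σ.reg) }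
  | load (σ : LocalState) (x : ℕ) (a : Expr) (ha : a.eval W σ.reg < S) :
      Exec W S coin (.load x a) σ 1
        { σ with reg := Function.update σ.reg x (σ.mem (a.eval W σ.reg)) }
  | store (σ : LocalState) (a e : Expr) (ha : a.eval W σ.reg < S) :
      Exec W S coin (.store a e) σ 1
        { σ with mem := Function.update σ.mem (a.eval W σ.reg) (e.eval W σ.reg) }
  | flip (σ : LocalState) (x : ℕ) :
      Exec W S coin (.flip x) σ 1
        { σ with reg := Function.update σ.reg x (coin σ.used).toNat, used := σ.used + 1 }
  | send (σ : LocalState) (d k v : Expr) :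
      Exec W S coin (.send d k v) σ 1
        { σ with out := σ.out ++ [⟨d.eval W σ.reg, k.eval W σ.reg, v.eval W σ.reg⟩] }
  | seq {p q : Program} {σ₁ σ₂ σ₃ : LocalState} {s t : ℕ}
      (hp : Exec W S coin p σ₁ s σ₂) (hq : Exec W S coin q σ₂ t σ₃) :
      Exec W S coin (.seq p q) σ₁ (s + t) σ₃
  | ite_true {e : Expr} {p q : Program} {σ σ' : LocalState} {t : ℕ}
      (he : e.eval W σ.reg ≠ 0) (hp : Exec W S coin p σ t σ') :
      Exec W S coin (.ite e p q) σ (t + 1) σ'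
  | ite_false {e : Expr} {p q : Program} {σ σ' : LocalState} {t : ℕ}
      (he : e.eval W σ.reg = 0) (hq : Exec W S coin q σ t σ') :
      Exec W S coin (.ite e p q) σ (t + 1) σ'
  | loop_true {e : Expr} {p : Program} {σ₁ σ₂ σ₃ : LocalState} {s t : ℕ}
      (he : e.eval W σ₁.reg ≠ 0) (hp : Exec W S coin p σ₁ s σ₂)
      (hl : Exec W S coin (.loop e p) σ₂ t σ₃) :
      Exec W S coin (.loop e p) σ₁ (s + t + 1) σ₃
  | loop_false {e : Expr} {p : Program} {σ : LocalState} (he : e.eval W σ.reg = 0) :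
      Exec W S coin (.loop e p) σ 1 σ

/-! ### Rounds -/

/-- The key-value pairs that a machine receives at the start of a round. -/
abbrev Inbox := List (ℕ × ℕ)

/-- The state in which machine `i` of `M` starts its local computation in round `t`, on an instance
with size parameter `n`: registers `0, …, 4` hold `n`, `M`, `i`, `t` and the number of received
pairs, and the received pairs are stored consecutively from memory cell `0` on. All other registers
and cells are `0`. In particular nothing but the received messages is kept from earlier rounds. -/
def initState (n M i t : ℕ) (inbox : Inbox) : LocalState where
  reg := fun x => [n, M, i, t, inbox.length].getD x 0
  mem := fun a => (inbox.flatMap fun p => [p.1, p.2]).getD a 0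
  out := []
  used := 0

/-- The resources of one machine in one round: the number `W` of distinct words, the number `S` of
words of memory, and the number `T` of steps. -/
structure Resources where
  W : ℕ
  S : ℕ
  T : ℕ

/-- Machine `i`, running `P` in round `t` on the received pairs `inbox` with the random bits `coin`,
sends exactly the messages `out`; its input fits into its memory, it accesses only `S` words of
memory, it halts after at most `T` steps, and the messages that it sends (three words each) have
total size at most `S`. -/
def LocalRun (P : Program) (R : Resources) (n M i t : ℕ) (inbox : Inbox) (coin : ℕ → Bool)
    (out : List Message) : Prop :=
  2 * inbox.length ≤ R.S ∧ 3 * out.length ≤ R.S ∧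
    ∃ s ≤ R.T, ∃ σ, Exec R.W R.S coin P (initState n M i t inbox) s σ ∧ σ.out = out

/-- The pairs delivered to machine `j`, when machine `i` has sent the messages `out i`. -/
def deliver {M : ℕ} (out : Fin M → List Message) (j : Fin M) : Inbox :=
  (List.finRange M).flatMap fun i =>
    (out i).filterMap fun m => if m.dest = (j : ℕ) then some (m.key, m.val) else none

/-- `Run P R n M coin input r final`: if machine `i` initially holds the pairs `input i`, then `r`
rounds, in each of which every machine runs `P` within the resources `R` (in round `t` machine `i`
uses the random bits `coin (t, i, ·)`) and all messages are then delivered, leave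
machine `j` with the pairs `final j`. -/
inductive Run (P : Program) (R : Resources) (n M : ℕ) (coin : ℕ × ℕ × ℕ → Bool)
    (input : Fin M → Inbox) : ℕ → (Fin M → Inbox) → Prop
  | start : Run P R n M coin input 0 input
  | round {t : ℕ} {cur : Fin M → Inbox} {out : Fin M → List Message}
      (hcur : Run P R n M coin input t cur)
      (hout : ∀ i : Fin M, LocalRun P R n M i t (cur i) (fun k => coin (t, i, k)) (out i)) :
      Run P R n M coin input (t + 1) (deliver out)

/-- Independent fair bits, one for each round, machine and position. -/
noncomputable def fairCoins : Measure (ℕ × ℕ × ℕ → Bool) :=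
  Measure.infinitePi fun _ => (PMF.uniformOfFintype Bool).toMeasure

/-! ### Graph problems -/

/-- The number of machines, `⌈m / n ^ (1 + μ)⌉` but at least one, for a graph with `n` vertices and
`m` edges. -/
noncomputable def numMachines (μ : ℝ) {n : ℕ} (G : SimpleGraph (Fin n)) : ℕ :=
  max 1 ⌈(G.edgeSet.ncard : ℝ) / (n : ℝ) ^ (1 + μ)⌉₊

/-- The edges of `G` are distributed over `M` machines, in any way such that no machine holds more
than `cap` edges: every edge is held by exactly one machine, exactly once, as a pair of its end
points in either order. -/
def IsEdgeDistribution {n M : ℕ} (G : SimpleGraph (Fin n)) (cap : ℕ)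
    (edges : Fin M → List (Fin n × Fin n)) : Prop :=
  (∀ i, (edges i).length ≤ cap) ∧
    (((List.finRange M).flatMap edges).map fun p => s(p.1, p.2)).Nodup ∧
    ∀ e : Sym2 (Fin n),
      e ∈ ((List.finRange M).flatMap edges).map (fun p => s(p.1, p.2)) ↔ e ∈ G.edgeSet

/-- The input of each machine: every edge `{u, v}` that it holds is a pair `(u, v)`. -/
def edgeInput {n M : ℕ} (edges : Fin M → List (Fin n × Fin n)) (i : Fin M) : Inbox :=
  (edges i).map fun p => ((p.1 : ℕ), (p.2 : ℕ))

/-- With the random bits `coin`, the program `P` finds a maximal clique of `G` in `r` rounds: the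
`r` rounds are completed within the resources, the pairs then delivered fit into the memories, and
the keys of these pairs are exactly the vertices of a maximal clique. -/
def FindsMaximalClique (P : Program) (R : Resources) {n M : ℕ} (G : SimpleGraph (Fin n))
    (edges : Fin M → List (Fin n × Fin n)) (r : ℕ) (coin : ℕ × ℕ × ℕ → Bool) : Prop :=
  ∃ final : Fin M → Inbox, Run P R n M coin (edgeInput edges) r final ∧
    (∀ i, 2 * (final i).length ≤ R.S) ∧
    ∃ Q : Set (Fin n), Maximal G.IsClique Q ∧
      {k : ℕ | ∃ i, ∃ p ∈ final i, p.1 = k} = Fin.val '' Q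

/-- `S = ⌊K n ^ (1 + μ)⌋` words of `b (⌊log₂ n⌋ + 1)` bits each, and `n ^ d` steps. -/
noncomputable def graphResources (μ : ℝ) (K b d n : ℕ) : Resources where
  W := 2 ^ (b * (Nat.log 2 n + 1))
  S := ⌊(K : ℝ) * (n : ℝ) ^ (1 + μ)⌋₊
  T := n ^ d

end MapReduce

namespace MapReduce

/-! The algorithm grows a clique in `2 * q` phases of at most eight rounds, where `q = ⌈2 / μ⌉`.
Call a vertex active if it is adjacent to the whole current clique. Write `l = Nat.log 2 n + 1` and
`h = l / q`. In phase `i` every active vertex is sampled independently with probability `2 ^ (-e)`,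
where `e = l - (i + 1) * h` (truncated), so the probability grows by a factor of at most `2 ^ h`,
about `n ^ (μ / 2)`, from phase to phase. The sample `T` is scanned greedily in increasing order,
and the vertices taken are added to the clique. In the last phase `e = 0`: all active vertices are
scanned, hence the clique becomes maximal (`cliqueAt_maximal`).

Machine `0` performs the scan knowing only the non-edges inside `T`, so the point is that these are
few. Two facts hold with high probability. The sample has fewer than `4 * 2 ^ (l - e)` vertices
(`measure_card_sampleAt_ge`). After a phase, every vertex that is still active has fewer than `L * 2
^ e` active non-neighbours (`measure_codegree_ge`): as long as `v` is active, each non-neighbour of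
`v` that the scan meets and could take must have escaped sampling, since taking it would deactivate
`v`. Multiplying the sample size of one phase by the codegree left by the phase before gives at most
`4 * L * 2 ^ (l + h)` non-edges, which is below `n ^ (1 + μ)` for `L = (κ + 2) * l` and large `n`
(`card_missing_sampleAt_le`, `measure_missing_gt_le_inv_pow`). Both tail bounds come from a
potential that does not increase in expectation as the vertices are decided one at a time
(`lintegral_potential_le`).

Finding the non-edges needs entire rows of the adjacency matrix of `T`. The rows are spread over the
machines by the ranks of the vertices in `T`; they fit because a set with few non-edges has about
`|T| ^ 2 / 2` edges, and the machines together hold at most `M * cap` edges (`Represents.row_le`).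

The rest verifies the programs. `Tr` specifies a command by the registers that it adds and the
multiset of messages that it sends; `Box` describes the received pairs by tags (0 edges, 1 active
vertices, 2 labelled vertices, 3 clique, 4 rows, 5 non-edges, 6 counts); each lemma `reaches_...`
treats one round, and `reaches_phase` chains them. Edges and clique are sent again in every round
but the last, because nothing else survives a round. -/

/-! ### Total correctness with step bounds -/

/-- An upper bound for the number of steps when every loop makes at most `B` iterations. -/
def Program.time (B : ℕ) : Program → ℕ
  | .skip => 1
  | .assign _ _ => 1
  | .load _ _ => 1
  | .store _ _ => 1
  | .flip _ => 1
  | .send _ _ _ => 1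
  | .seq p q => p.time B + q.time B
  | .ite _ p q => p.time B + q.time B + 1
  | .loop _ p => B * (p.time B + 1) + 1

/-- The number of commands. -/
def Program.size : Program → ℕ
  | .skip => 1
  | .assign _ _ => 1
  | .load _ _ => 1
  | .store _ _ => 1
  | .flip _ => 1
  | .send _ _ _ => 1
  | .seq p q => p.size + q.size
  | .ite _ p q => p.size + q.size + 1
  | .loop _ p => p.size + 1

/-- The nesting depth of loops. -/
def Program.depth : Program → ℕ
  | .skip => 0
  | .assign _ _ => 0
  | .load _ _ => 0
  | .store _ _ => 0
  | .flip _ => 0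
  | .send _ _ _ => 0
  | .seq p q => max p.depth q.depth
  | .ite _ p q => max p.depth q.depth
  | .loop _ p => p.depth + 1

/-- Each level of nesting multiplies the time by at most `B + 1`. Thus a fixed program with
polynomially bounded loops takes polynomially many steps. -/
theorem Program.time_le (B : ℕ) (p : Program) : p.time B ≤ p.size * (B + 1) ^ p.depth := by
  induction p with
  | skip | assign | load | store | flip | send => simp [time, size, depth]
  | seq p q hp hq =>
    simp only [time, size, depth, add_mul]
    gcongr
    · exact hp.trans (by gcongr <;> simp)
    · exact hq.trans (by gcongr <;> simp)
  | ite e p q hp hq =>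
    simp only [time, size, depth, add_mul]
    gcongr
    · exact hp.trans (by gcongr <;> simp)
    · exact hq.trans (by gcongr <;> simp)
    · simpa using Nat.one_le_pow _ _ (by omega)
  | loop e p hp =>
    simp only [time, size, depth]
    have h1 : 1 ≤ (B + 1) ^ p.depth := Nat.one_le_pow _ _ (by omega)
    calc B * (p.time B + 1) + 1 ≤ (B + 1) * (p.time B + 1) := by nlinarith
      _ ≤ (B + 1) * (p.size * (B + 1) ^ p.depth + (B + 1) ^ p.depth) := by gcongr
      _ = _ := by ring

/-- The parameters of a machine: number of words, memory size, a bound for the number of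
iterations of each loop, and the random bits. -/
structure Machine where
  W : ℕ
  S : ℕ
  B : ℕ
  coin : ℕ → Bool

/-- The program halts from `σ` within its time bound in a state with property `Q`. -/
def wp (c : Machine) (p : Program) (σ : LocalState) (Q : LocalState → Prop) : Prop :=
  ∃ t ≤ p.time c.B, ∃ σ', Exec c.W c.S c.coin p σ t σ' ∧ Q σ'

section wp

variable {c : Machine} {p q : Program} {σ : LocalState} {Q R : LocalState → Prop}

theorem wp.mono (h : wp c p σ Q) (hQ : ∀ σ', Q σ' → R σ') : wp c p σ R := by
  obtain ⟨t, ht, σ', h1, h2⟩ := h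
  exact ⟨t, ht, σ', h1, hQ _ h2⟩

theorem wp_skip (h : Q σ) : wp c .skip σ Q := ⟨1, le_rfl, _, .skip _, h⟩

theorem wp_assign {x : ℕ} {e : Expr}
    (h : Q { σ with reg := Function.update σ.reg x (e.eval c.W σ.reg) }) :
    wp c (.assign x e) σ Q := ⟨1, le_rfl, _, .assign _ _ _, h⟩

theorem wp_load {x : ℕ} {a : Expr} (ha : a.eval c.W σ.reg < c.S)
    (h : Q { σ with reg := Function.update σ.reg x (σ.mem (a.eval c.W σ.reg)) }) :
    wp c (.load x a) σ Q := ⟨1, le_rfl, _, .load _ _ _ ha, h⟩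

theorem wp_store {a e : Expr} (ha : a.eval c.W σ.reg < c.S)
    (h : Q { σ with mem := Function.update σ.mem (a.eval c.W σ.reg) (e.eval c.W σ.reg) }) :
    wp c (.store a e) σ Q := ⟨1, le_rfl, _, .store _ _ _ ha, h⟩

theorem wp_flip {x : ℕ}
    (h : Q { σ with reg := Function.update σ.reg x (c.coin σ.used).toNat, used := σ.used + 1 }) :
    wp c (.flip x) σ Q := ⟨1, le_rfl, _, .flip _ _, h⟩

theorem wp_send {d k v : Expr}
    (h : Q { σ with out := σ.out ++
      [⟨d.eval c.W σ.reg, k.eval c.W σ.reg, v.eval c.W σ.reg⟩] }) :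
    wp c (.send d k v) σ Q := ⟨1, le_rfl, _, .send _ _ _ _, h⟩

theorem wp_seq (h : wp c p σ fun σ' => wp c q σ' Q) : wp c (.seq p q) σ Q := by
  obtain ⟨t, ht, σ', h1, s, hs, σ'', h2, h3⟩ := h
  exact ⟨t + s, Nat.add_le_add ht hs, σ'', .seq h1 h2, h3⟩

theorem wp_ite {e : Expr} (h1 : e.eval c.W σ.reg ≠ 0 → wp c p σ Q)
    (h0 : e.eval c.W σ.reg = 0 → wp c q σ Q) : wp c (.ite e p q) σ Q := by
  by_cases he : e.eval c.W σ.reg = 0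
  · obtain ⟨t, ht, σ', h2, h3⟩ := h0 he
    exact ⟨t + 1, by simp only [Program.time]; omega, σ', .ite_false he h2, h3⟩
  · obtain ⟨t, ht, σ', h2, h3⟩ := h1 he
    exact ⟨t + 1, by simp only [Program.time]; omega, σ', .ite_true he h2, h3⟩

/-- The invariant is indexed by the iteration and decides the guard, so the loop makes exactly `N`
iterations and its time bound needs no separate argument. -/
theorem wp_loop {e : Expr} (I : ℕ → LocalState → Prop) (N : ℕ) (hN : N ≤ c.B)
    (hstep : ∀ k < N, ∀ σ, I k σ → e.eval c.W σ.reg ≠ 0 ∧ wp c p σ (I (k + 1)))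
    (hend : ∀ σ, I N σ → e.eval c.W σ.reg = 0) (h0 : I 0 σ) : wp c (.loop e p) σ (I N) := by
  have key : ∀ j k, k + j = N → ∀ σ, I k σ →
      ∃ t ≤ j * (p.time c.B + 1) + 1, ∃ σ', Exec c.W c.S c.coin (.loop e p) σ t σ' ∧ I N σ' := by
    intro j
    induction j with
    | zero =>
      intro k hk σ h
      obtain rfl : k = N := by omega
      exact ⟨1, by simp, σ, .loop_false (hend σ h), h⟩
    | succ j ih =>
      intro k hk σ h
      obtain ⟨he, t, ht, σ', h1, h2⟩ := hstep k (by omega) σ h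
      obtain ⟨s, hs, σ'', h3, h4⟩ := ih (k + 1) (by omega) σ' h2
      exact ⟨t + s + 1, by rw [add_mul]; omega, σ'', .loop_true he h1 h3, h4⟩
  obtain ⟨t, ht, σ', h1, h2⟩ := key N 0 (by omega) σ h0
  exact ⟨t, ht.trans (by simp only [Program.time]; gcongr), σ', h1, h2⟩

end wp

/-- Execute `p` for `x = 0, …, N - 1`. -/
def Program.forLoop (x : ℕ) (N : Expr) (p : Program) : Program :=
  .seq (.assign x (.const 0)) (.loop (.lt (.reg x) N) (.seq p (.assign x (.add (.reg x) (.const 1)))))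

/-- The bound is evaluated anew before every iteration, hence the invariant must fix its value; `N <
c.W` keeps the counter from wrapping around. -/
theorem wp_forLoop {c : Machine} {p : Program} {σ : LocalState} {x : ℕ} {e : Expr}
    (I : ℕ → LocalState → Prop) (N : ℕ) (hN : N ≤ c.B) (hW : N < c.W)
    (he : ∀ k ≤ N, ∀ σ, I k σ → e.eval c.W σ.reg = N)
    (h0 : I 0 { σ with reg := Function.update σ.reg x 0 })
    (hstep : ∀ k < N, ∀ σ, I k σ → σ.reg x = k → wp c p σ fun σ' => σ'.reg x = k ∧
      I (k + 1) { σ' with reg := Function.update σ'.reg x (k + 1) }) :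
    wp c (.forLoop x e p) σ (I N) := by
  have hW0 : 0 < c.W := by omega
  apply wp_seq
  apply wp_assign
  have hlt : ∀ k ≤ N, ∀ σ, (σ.reg x = k ∧ I k σ) →
      (Expr.lt (.reg x) e).eval c.W σ.reg = (if k < N then 1 else 0) % c.W := by
    rintro k hk σ ⟨h1, h2⟩
    simp only [Expr.eval, h1, he k hk σ h2, Nat.mod_eq_of_lt (show k < c.W by omega)]
  refine (wp_loop (fun k σ => σ.reg x = k ∧ I k σ) N hN ?_ ?_ ?_).mono fun σ h => h.2
  · intro k hk σ h
    refine ⟨?_, ?_⟩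
    · rw [hlt k hk.le σ h, if_pos hk, Nat.mod_eq_of_lt (by omega)]
      exact one_ne_zero
    · apply wp_seq
      refine (hstep k hk σ h.2 h.1).mono ?_
      rintro σ' ⟨h1, h2⟩
      apply wp_assign
      have : (Expr.add (.reg x) (.const 1)).eval c.W σ'.reg = k + 1 := by
        simp only [Expr.eval, h1]
        rw [← Nat.add_mod, Nat.mod_eq_of_lt (by omega)]
      rw [this]
      exact ⟨by simp, h2⟩
  · intro σ h
    rw [hlt N le_rfl σ h]
    simp
  · simpa [Expr.eval] using h0

/-! ### Values of expressions -/

/-- The expression has value `v` whenever the first registers are `env`. -/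
def EvalsTo (W : ℕ) (env : List ℕ) (e : Expr) (v : ℕ) : Prop :=
  ∀ reg : ℕ → ℕ, (∀ (k v : ℕ), env[k]? = some v → reg k = v) → e.eval W reg = v

namespace EvalsTo

variable {W : ℕ} {env : List ℕ} {a b : Expr} {x y : ℕ}

theorem const (h : x < W) : EvalsTo W env (.const x) x := fun _ _ => Nat.mod_eq_of_lt h

theorem reg {k : ℕ} (hk : env[k]? = some x) (h : x < W) : EvalsTo W env (.reg k) x := by
  intro r hr
  simp only [Expr.eval, hr _ _ hk, Nat.mod_eq_of_lt h]

theorem add (ha : EvalsTo W env a x) (hb : EvalsTo W env b y) (h : x + y < W) :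
    EvalsTo W env (.add a b) (x + y) := by
  intro r hr
  simp only [Expr.eval, ha r hr, hb r hr, Nat.mod_eq_of_lt h]

theorem sub (ha : EvalsTo W env a x) (hb : EvalsTo W env b y) (h : x < W) :
    EvalsTo W env (.sub a b) (x - y) := by
  intro r hr
  simp only [Expr.eval, ha r hr, hb r hr, Nat.mod_eq_of_lt ((Nat.sub_le x y).trans_lt h)]

theorem mul (ha : EvalsTo W env a x) (hb : EvalsTo W env b y) (h : x * y < W) :
    EvalsTo W env (.mul a b) (x * y) := by
  intro r hr
  simp only [Expr.eval, ha r hr, hb r hr, Nat.mod_eq_of_lt h]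

theorem div (ha : EvalsTo W env a x) (hb : EvalsTo W env b y) (h : x < W) :
    EvalsTo W env (.div a b) (x / y) := by
  intro r hr
  simp only [Expr.eval, ha r hr, hb r hr, Nat.mod_eq_of_lt ((Nat.div_le_self x y).trans_lt h)]

theorem mod (ha : EvalsTo W env a x) (hb : EvalsTo W env b y) (h : x < W) :
    EvalsTo W env (.mod a b) (x % y) := by
  intro r hr
  simp only [Expr.eval, ha r hr, hb r hr, Nat.mod_eq_of_lt ((Nat.mod_le x y).trans_lt h)]

theorem lt (ha : EvalsTo W env a x) (hb : EvalsTo W env b y) (h : 1 < W) :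
    EvalsTo W env (.lt a b) (if x < y then 1 else 0) := by
  intro r hr
  simp only [Expr.eval, ha r hr, hb r hr]
  exact Nat.mod_eq_of_lt (by split_ifs <;> omega)

theorem eq (ha : EvalsTo W env a x) (hb : EvalsTo W env b y) (h : 1 < W) :
    EvalsTo W env (.eq a b) (if x = y then 1 else 0) := by
  intro r hr
  simp only [Expr.eval, ha r hr, hb r hr]
  exact Nat.mod_eq_of_lt (by split_ifs <;> omega)

end EvalsTo

/-! ### Programs that only extend the registers and send messages -/

/-- The first registers are `env` and the memory is `mem`. -/
def Frame (env : List ℕ) (mem : ℕ → ℕ) (σ : LocalState) : Prop :=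
  (∀ (k v : ℕ), env[k]? = some v → σ.reg k = v) ∧ σ.mem = mem

/-- From first registers `env` and memory `mem`, the program leaves these unchanged, computes `ext`
in the following registers and sends the messages `L`, in some order. -/
def Tr (c : Machine) (mem : ℕ → ℕ) (p : Program) (env ext : List ℕ) (L : Multiset Message) : Prop :=
  ∀ σ, Frame env mem σ → wp c p σ fun σ' => Frame (env ++ ext) mem σ' ∧
    ∃ l : List Message, σ'.out = σ.out ++ l ∧ (l : Multiset Message) = L

theorem Frame.of_append {env ext : List ℕ} {mem : ℕ → ℕ} {σ : LocalState}
    (h : Frame (env ++ ext) mem σ) : Frame env mem σ := by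
  refine ⟨fun k v hk => h.1 k v ?_, h.2⟩
  rw [List.getElem?_append_left, hk]
  exact (List.getElem?_eq_some_iff.1 hk).1

theorem Frame.update {env : List ℕ} {mem : ℕ → ℕ} {σ : LocalState} (h : Frame env mem σ)
    {x : ℕ} (hx : x = env.length) (v : ℕ) :
    Frame (env ++ [v]) mem { σ with reg := Function.update σ.reg x v } := by
  subst hx
  refine ⟨fun k w hk => ?_, h.2⟩
  rcases lt_trichotomy k env.length with hlt | rfl | hgt
  · rw [List.getElem?_append_left hlt] at hk
    simpa [Function.update_of_ne hlt.ne] using h.1 k w hk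
  · simp at hk
    simp [hk]
  · simp [List.getElem?_append_right hgt.le, List.getElem?_eq_none, show 1 ≤ k - env.length by omega]
      at hk

theorem Frame.snoc {env : List ℕ} {mem : ℕ → ℕ} {σ : LocalState} (h : Frame env mem σ)
    {x v : ℕ} (hx : x = env.length) (hv : σ.reg x = v) : Frame (env ++ [v]) mem σ := by
  have := h.update hx v
  rw [← hv, Function.update_eq_self] at this
  rwa [← hv]

namespace Tr

variable {c : Machine} {mem : ℕ → ℕ} {p q : Program} {env ext ext' : List ℕ}
  {L L' : Multiset Message}

/-- Forgetting the computed registers turns them into scratch space, which the next command or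
iteration may overwrite. -/
theorem shrink (h : Tr c mem p env ext L) : Tr c mem p env [] L := fun σ hσ =>
  (h σ hσ).mono fun σ' h' => ⟨by simpa using h'.1.of_append, h'.2⟩

theorem congr (h : Tr c mem p env ext L) (hL : L = L') : Tr c mem p env ext L' := hL ▸ h

theorem skip : Tr c mem .skip env [] 0 := fun σ hσ =>
  wp_skip ⟨by simpa using hσ, [], by simp, rfl⟩

theorem assign {x v : ℕ} {e : Expr} (hx : x = env.length) (he : EvalsTo c.W env e v) :
    Tr c mem (.assign x e) env [v] 0 := fun σ hσ => wp_assign <| by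
  rw [he _ hσ.1]
  exact ⟨hσ.update hx v, [], by simp, rfl⟩

theorem load {x v : ℕ} {e : Expr} (hx : x = env.length) (he : EvalsTo c.W env e v) (hv : v < c.S) :
    Tr c mem (.load x e) env [mem v] 0 := fun σ hσ => by
  apply wp_load
  · rwa [he _ hσ.1]
  · rw [he _ hσ.1]
    have := hσ.update hx (mem v)
    rw [← hσ.2] at this ⊢
    exact ⟨this, [], by simp, rfl⟩

theorem send {d k v : Expr} {d' k' v' : ℕ} (hd : EvalsTo c.W env d d') (hk : EvalsTo c.W env k k')
    (hv : EvalsTo c.W env v v') : Tr c mem (.send d k v) env [] {⟨d', k', v'⟩} := fun σ hσ =>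
  wp_send <| by
    rw [hd _ hσ.1, hk _ hσ.1, hv _ hσ.1]
    exact ⟨by simpa [Frame] using hσ, _, rfl, rfl⟩

theorem seq (hp : Tr c mem p env ext L) (hq : Tr c mem q (env ++ ext) ext' L') :
    Tr c mem (.seq p q) env (ext ++ ext') (L + L') := fun σ hσ => wp_seq <| by
  refine (hp σ hσ).mono ?_
  rintro σ₁ ⟨h1, l, hl, rfl⟩
  refine (hq σ₁ h1).mono ?_
  rintro σ₂ ⟨h2, l', hl', rfl⟩
  exact ⟨by simpa using h2, l ++ l', by simp [hl', hl], by simp⟩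

/-- Sequential composition of two programs that do not share registers. -/
theorem both (hp : Tr c mem p env [] L) (hq : Tr c mem q env [] L') :
    Tr c mem (.seq p q) env [] (L + L') :=
  hp.seq (by simpa using hq)

theorem ite {e : Expr} {v : ℕ} (he : EvalsTo c.W env e v)
    (h1 : v ≠ 0 → Tr c mem p env ext L) (h0 : v = 0 → Tr c mem q env ext L) :
    Tr c mem (.ite e p q) env ext L := fun σ hσ => by
  apply wp_ite
  · intro h
    rw [he _ hσ.1] at h
    exact h1 h σ hσ
  · intro h
    rw [he _ hσ.1] at h
    exact h0 h σ hσ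

theorem forLoop {x N : ℕ} {e : Expr} {L : ℕ → Multiset Message} (hx : x = env.length)
    (he : EvalsTo c.W env e N) (hN : N ≤ c.B) (hW : N < c.W)
    (hp : ∀ k < N, Tr c mem p (env ++ [k]) [] (L k)) :
    Tr c mem (.forLoop x e p) env [] (∑ k ∈ Finset.range N, L k) := fun σ hσ => by
  refine (wp_forLoop (fun k σ' => Frame env mem σ' ∧ ∃ l : List Message, σ'.out = σ.out ++ l ∧
    (l : Multiset Message) = ∑ i ∈ Finset.range k, L i) N hN hW ?_ ?_ ?_).mono ?_
  · exact fun k hk σ h => he _ h.1.1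
  · exact ⟨(hσ.update hx 0).of_append, [], by simp, by simp⟩
  · rintro k hk σ₁ ⟨h1, l, hl, hL⟩ hxk
    have hf : Frame (env ++ [k]) mem σ₁ := h1.snoc hx hxk
    refine (hp k hk σ₁ hf).mono ?_
    rintro σ₂ ⟨h2, l', hl', hL'⟩
    rw [List.append_nil] at h2
    refine ⟨h2.1 x k (by simp [hx]), ((h2.of_append).update hx (k + 1)).of_append, l ++ l', ?_, ?_⟩
    · simp [hl', hl]
    · rw [Finset.sum_range_succ, ← hL, ← hL']
      simp
  · rintro σ' ⟨h1, h2⟩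
    exact ⟨by simpa using h1, h2⟩

end Tr

/-- `if e ≠ 0 then p`. -/
def Program.when (e : Expr) (p : Program) : Program := .ite e p .skip

theorem Tr.when {c : Machine} {mem : ℕ → ℕ} {p : Program} {env : List ℕ} {L : Multiset Message}
    {e : Expr} {v : ℕ} (he : EvalsTo c.W env e v) (hp : v ≠ 0 → Tr c mem p env [] L) :
    Tr c mem (.when e p) env [] (if v ≠ 0 then L else 0) := by
  apply Tr.ite he
  · intro h
    simpa [h] using hp h
  · rintro h
    simpa [h] using Tr.skip

/-! ### Iterating over the received pairs -/

/-- The pairs with tag `τ`, that is, with keys `τ * n + x` where `x < n`. -/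
def sel (n τ : ℕ) (I : Multiset (ℕ × ℕ)) : Multiset (ℕ × ℕ) :=
  (I.filter fun p => p.1 / n = τ).map fun p => (p.1 % n, p.2)

/-- For every received pair with tag `τ` execute `p`; the registers `x + 3` and `x + 2` hold the
key without its tag and the value. -/
def Program.forTag (τ x : ℕ) (p : Program) : Program :=
  .forLoop x (.reg 4) <|
    .seq (.load (x + 1) (.mul (.const 2) (.reg x))) <|
    .seq (.load (x + 2) (.add (.mul (.const 2) (.reg x)) (.const 1))) <|
    .when (.eq (.div (.reg (x + 1)) (.reg 0)) (.const τ)) <|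
    .seq (.assign (x + 3) (.mod (.reg (x + 1)) (.reg 0))) p

/-- The memory starts with the received pairs. -/
def MemHolds (mem : ℕ → ℕ) (I : Inbox) : Prop :=
  ∀ (k : ℕ) (h : k < I.length), mem (2 * k) = I[k].1 ∧ mem (2 * k + 1) = I[k].2

/-- The received pairs `I` are held by a machine of sufficient size, whose first registers are
`env`. -/
structure Holds (c : Machine) (mem : ℕ → ℕ) (n : ℕ) (I : Inbox) (env : List ℕ) : Prop where
  mem : MemHolds mem I
  key_lt : ∀ p ∈ I, p.1 < c.W
  val_lt : ∀ p ∈ I, p.2 < c.W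
  n_reg : env[0]? = some n
  len_reg : env[4]? = some I.length
  n_lt : n < c.W
  len_lt : 2 * I.length < c.W
  len_le : I.length ≤ c.B
  len_mem : 2 * I.length ≤ c.S
  one_lt : 8 < c.W

theorem Holds.append {c : Machine} {mem : ℕ → ℕ} {n : ℕ} {I : Inbox} {env : List ℕ}
    (h : Holds c mem n I env) (ext : List ℕ) : Holds c mem n I (env ++ ext) := by
  refine { h with n_reg := ?_, len_reg := ?_ }
  · rw [List.getElem?_append_left, h.n_reg]
    exact (List.getElem?_eq_some_iff.1 h.n_reg).1
  · rw [List.getElem?_append_left, h.len_reg]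
    exact (List.getElem?_eq_some_iff.1 h.len_reg).1

/-- Passing from positions in memory to the multiset of tagged pairs makes the specifications
independent of the order in which messages arrive. -/
theorem sum_range_sel {α : Type*} [AddCommMonoid α] (n τ : ℕ) (I : Inbox) (f : ℕ × ℕ → α)
    (g : ℕ → α)
    (hg : ∀ k (h : k < I.length), g k = if I[k].1 / n = τ then f (I[k].1 % n, I[k].2) else 0) :
    ∑ k ∈ Finset.range I.length, g k = ((sel n τ I).map f).sum := by
  have h1 : ∑ k ∈ Finset.range I.length, g k =
      (I.map fun p => if p.1 / n = τ then f (p.1 % n, p.2) else 0).sum := by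
    rw [Finset.sum_range, ← List.sum_ofFn]
    congr 1
    apply List.ext_getElem
    · simp
    · intro i h1 h2
      simp only [List.length_ofFn] at h1
      simp [hg i h1]
  rw [h1, sel]
  clear h1 hg
  induction I with
  | nil => simp
  | cons p I ih =>
    rw [List.map_cons, List.sum_cons, ih, ← Multiset.cons_coe, Multiset.filter_cons]
    split_ifs <;> simp

section tag

variable {c : Machine} {mem : ℕ → ℕ} {n : ℕ} {I : Inbox} {env : List ℕ}

theorem Tr.loadPair {x k : ℕ} (H : Holds c mem n I env) (hx : x = env.length)
    (hk : k < I.length) {p : Program} {ext : List ℕ} {L : Multiset Message}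
    (hp : Tr c mem p (env ++ [k, I[k].1, I[k].2]) ext L) :
    Tr c mem (.seq (.load (x + 1) (.mul (.const 2) (.reg x))) <|
      .seq (.load (x + 2) (.add (.mul (.const 2) (.reg x)) (.const 1))) p) (env ++ [k])
      ([I[k].1, I[k].2] ++ ext) L := by
  have h2 := H.len_lt
  have h3 := H.len_mem
  have h4 := H.one_lt
  have e0 : ∀ ext, EvalsTo c.W (env ++ [k] ++ ext) (.mul (.const 2) (.reg x)) (2 * k) := fun ext =>
    .mul (.const (by omega)) (.reg (by simp [hx]) (by omega)) (by omega)
  have t1 : Tr c mem (.load (x + 1) (.mul (.const 2) (.reg x))) (env ++ [k]) [I[k].1] 0 := by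
    rw [← (H.mem k hk).1]
    exact .load (by simp [hx]) (by simpa using e0 []) (by omega)
  have t2 : Tr c mem (.load (x + 2) (.add (.mul (.const 2) (.reg x)) (.const 1)))
      (env ++ [k] ++ [I[k].1]) [I[k].2] 0 := by
    rw [← (H.mem k hk).2]
    exact .load (by simp [hx]) (.add (e0 _) (.const (by omega)) (by omega)) (by omega)
  have := t1.seq (t2.seq (ext' := ext) (L' := L) (q := p) (by simpa using hp))
  simpa using this

theorem Holds.tag (H : Holds c mem n I env) {x k : ℕ} (τ : ℕ) (hτ : τ ≤ 8) (hx : x = env.length)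
    (hk : k < I.length) (ext : List ℕ) :
    EvalsTo c.W (env ++ ([k, I[k].1, I[k].2] ++ ext)) (.eq (.div (.reg (x + 1)) (.reg 0)) (.const τ))
      (if I[k].1 / n = τ then 1 else 0) := by
  have h4 := H.one_lt
  have hk' := H.key_lt _ (List.getElem_mem hk)
  refine .eq (.div (.reg ?_ hk') (.reg (H.append _).n_reg H.n_lt) hk') (.const (by omega)) (by omega)
  simp [hx]

theorem Holds.key (H : Holds c mem n I env) {x k : ℕ} (hx : x = env.length)
    (hk : k < I.length) (ext : List ℕ) :
    EvalsTo c.W (env ++ ([k, I[k].1, I[k].2] ++ ext)) (.mod (.reg (x + 1)) (.reg 0))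
      (I[k].1 % n) := by
  have hk' := H.key_lt _ (List.getElem_mem hk)
  refine .mod (.reg ?_ hk') (.reg (H.append _).n_reg H.n_lt) hk'
  simp [hx]

theorem mem_sel {k τ : ℕ} (hk : k < I.length) (h : I[k].1 / n = τ) :
    (I[k].1 % n, I[k].2) ∈ sel n τ I := by
  rw [sel, Multiset.mem_map]
  exact ⟨I[k], by simp [h], rfl⟩

theorem Tr.forTag {τ x : ℕ} {p : Program} {f : ℕ × ℕ → Multiset Message}
    (H : Holds c mem n I env) (hτ : τ ≤ 8) (hx : x = env.length)
    (hp : ∀ k key a y, (a, y) ∈ sel n τ I → Tr c mem p (env ++ [k, key, y, a]) [] (f (a, y))) :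
    Tr c mem (.forTag τ x p) env [] ((sel n τ I).map f).sum := by
  have h2 := H.len_lt
  rw [← sum_range_sel n τ I f (fun k => if h : k < I.length then
    if I[k].1 / n = τ then f (I[k].1 % n, I[k].2) else 0 else 0) (fun k h => by simp [h])]
  refine .forLoop hx (.reg H.len_reg (by omega)) H.len_le (by omega) fun k hk => ?_
  rw [dif_pos hk]
  refine (Tr.loadPair (ext := []) H hx hk ?_).shrink
  refine (Tr.when (by simpa using H.tag τ hτ hx hk []) (L := f (I[k].1 % n, I[k].2)) ?_).congr
    (by split_ifs <;> simp_all)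
  intro h
  replace h : I[k].1 / n = τ := by
    by_contra h'
    simp [h'] at h
  have t1 := Tr.assign (mem := mem) (x := x + 3) (env := env ++ [k, I[k].1, I[k].2]) (by simp [hx])
    (by simpa using H.key (ext := []) hx hk)
  have t2 := hp k I[k].1 _ _ (mem_sel hk h)
  have := (t1.seq (q := p) (by simpa using t2)).shrink
  simpa using this

/-- `x :=` the sum of the values of `e`, computed after executing `p`, over all received pairs with
tag `τ`. The registers `x + 4` and `x + 3` hold the key without its tag and the value. -/
def Program.sumTag (τ x : ℕ) (p : Program) (e : Expr) : Program :=
  .seq (.assign x (.const 0)) <|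
  .forLoop (x + 1) (.reg 4) <|
    .seq (.load (x + 2) (.mul (.const 2) (.reg (x + 1)))) <|
    .seq (.load (x + 3) (.add (.mul (.const 2) (.reg (x + 1))) (.const 1))) <|
    .when (.eq (.div (.reg (x + 2)) (.reg 0)) (.const τ)) <|
    .seq (.assign (x + 4) (.mod (.reg (x + 2)) (.reg 0))) <|
    .seq p <| .assign x (.add (.reg x) e)

theorem Frame.update_last {env : List ℕ} {mem : ℕ → ℕ} {σ : LocalState} {x v : ℕ}
    (h : Frame (env ++ [v]) mem σ) (hx : x = env.length) (w : ℕ) :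
    Frame (env ++ [w]) mem { σ with reg := Function.update σ.reg x w } :=
  (h.of_append).update hx w

/-- `Tr.forLoop` does not apply, since the accumulator precedes the loop counter and changes between
iterations. The invariant holds the partial sum there; partial sums are bounded by the full sum, so
nothing overflows. -/
theorem Tr.sumTag {τ x : ℕ} {p : Program} {e : Expr} {g : ℕ × ℕ → ℕ}
    (H : Holds c mem n I env) (hτ : τ ≤ 8) (hx : x = env.length)
    (hsum : ((sel n τ I).map g).sum < c.W)
    (hp : ∀ acc k key a y, (a, y) ∈ sel n τ I → ∃ ext,
      Tr c mem p (env ++ [acc, k, key, y, a]) ext 0 ∧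
      EvalsTo c.W (env ++ [acc, k, key, y, a] ++ ext) e (g (a, y))) :
    Tr c mem (.sumTag τ x p e) env [((sel n τ I).map g).sum] 0 := fun σ hσ => by
  have h2 := H.len_lt
  have h4 := H.one_lt
  set G : ℕ → ℕ := fun k => if h : k < I.length then
    if I[k].1 / n = τ then g (I[k].1 % n, I[k].2) else 0 else 0 with hG
  have hs := sum_range_sel n τ I g G (fun k h => by simp [hG, h])
  rw [← hs] at hsum ⊢
  apply wp_seq
  apply wp_assign
  refine (wp_forLoop (fun k σ' => Frame (env ++ [∑ i ∈ Finset.range k, G i]) mem σ' ∧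
    σ'.out = σ.out) I.length H.len_le (by omega) ?_ ?_ ?_).mono ?_
  · intro k hk σ h
    exact EvalsTo.reg ((H.append _).len_reg) (by omega) _ h.1.1
  · refine ⟨?_, rfl⟩
    have := hσ.update hx 0
    have := (this.update (x := x + 1) (by simp [hx]) 0).of_append
    simpa [Expr.eval] using this
  · rintro k hk σ₁ ⟨h1, hl⟩ hxk
    set acc := ∑ i ∈ Finset.range k, G i with hacc
    have hf : Frame (env ++ [acc] ++ [k]) mem σ₁ := h1.snoc (by simp [hx]) hxk
    have hle : acc + G k < c.W := by
      refine lt_of_le_of_lt ?_ hsum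
      rw [hacc, ← Finset.sum_range_succ]
      exact Finset.sum_le_sum_of_subset (Finset.range_subset_range.2 hk)
    have H' := H.append [acc]
    have hx' : x + 1 = (env ++ [acc]).length := by simp [hx]
    -- Both branches end here: the counter is intact and the accumulator contains the next partial
    -- sum.
    have done : ∀ σ₂, Frame (env ++ [acc + G k] ++ [k]) mem σ₂ → σ₂.out = σ.out →
        σ₂.reg (x + 1) = k ∧ (Frame (env ++ [∑ i ∈ Finset.range (k + 1), G i]) mem
          { σ₂ with reg := Function.update σ₂.reg (x + 1) (k + 1) } ∧ σ₂.out = σ.out) := by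
      intro σ₂ h2 ho
      refine ⟨h2.1 _ _ (by simp [hx]), ?_, ho⟩
      rw [Finset.sum_range_succ]
      exact ((h2.of_append).update (by simp [hx]) (k + 1)).of_append
    apply wp_seq
    have l1 := Tr.load (mem := mem) (env := env ++ [acc] ++ [k]) (v := 2 * k) (c := c)
      (e := .mul (.const 2) (.reg (x + 1))) (x := x + 2) (by simp [hx])
      (.mul (.const (by omega)) (.reg (by simp [hx]) (by omega)) (by omega))
      (by have := H.len_mem; omega)
    rw [(H.mem k hk).1] at l1
    refine (l1 σ₁ hf).mono ?_
    rintro σ₂ ⟨f2, l, hl2, hz⟩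
    obtain rfl : l = [] := by simpa using hz
    apply wp_seq
    have l2 := Tr.load (mem := mem) (env := env ++ [acc] ++ [k] ++ [I[k].1]) (v := 2 * k + 1) (c := c)
      (e := .add (.mul (.const 2) (.reg (x + 1))) (.const 1)) (x := x + 3) (by simp [hx])
      (.add (.mul (.const (by omega)) (.reg (by simp [hx]) (by omega)) (by omega))
        (.const (by omega)) (by omega))
      (by have := H.len_mem; omega)
    rw [(H.mem k hk).2] at l2
    refine (l2 σ₂ f2).mono ?_
    rintro σ₃ ⟨f3, l, hl3, hz⟩
    obtain rfl : l = [] := by simpa using hz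
    have hout : σ₃.out = σ.out := by simp [hl3, hl2, hl]
    have et := (H'.tag τ hτ hx' hk []) _ (by simpa using f3.1)
    apply wp_ite
    · intro h
      rw [et] at h
      replace h : I[k].1 / n = τ := by
        by_contra h'
        simp [h'] at h
      have hGk : G k = g (I[k].1 % n, I[k].2) := by simp [hG, h, hk]
      obtain ⟨ext, tp, ep⟩ := hp acc k I[k].1 _ _ (mem_sel hk h)
      have t1 := Tr.assign (mem := mem) (x := x + 4) (env := env ++ [acc, k, I[k].1, I[k].2])
        (by simp [hx]) (by simpa using H'.key (ext := []) hx' hk)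
      apply wp_seq
      refine (t1 σ₃ (by simpa using f3)).mono ?_
      rintro σ₄ ⟨f4, l, hl4, hz⟩
      obtain rfl : l = [] := by simpa using hz
      apply wp_seq
      refine (tp σ₄ (by simpa using f4)).mono ?_
      rintro σ₅ ⟨f5, l, hl5, hz⟩
      obtain rfl : l = [] := by simpa using hz
      apply wp_assign
      have ev := (EvalsTo.add (EvalsTo.reg (k := x) (x := acc) (by simp [hx]) (by omega)) ep
        (by rw [← hGk]; exact hle)) _ f5.1
      rw [ev, ← hGk]
      apply done
      · have f5' : Frame (env ++ [acc] ++ ([k, I[k].1, I[k].2, I[k].1 % n] ++ ext)) mem σ₅ := by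
          simpa using f5
        have r1 := f5'.of_append.update_last hx (acc + G k)
        refine r1.snoc (x := x + 1) (by simp [hx]) ?_
        simp only
        rw [Function.update_of_ne (by omega)]
        exact f5.1 (x + 1) k (by simp [hx])
      · simp [hl5, hl4, hout]
    · intro h
      rw [et] at h
      have hGk : G k = 0 := by
        by_cases h' : I[k].1 / n = τ
        · simp [h'] at h
        · simp [hG, h']
      refine wp_skip (done _ ?_ hout)
      rw [hGk, add_zero]
      simpa using (f3.of_append).of_append
  · rintro σ' ⟨h1, h2⟩
    exact ⟨h1, [], by simp [h2], rfl⟩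

end tag

/-! ### The programs of the rounds -/

/-- The message `(τ * n + a, y)` to machine `d`. -/
def msg (n d τ a y : ℕ) : Message := ⟨d, τ * n + a, y⟩

/-- The key with tag `τ`. -/
def tagKey (τ : ℕ) (e : Expr) : Expr := .add (.mul (.const τ) (.reg 0)) e

/-- Whether `{u, w} = {x, y}`. -/
def hitExpr (u w x y : ℕ) : Expr :=
  .add (.mul (.eq (.reg u) (.reg x)) (.eq (.reg w) (.reg y)))
    (.mul (.eq (.reg u) (.reg y)) (.eq (.reg w) (.reg x)))

/-- The address of the cell of vertex `e` behind the received pairs. -/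
def cellExpr (e : Expr) : Expr := .add (.mul (.const 2) (.reg 4)) e

namespace Program

/-- Send all pairs with tag `τ` to the machine itself. -/
def keep (τ : ℕ) : Program := .forTag τ 5 (.send (.reg 2) (tagKey τ (.reg 8)) (.reg 7))

/-- For every vertex count the held edges to the clique. -/
def countRound : Program :=
  .seq (keep 0) <| .seq (keep 3) <|
  .forLoop 5 (.reg 0) <| .seq (.sumTag 3 6 (.sumTag 0 11 .skip (hitExpr 15 14 5 10)) (.reg 11)) <|
    .send (.mod (.reg 5) (.reg 1)) (tagKey 6 (.reg 5)) (.reg 6)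

/-- Report the vertices that are adjacent to the whole clique to machine `0`. -/
def activeRound : Program :=
  .seq (keep 0) <| .seq (keep 3) <|
  .forLoop 5 (.reg 0) <| .when (.eq (.mod (.reg 5) (.reg 1)) (.reg 2)) <|
    .seq (.sumTag 6 6 .skip (.mul (.eq (.reg 10) (.reg 5)) (.reg 9))) <|
    .seq (.sumTag 3 7 .skip (.const 1)) <|
    .when (.eq (.reg 6) (.reg 7)) <| .send (.const 0) (tagKey 1 (.reg 5)) (.const 0)

/-- Label the sampled active vertices. -/
def labelRound : Program :=
  .seq (keep 0) <| .seq (keep 3) <|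
  .forTag 1 5 <| .seq (.load 9 (cellExpr (.reg 8))) <| .when (.reg 9) <|
    .seq (.sumTag 1 10 (.load 15 (cellExpr (.reg 14))) (.mul (.reg 15) (.lt (.reg 14) (.reg 8)))) <|
    .send (.mod (.reg 10) (.reg 1)) (tagKey 2 (.reg 10)) (.reg 8)

/-- Send the labelled vertices to all machines. -/
def shareRound : Program :=
  .seq (keep 0) <| .seq (keep 3) <|
  .forTag 2 5 <| .forLoop 9 (.reg 1) <| .send (.reg 9) (tagKey 2 (.reg 8)) (.reg 7)

/-- Send the held edges between labelled vertices to the machines that collect their rows. -/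
def rowRound : Program :=
  .seq (keep 0) <| .seq (keep 3) <| .seq (keep 2) <|
  .forTag 2 5 <| .forTag 2 9 <| .seq (.sumTag 0 13 .skip (hitExpr 17 16 7 11)) <|
    .when (.reg 13) <| .send (.mod (.reg 8) (.reg 1)) (tagKey 4 (.reg 7)) (.reg 11)

/-- Report the missing edges between labelled vertices to machine `0`. -/
def missingRound : Program :=
  .seq (keep 0) <| .seq (keep 3) <| .seq (keep 2) <|
  .forTag 2 5 <| .when (.eq (.mod (.reg 8) (.reg 1)) (.reg 2)) <|
    .forTag 2 9 <| .when (.lt (.reg 11) (.reg 7)) <|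
    .seq (.sumTag 4 13 .skip (.mul (.eq (.reg 17) (.reg 7)) (.eq (.reg 16) (.reg 11)))) <|
    .when (.eq (.reg 13) (.const 0)) <| .send (.const 0) (tagKey 5 (.reg 7)) (.reg 11)

/-- Machine `0` scatters the chosen vertices. -/
def chosenRound : Program :=
  .seq (keep 0) <| .seq (keep 3) <|
  .when (.eq (.reg 2) (.const 0)) <| .forTag 2 5 <| .seq (.load 9 (cellExpr (.reg 7))) <|
    .when (.reg 9) <| .send (.mod (.reg 8) (.reg 1)) (tagKey 2 (.reg 8)) (.reg 7)

/-- Add the chosen vertices to the clique on all machines. -/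
def extendRound : Program :=
  .seq (keep 0) <| .seq (keep 3) <|
  .forTag 2 5 <| .forLoop 9 (.reg 1) <| .send (.reg 9) (tagKey 3 (.reg 7)) (.const 0)

/-- Machine `0` outputs the clique with the chosen vertices. -/
def outputRound : Program :=
  .when (.eq (.reg 2) (.const 0)) <|
  .seq (.forTag 3 5 <| .send (.const 0) (tagKey 0 (.reg 8)) (.const 0)) <|
  .forTag 2 5 <| .seq (.load 9 (cellExpr (.reg 7))) <|
    .when (.reg 9) <| .send (.const 0) (tagKey 0 (.reg 7)) (.const 0)

end Program

/-! ### The messages sent in the rounds -/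

/-- A machine in some round: the received pairs and the parameters fit. -/
structure Fits (c : Machine) (mem : ℕ → ℕ) (n M i t : ℕ) (I : Inbox) : Prop
    extends Holds c mem n I [n, M, i, t, I.length] where
  M_lt : M < c.W
  i_lt : i < M
  n_pos : 0 < n
  M_le : M ≤ c.B
  n_le : n ≤ c.B
  n_words : 8 * n < c.W
  cells : 2 * I.length + n ≤ c.S
  cells_lt : 2 * I.length + n < c.W

/-- The number of orders in which the pair `p` is `{x, y}`. -/
def hit (x y : ℕ) (p : ℕ × ℕ) : ℕ :=
  (if p.1 = x then 1 else 0) * (if p.2 = y then 1 else 0) +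
    (if p.1 = y then 1 else 0) * (if p.2 = x then 1 else 0)

theorem hit_le (x y : ℕ) (p : ℕ × ℕ) : hit x y p ≤ 2 := by
  unfold hit
  split_ifs <;> simp

theorem EvalsTo.tagKey {W : ℕ} {env : List ℕ} {e : Expr} {n τ x : ℕ} (hn : env[0]? = some n)
    (hτ : τ ≤ 6) (hW : 8 * n < W) (hW' : 8 < W) (hx : x < n) (he : EvalsTo W env e x) :
    EvalsTo W env (tagKey τ e) (τ * n + x) :=
  have h : τ * n + x < W := by nlinarith
  .add (.mul (.const (by omega)) (.reg hn (by omega)) (by omega)) he h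

theorem EvalsTo.hitExpr {W : ℕ} {env : List ℕ} {u w x y : ℕ} {u' w' x' y' : ℕ}
    (hu : env[u]? = some u') (hw : env[w]? = some w') (hx : env[x]? = some x')
    (hy : env[y]? = some y') (hW : 8 < W) (hu' : u' < W) (hw' : w' < W) (hx' : x' < W)
    (hy' : y' < W) : EvalsTo W env (hitExpr u w x y) (hit x' y' (u', w')) := by
  have h : ∀ {a b a' b' : ℕ}, env[a]? = some a' → env[b]? = some b' → a' < W → b' < W →
      EvalsTo W env (.eq (.reg a) (.reg b)) (if a' = b' then 1 else 0) :=
    fun h1 h2 h3 h4 => .eq (.reg h1 h3) (.reg h2 h4) (by omega)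
  refine .add (.mul (h hu hx hu' hx') (h hw hy hw' hy') ?_)
    (.mul (h hu hy hu' hy') (h hw hx hw' hx') ?_) (lt_of_le_of_lt (hit_le x' y' (u', w')) (by omega))
  all_goals split_ifs <;> simp <;> omega

section rounds

variable {c : Machine} {mem : ℕ → ℕ} {n M i t : ℕ} {I : Inbox}

theorem Fits.sel_lt (H : Fits c mem n M i t I) {τ a y : ℕ} (h : (a, y) ∈ sel n τ I) :
    a < n ∧ y < c.W := by
  rw [sel, Multiset.mem_map] at h
  obtain ⟨p, hp, h⟩ := h
  rw [Prod.mk.injEq] at h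
  rw [← h.1, ← h.2]
  exact ⟨Nat.mod_lt _ H.n_pos, H.val_lt p (by simpa using Multiset.mem_of_mem_filter hp)⟩

theorem card_sel_le (n τ : ℕ) (I : Multiset (ℕ × ℕ)) : Multiset.card (sel n τ I) ≤ Multiset.card I := by
  rw [sel, Multiset.card_map]
  exact Multiset.card_le_card (Multiset.filter_le _ _)

theorem Fits.evalsTo_cell (H : Fits c mem n M i t I) {ext : List ℕ} {e : Expr} {x : ℕ} (hx : x < n)
    (he : EvalsTo c.W ([n, M, i, t, I.length] ++ ext) e x) :
    EvalsTo c.W ([n, M, i, t, I.length] ++ ext) (cellExpr e) (2 * I.length + x) := by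
  have h1 := H.one_lt
  have h2 := H.cells_lt
  exact .add (.mul (.const (by omega)) (.reg rfl (by omega)) (by omega)) he (by omega)

theorem sum_map_singleton' {α β : Type*} (S : Multiset α) (f : α → β) :
    (S.map fun p => ({f p} : Multiset β)).sum = S.map f := by
  rw [← Multiset.sum_map_singleton (S.map f), Multiset.map_map]
  rfl

theorem Tr.keep (H : Fits c mem n M i t I) (τ : ℕ) (hτ : τ ≤ 6) :
    Tr c mem (.keep τ) [n, M, i, t, I.length] []
      ((sel n τ I).map fun p => msg n i τ p.1 p.2) := by
  refine (Tr.forTag H.toHolds (by omega) rfl (f := fun p => {msg n i τ p.1 p.2}) ?_).congr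
    (sum_map_singleton' _ _)
  intro k key a y hp
  obtain ⟨h1, h2⟩ := H.sel_lt hp
  have h3 := H.M_lt
  have h4 := H.i_lt
  have h5 := H.n_words
  exact .send (.reg rfl (by omega)) (.tagKey rfl hτ h5 H.one_lt h1 (.reg rfl (by omega)))
    (.reg rfl h2)

/-- The number of edges in `E` from `v` to vertices in `C`. -/
def edgesTo (E C : Multiset (ℕ × ℕ)) (v : ℕ) : ℕ :=
  (C.map fun c => (E.map (hit v c.1)).sum).sum

theorem sum_map_le_card {α : Type*} (S : Multiset α) (f : α → ℕ) (b : ℕ) (h : ∀ x ∈ S, f x ≤ b) :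
    (S.map f).sum ≤ Multiset.card S * b := by
  simpa using Multiset.sum_le_card_nsmul (S.map f) b (by simpa using h)

/-- Each pair contributes at most `2`, so a count is at most `2 * I.length * I.length`. Sending the
counts for `v` to machine `v % M` balances the load. -/
theorem Tr.countRound (H : Fits c mem n M i t I) (hW : 2 * I.length * I.length < c.W) :
    Tr c mem .countRound [n, M, i, t, I.length] []
      ((sel n 0 I).map (fun p => msg n i 0 p.1 p.2) +
        ((sel n 3 I).map (fun p => msg n i 3 p.1 p.2) +
          ∑ v ∈ Finset.range n, {msg n (v % M) 6 v (edgesTo (sel n 0 I) (sel n 3 I) v)})) := by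
  have h3 := H.M_lt
  have h4 := H.i_lt
  have h5 := H.n_words
  have h6 := H.one_lt
  have hc : ∀ τ, Multiset.card (sel n τ I) ≤ I.length := fun τ => by
    simpa using card_sel_le n τ I
  have hin : ∀ x y, ((sel n 0 I).map (hit x y)).sum ≤ 2 * I.length := fun x y => by
    have := sum_map_le_card (sel n 0 I) (hit x y) 2 (fun p _ => hit_le x y p)
    have := hc 0
    omega
  have hout : ∀ v, edgesTo (sel n 0 I) (sel n 3 I) v < c.W := fun v => by
    have h1 := sum_map_le_card (sel n 3 I) (fun c => ((sel n 0 I).map (hit v c.1)).sum)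
      (2 * I.length) (fun c _ => hin v c.1)
    have h2 := hc 3
    calc edgesTo (sel n 0 I) (sel n 3 I) v ≤ Multiset.card (sel n 3 I) * (2 * I.length) := h1
      _ ≤ I.length * (2 * I.length) := by gcongr
      _ < c.W := by linarith
  refine (Tr.keep H 0 (by omega)).both ((Tr.keep H 3 (by omega)).both ?_)
  refine .forLoop rfl (.reg rfl H.n_lt) H.n_le H.n_lt fun v hv => ?_
  refine ((Tr.sumTag (H.append _) (by omega) rfl (hout v)
    (g := fun c => ((sel n 0 I).map (hit v c.1)).sum) ?_).seq
    (.send (.mod (.reg rfl (by omega)) (.reg rfl h3) (by omega))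
      (.tagKey rfl (by omega) h5 h6 hv (.reg rfl (by omega))) (.reg rfl (hout v)))).shrink.congr
      (zero_add _)
  intro acc k key a y hp
  obtain ⟨h1, h2⟩ := H.sel_lt hp
  have h8 := H.len_lt
  refine ⟨_, Tr.sumTag (g := hit v a) ((H.append [v]).append _) (by omega) rfl ((hin v a).trans_lt h8) ?_,
    .reg rfl ((hin v a).trans_lt h8)⟩
  intro acc k key u w hp
  obtain ⟨h1', h2'⟩ := H.sel_lt hp
  exact ⟨[], .skip, .hitExpr rfl rfl rfl rfl h6 (by omega) h2' (by omega) (by omega)⟩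

/-- Only machine `v % M` has received the counts for `v`, so only this machine may decide whether
they add up to the number of clique vertices. -/
theorem Tr.activeRound (H : Fits c mem n M i t I)
    (hW : ((sel n 6 I).map fun p => p.2).sum < c.W) :
    Tr c mem .activeRound [n, M, i, t, I.length] []
      ((sel n 0 I).map (fun p => msg n i 0 p.1 p.2) +
        ((sel n 3 I).map (fun p => msg n i 3 p.1 p.2) +
          ∑ v ∈ Finset.range n, if v % M = i ∧ ((sel n 6 I).map fun p =>
            (if p.1 = v then 1 else 0) * p.2).sum = Multiset.card (sel n 3 I) then
            {msg n 0 1 v 0} else 0)) := by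
  have h3 := H.M_lt
  have h4 := H.i_lt
  have h5 := H.n_words
  have h6 := H.one_lt
  have h7 := H.len_lt
  have hc : Multiset.card (sel n 3 I) ≤ I.length := by
    simpa using card_sel_le n 3 I
  refine (Tr.keep H 0 (by omega)).both ((Tr.keep H 3 (by omega)).both ?_)
  refine .forLoop rfl (.reg rfl H.n_lt) H.n_le H.n_lt fun v hv => ?_
  have hle : ((sel n 6 I).map fun p => (if p.1 = v then 1 else 0) * p.2).sum < c.W := by
    refine lt_of_le_of_lt (Multiset.sum_map_le_sum_map _ _ fun p _ => ?_) hW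
    split_ifs <;> simp
  refine (Tr.when (L := if ((sel n 6 I).map fun p =>
            (if p.1 = v then 1 else 0) * p.2).sum = Multiset.card (sel n 3 I) then
            {msg n 0 1 v 0} else 0) (.eq (.mod (.reg rfl (by omega)) (.reg rfl h3) (by omega))
    (.reg rfl (by omega)) (by omega)) ?_).congr ?_
  · intro _
    have s2 : Tr c mem (.sumTag 3 7 .skip (.const 1)) ([n, M, i, t, I.length, v] ++
        [((sel n 6 I).map fun p => (if p.1 = v then 1 else 0) * p.2).sum])
        [Multiset.card (sel n 3 I)] 0 := by
      have := Tr.sumTag (x := 7) (mem := mem) (g := fun _ => 1) (e := .const 1) (p := .skip) (τ := 3)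
        ((H.append [v]).append
        [((sel n 6 I).map fun p => (if p.1 = v then 1 else 0) * p.2).sum]) (by omega) rfl
        (by simp; omega) (fun acc k key a y hp => ⟨[], .skip, .const (by omega)⟩)
      simpa using this
    have s1 := (Tr.sumTag (x := 6) (p := .skip) (e := .mul (.eq (.reg 10) (.reg 5)) (.reg 9))
      (mem := mem) (H.append [v]) (by omega) rfl hle
      (fun acc k key a y hp => ⟨[], .skip, by
        obtain ⟨h1, h2⟩ := H.sel_lt hp
        refine .mul (.eq (.reg rfl (by omega)) (.reg rfl (by omega)) (by omega)) (.reg rfl h2) ?_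
        split_ifs <;> simp <;> omega⟩)).seq (s2.seq
      (Tr.when (L := {msg n 0 1 v 0}) (e := .eq (.reg 6) (.reg 7))
        (.eq (.reg rfl hle) (.reg rfl (by omega)) (by omega)) fun _ =>
        .send (d := .const 0) (k := tagKey 1 (.reg 5)) (v := .const 0) (.const (by omega)) (.tagKey rfl (by omega) h5 h6 hv (.reg rfl (by omega)))
          (.const (by omega))))
    refine s1.shrink.congr ?_
    simp
  · by_cases hv : v % M = i <;> simp [hv]

/-- The sum of the cells of the active vertices below `v`. -/
def rankIn (cell : ℕ → ℕ) (X : Multiset (ℕ × ℕ)) (v : ℕ) : ℕ :=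
  (X.map fun p => cell p.1 * if p.1 < v then 1 else 0).sum

/-- A label is the rank among the sampled vertices. Labels are therefore consecutive, and reducing
them modulo `M` distributes the sample evenly. -/
theorem Tr.labelRound (H : Fits c mem n M i t I) {cell : ℕ → ℕ}
    (hcell : ∀ v < n, mem (2 * I.length + v) = cell v) (hcell' : ∀ v < n, cell v ≤ 1)
    (hrank : ∀ p ∈ sel n 1 I, cell p.1 ≠ 0 → rankIn cell (sel n 1 I) p.1 < n) :
    Tr c mem .labelRound [n, M, i, t, I.length] []
      ((sel n 0 I).map (fun p => msg n i 0 p.1 p.2) +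
        ((sel n 3 I).map (fun p => msg n i 3 p.1 p.2) +
          ((sel n 1 I).map fun p => if cell p.1 ≠ 0 then
            {msg n (rankIn cell (sel n 1 I) p.1 % M) 2 (rankIn cell (sel n 1 I) p.1) p.1}
            else 0).sum)) := by
  have h3 := H.M_lt
  have h4 := H.i_lt
  have h5 := H.n_words
  have h6 := H.one_lt
  have h7 := H.cells
  refine (Tr.keep H 0 (by omega)).both ((Tr.keep H 3 (by omega)).both ?_)
  refine .forTag H.toHolds (by omega) rfl fun k key v y hp => ?_
  obtain ⟨hv, -⟩ := H.sel_lt hp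
  have hcv := hcell' v hv
  have l1 : Tr c mem (.load 9 (cellExpr (.reg 8))) ([n, M, i, t, I.length] ++ [k, key, y, v])
      [cell v] 0 := by
    rw [← hcell v hv]
    exact .load rfl (H.evalsTo_cell hv (.reg rfl (by omega))) (by omega)
  refine (l1.seq (Tr.when (L := {msg n (rankIn cell (sel n 1 I) v % M) 2
    (rankIn cell (sel n 1 I) v) v}) (.reg rfl (by dsimp only; omega)) fun h => ?_)).shrink.congr (zero_add _)
  have hr := hrank _ hp h
  simp only at hr
  have s1 := Tr.sumTag (x := 10) (p := .load 15 (cellExpr (.reg 14))) (mem := mem) (τ := 1)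
    (e := .mul (.reg 15) (.lt (.reg 14) (.reg 8)))
    (g := fun p => cell p.1 * if p.1 < v then 1 else 0)
    ((H.append [k, key, y, v]).append [cell v]) (by omega) rfl (hr.trans (by omega)) (by
      intro acc k' key' w y' hw
      obtain ⟨hw', -⟩ := H.sel_lt hw
      have hcw := hcell' w hw'
      refine ⟨[cell w], ?_, ?_⟩
      · rw [← hcell w hw', List.append_assoc, List.append_assoc]
        exact .load rfl (H.evalsTo_cell hw' (.reg rfl (by omega))) (by omega)
      · refine .mul (.reg rfl (by dsimp only; omega)) (.lt (.reg rfl (by omega)) (.reg rfl (by omega)) (by omega)) ?_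
        split_ifs <;> simp <;> omega)
  refine (s1.seq (.send (.mod (.reg rfl ?_) (.reg rfl h3) ?_) (.tagKey rfl (by omega) h5 h6 hr
    (.reg rfl ?_)) (.reg rfl (by omega)))).shrink.congr (zero_add _)
  all_goals omega

/-- Second hop of a broadcast: every machine forwards its share of the labels to all machines. A
direct broadcast would make machine `0` send `M` copies of the entire sample. -/
theorem Tr.shareRound (H : Fits c mem n M i t I) :
    Tr c mem .shareRound [n, M, i, t, I.length] []
      ((sel n 0 I).map (fun p => msg n i 0 p.1 p.2) +
        ((sel n 3 I).map (fun p => msg n i 3 p.1 p.2) +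
          ((sel n 2 I).map fun p => ∑ j ∈ Finset.range M, {msg n j 2 p.1 p.2}).sum)) := by
  have h3 := H.M_lt
  have h5 := H.n_words
  refine (Tr.keep H 0 (by omega)).both ((Tr.keep H 3 (by omega)).both ?_)
  refine .forTag H.toHolds (by omega) rfl fun k key v y hp => ?_
  obtain ⟨hv, hy⟩ := H.sel_lt hp
  exact .forLoop rfl (.reg rfl h3) H.M_le h3 fun j hj => .send (.reg rfl (by omega))
    (.tagKey rfl (by omega) h5 H.one_lt hv (.reg rfl (by omega))) (.reg rfl hy)

theorem Tr.extendRound (H : Fits c mem n M i t I) (hn : ∀ p ∈ sel n 2 I, p.2 < n) :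
    Tr c mem .extendRound [n, M, i, t, I.length] []
      ((sel n 0 I).map (fun p => msg n i 0 p.1 p.2) +
        ((sel n 3 I).map (fun p => msg n i 3 p.1 p.2) +
          ((sel n 2 I).map fun p => ∑ j ∈ Finset.range M, {msg n j 3 p.2 0}).sum)) := by
  have h3 := H.M_lt
  have h5 := H.n_words
  refine (Tr.keep H 0 (by omega)).both ((Tr.keep H 3 (by omega)).both ?_)
  refine .forTag H.toHolds (by omega) rfl fun k key v y hp => ?_
  have hy := hn _ hp
  exact .forLoop rfl (.reg rfl h3) H.M_le h3 fun j hj => .send (.reg rfl (by omega))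
    (.tagKey rfl (by omega) h5 H.one_lt hy (.reg rfl (by omega))) (.const (by omega))

/-- Both orders of a held edge occur among the ordered pairs of labelled vertices, so each end
point's row receives the edge. -/
theorem Tr.rowRound (H : Fits c mem n M i t I) (hn : ∀ p ∈ sel n 2 I, p.2 < n) :
    Tr c mem .rowRound [n, M, i, t, I.length] []
      ((sel n 0 I).map (fun p => msg n i 0 p.1 p.2) +
        ((sel n 3 I).map (fun p => msg n i 3 p.1 p.2) +
        ((sel n 2 I).map (fun p => msg n i 2 p.1 p.2) +
          ((sel n 2 I).map fun p => ((sel n 2 I).map fun q =>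
            if ((sel n 0 I).map (hit p.2 q.2)).sum ≠ 0 then {msg n (p.1 % M) 4 p.2 q.2}
            else 0).sum).sum))) := by
  have h3 := H.M_lt
  have h5 := H.n_words
  have h6 := H.one_lt
  refine (Tr.keep H 0 (by omega)).both ((Tr.keep H 3 (by omega)).both
    ((Tr.keep H 2 (by omega)).both ?_))
  refine .forTag H.toHolds (by omega) rfl fun k key a x hp => ?_
  refine .forTag (H.append _) (by omega) rfl fun k' key' b y hq => ?_
  have hx := hn _ hp
  have hy := hn _ hq
  have ha := (H.sel_lt hp).1
  simp only at hx hy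
  have hin : ((sel n 0 I).map (hit x y)).sum < c.W := by
    have h1 := sum_map_le_card (sel n 0 I) (hit x y) 2 (fun p _ => hit_le x y p)
    have h2 := card_sel_le n 0 I
    have h7 := H.len_lt
    rw [Multiset.coe_card] at h2
    omega
  have s1 := Tr.sumTag (x := 13) (p := .skip) (e := hitExpr 17 16 7 11) (mem := mem) (τ := 0)
    ((H.append [k, key, x, a]).append [k', key', y, b]) (by omega) rfl hin (by
      intro acc k key u w hp
      obtain ⟨h1', h2'⟩ := H.sel_lt hp
      exact ⟨[], .skip, .hitExpr rfl rfl rfl rfl h6 (by omega) h2' (by omega) (by omega)⟩)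
  exact (s1.seq (.when (.reg rfl hin) fun _ => .send (.mod (.reg rfl (by omega)) (.reg rfl h3)
    (by omega)) (.tagKey rfl (by omega) h5 h6 hx (.reg rfl (by omega)))
    (.reg rfl (by omega)))).shrink.congr (zero_add _)

/-- The absence of an edge shows only where a complete row is present. The restriction `q.2 < p.2`
reports each non-edge once, oriented towards the vertex that the greedy scan meets earlier. -/
theorem Tr.missingRound (H : Fits c mem n M i t I) (hn : ∀ p ∈ sel n 2 I, p.2 < n) :
    Tr c mem .missingRound [n, M, i, t, I.length] []
      ((sel n 0 I).map (fun p => msg n i 0 p.1 p.2) +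
        ((sel n 3 I).map (fun p => msg n i 3 p.1 p.2) +
        ((sel n 2 I).map (fun p => msg n i 2 p.1 p.2) +
          ((sel n 2 I).map fun p => if p.1 % M = i then ((sel n 2 I).map fun q =>
            if q.2 < p.2 ∧ (p.2, q.2) ∉ sel n 4 I then {msg n 0 5 p.2 q.2}
            else 0).sum else 0).sum))) := by
  have h3 := H.M_lt
  have h4 := H.i_lt
  have h5 := H.n_words
  have h6 := H.one_lt
  refine (Tr.keep H 0 (by omega)).both ((Tr.keep H 3 (by omega)).both
    ((Tr.keep H 2 (by omega)).both ?_))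
  refine .forTag H.toHolds (by omega) rfl fun k key a x hp => ?_
  have ha := (H.sel_lt hp).1
  have hx := hn _ hp
  simp only at hx
  refine (Tr.when (.eq (.mod (.reg rfl (by omega)) (.reg rfl h3) (by omega)) (.reg rfl (by omega))
    (by omega)) fun _ => .forTag (H.append _) (by omega) rfl fun k' key' b y hq => ?_).congr
    (L := if (if a % M = i then 1 else 0) ≠ 0 then ((sel n 2 I).map fun q =>
            if q.2 < x ∧ (x, q.2) ∉ sel n 4 I then {msg n 0 5 x q.2} else 0).sum else 0)
    (by simp)
  have hy := hn _ hq
  simp only at hy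
  set s := ((sel n 4 I).map fun p => (if p.1 = x then 1 else 0) * if p.2 = y then 1 else 0).sum
    with hs
  have hin : s < c.W := by
    have h1 := sum_map_le_card (sel n 4 I)
      (fun p => (if p.1 = x then 1 else 0) * if p.2 = y then 1 else 0) 1
      (fun p _ => by split_ifs <;> simp)
    have h2 := card_sel_le n 4 I
    have h7 := H.len_lt
    rw [Multiset.coe_card] at h2
    omega
  have hs0 : s = 0 ↔ (x, y) ∉ sel n 4 I := by
    rw [hs, Multiset.sum_eq_zero_iff]
    constructor
    · intro h hm
      have := h _ (Multiset.mem_map_of_mem _ hm)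
      simp at this
    · intro h z hz
      obtain ⟨⟨u, w⟩, hp, rfl⟩ := Multiset.mem_map.1 hz
      by_contra hne
      simp only [mul_eq_zero, ite_eq_right_iff, one_ne_zero, imp_false, not_or, not_not] at hne
      rw [hne.1, hne.2] at hp
      exact h hp
  refine (Tr.when (L := if s = 0 then {msg n 0 5 x y} else 0)
    (.lt (.reg rfl (by omega)) (.reg rfl (by omega)) (by omega)) fun _ => ?_).congr (by
      by_cases hyx : y < x <;> simp [hyx, hs0])
  have s1 := Tr.sumTag (x := 13) (p := .skip) (mem := mem) (τ := 4)
    (e := .mul (.eq (.reg 17) (.reg 7)) (.eq (.reg 16) (.reg 11)))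
    ((H.append [k, key, x, a]).append [k', key', y, b]) (by omega) rfl hin (by
      intro acc k key u w hp
      obtain ⟨h1', h2'⟩ := H.sel_lt hp
      refine ⟨[], .skip, .mul (.eq (.reg rfl (by omega)) (.reg rfl (by omega)) (by omega))
        (.eq (.reg rfl (by omega)) (.reg rfl (by omega)) (by omega)) ?_⟩
      split_ifs <;> simp <;> omega)
  refine (s1.seq (.when (.eq (.reg rfl hin) (.const (by omega)) (by omega)) fun _ =>
    .send (.const (by omega)) (.tagKey rfl (by omega) h5 h6 hx (.reg rfl (by omega)))
    (.reg rfl (by omega)))).shrink.congr ?_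
  simp [msg, hs]

theorem Tr.chosenRound (H : Fits c mem n M i t I) (hn : ∀ p ∈ sel n 2 I, p.2 < n) {cell : ℕ → ℕ}
    (hcell : ∀ v < n, mem (2 * I.length + v) = cell v) (hcell' : ∀ v < n, cell v ≤ 1) :
    Tr c mem .chosenRound [n, M, i, t, I.length] []
      ((sel n 0 I).map (fun p => msg n i 0 p.1 p.2) +
        ((sel n 3 I).map (fun p => msg n i 3 p.1 p.2) +
          if i = 0 then ((sel n 2 I).map fun p =>
            if cell p.2 ≠ 0 then {msg n (p.1 % M) 2 p.1 p.2} else 0).sum else 0)) := by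
  have h3 := H.M_lt
  have h4 := H.i_lt
  have h5 := H.n_words
  have h6 := H.one_lt
  have h7 := H.cells
  refine (Tr.keep H 0 (by omega)).both ((Tr.keep H 3 (by omega)).both ?_)
  refine (Tr.when (L := ((sel n 2 I).map fun p =>
            if cell p.2 ≠ 0 then {msg n (p.1 % M) 2 p.1 p.2} else 0).sum)
    (.eq (.reg rfl (by omega)) (.const (by omega)) (by omega)) fun _ => ?_).congr
    (by simp)
  refine .forTag H.toHolds (by omega) rfl fun k key a x hp => ?_
  have ha := (H.sel_lt hp).1
  have hx := hn _ hp
  simp only at hx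
  have hcx := hcell' x hx
  have l1 : Tr c mem (.load 9 (cellExpr (.reg 7))) ([n, M, i, t, I.length] ++ [k, key, x, a])
      [cell x] 0 := by
    rw [← hcell x hx]
    exact .load rfl (H.evalsTo_cell hx (.reg rfl (by omega))) (by omega)
  exact (l1.seq (.when (.reg rfl (by dsimp only; omega)) fun _ => .send (.mod (.reg rfl (by omega))
    (.reg rfl h3) (by omega)) (.tagKey rfl (by omega) h5 h6 ha (.reg rfl (by omega)))
    (.reg rfl (by omega)))).shrink.congr (zero_add _)

/-- With tag `0` the delivered key is the vertex itself, as the output format demands. -/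
theorem Tr.outputRound (H : Fits c mem n M i t I) (hn : ∀ p ∈ sel n 2 I, p.2 < n) {cell : ℕ → ℕ}
    (hcell : ∀ v < n, mem (2 * I.length + v) = cell v) (hcell' : ∀ v < n, cell v ≤ 1) :
    Tr c mem .outputRound [n, M, i, t, I.length] []
      (if i = 0 then ((sel n 3 I).map (fun p => msg n 0 0 p.1 0) + ((sel n 2 I).map fun p =>
            if cell p.2 ≠ 0 then {msg n 0 0 p.2 0} else 0).sum) else 0) := by
  have h3 := H.M_lt
  have h4 := H.i_lt
  have h5 := H.n_words
  have h6 := H.one_lt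
  have h7 := H.cells
  refine (Tr.when (L := ((sel n 3 I).map (fun p => msg n 0 0 p.1 0) + ((sel n 2 I).map fun p =>
            if cell p.2 ≠ 0 then {msg n 0 0 p.2 0} else 0).sum))
    (.eq (.reg rfl (by omega)) (.const (by omega)) (by omega)) fun _ => ?_).congr
    (by simp)
  refine Tr.both ?_ ?_
  · refine (Tr.forTag H.toHolds (by omega) rfl (f := fun p => {msg n 0 0 p.1 0}) ?_).congr
      (sum_map_singleton' _ _)
    intro k key a y hp
    obtain ⟨h1, h2⟩ := H.sel_lt hp
    exact .send (.const (by omega)) (.tagKey rfl (by omega) h5 H.one_lt h1 (.reg rfl (by omega)))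
      (.const (by omega))
  refine .forTag H.toHolds (by omega) rfl fun k key a x hp => ?_
  have hx := hn _ hp
  simp only at hx
  have hcx := hcell' x hx
  have l1 : Tr c mem (.load 9 (cellExpr (.reg 7))) ([n, M, i, t, I.length] ++ [k, key, x, a])
      [cell x] 0 := by
    rw [← hcell x hx]
    exact .load rfl (H.evalsTo_cell hx (.reg rfl (by omega))) (by omega)
  exact (l1.seq (.when (.reg rfl (by dsimp only; omega)) fun _ => .send (.const (by omega))
    (.tagKey rfl (by omega) h5 h6 hx (.reg rfl (by omega)))
    (.const (by omega)))).shrink.congr (zero_add _)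

end rounds

/-! ### Sampling and the greedy clique -/

namespace Program

/-- `x₅ := ⌊log₂ n⌋ + 1`. -/
def logLoop : Program :=
  .seq (.assign 5 (.const 0)) <| .seq (.assign 6 (.const 1)) <|
  .forLoop 7 (.reg 0) <| .ite (.lt (.reg 0) (.reg 6)) .skip <|
    .seq (.assign 6 (.mul (.const 2) (.reg 6))) (.assign 5 (.add (.reg 5) (.const 1)))

/-- Sample every vertex with probability `2 ^ (-x₈)`; the results are stored behind the received
pairs. -/
def drawLoop : Program :=
  .forLoop 9 (.reg 0) <| .seq (.assign 10 (.const 1)) <|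
    .seq (.forLoop 11 (.reg 8) (.seq (.flip 12) (.assign 10 (.mul (.reg 10) (.reg 12))))) <|
    .store (cellExpr (.reg 9)) (.reg 10)

/-- Sample the vertices for the phase of the current round. -/
def sample (q : ℕ) : Program :=
  .seq logLoop <| .seq (.assign 8 (.sub (.reg 5)
    (.mul (.add (.div (.reg 3) (.const 8)) (.const 1)) (.div (.reg 5) (.const q))))) drawLoop

/-- Choose vertices greedily in increasing order, avoiding the missing edges. -/
def greedy : Program :=
  .forLoop 5 (.reg 0) <|
    .seq (.sumTag 5 6 (.load 11 (cellExpr (.reg 9))) (.mul (.eq (.reg 10) (.reg 5)) (.reg 11))) <|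
    .store (cellExpr (.reg 5)) (.eq (.reg 6) (.const 0))

end Program

theorem Frame.update_of_le {env : List ℕ} {mem : ℕ → ℕ} {σ : LocalState} (h : Frame env mem σ)
    {x : ℕ} (hx : env.length ≤ x) (v : ℕ) :
    Frame env mem { σ with reg := Function.update σ.reg x v } := by
  refine ⟨fun k w hk => ?_, h.2⟩
  have := (List.getElem?_eq_some_iff.1 hk).1
  simpa [Function.update_of_ne (show k ≠ x by omega)] using h.1 k w hk

theorem MemHolds.update {mem : ℕ → ℕ} {I : Inbox} (h : MemHolds mem I) {x : ℕ}
    (hx : 2 * I.length ≤ x) (v : ℕ) : MemHolds (Function.update mem x v) I := by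
  intro k hk
  rw [Function.update_of_ne (by omega), Function.update_of_ne (by omega)]
  exact h k hk

theorem Fits.change {c : Machine} {mem mem' : ℕ → ℕ} {n M i t : ℕ} {I : Inbox}
    (H : Fits c mem n M i t I) (h : MemHolds mem' I) : Fits c mem' n M i t I :=
  { H with mem := h }

theorem initState_mem_eq (I : Inbox) (x : ℕ) (hx : 2 * I.length ≤ x) :
    (I.flatMap fun p => [p.1, p.2]).getD x 0 = 0 := by
  rw [List.getD_eq_default]
  simp only [List.length_flatMap, List.length_cons, List.length_nil, List.map_const', List.sum_replicate]
  simpa [mul_comm] using hx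

theorem memHolds_initState (n M i t : ℕ) (I : Inbox) : MemHolds (initState n M i t I).mem I := by
  intro k hk
  simp only [initState]
  induction I generalizing k with
  | nil => simp at hk
  | cons p I ih =>
    cases k with
    | zero => simp
    | succ k =>
      have := ih k (by simpa using hk)
      have h1 : 2 * (k + 1) = 2 * k + 1 + 1 := by ring
      simpa [h1, List.getD_cons_succ] using this

theorem frame_initState (n M i t : ℕ) (I : Inbox) :
    Frame [n, M, i, t, I.length] (initState n M i t I).mem (initState n M i t I) := by
  refine ⟨fun k v hk => ?_, rfl⟩
  simp only [initState]
  rw [List.getD_eq_getElem?_getD, hk]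
  rfl

/-- The exponent of the sampling probability in phase `i`. -/
def sampleExp (q n i : ℕ) : ℕ := (Nat.log 2 n + 1) - (i + 1) * ((Nat.log 2 n + 1) / q)

/-- Whether vertex `v` is sampled, when the probability is `2 ^ (-e)`. -/
def sampled (coin : ℕ → Bool) (e v : ℕ) : Prop := ∀ j < e, coin (v * e + j) = true

open Classical in
/-- The value `1` if vertex `v` is sampled and `0` otherwise. -/
noncomputable def sampleCell (coin : ℕ → Bool) (e v : ℕ) : ℕ := if sampled coin e v then 1 else 0

section

variable {c : Machine} {mem : ℕ → ℕ} {n M i t : ℕ} {I : Inbox}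

/-- Register `6` doubles until it exceeds `n`, and register `5` counts the doublings; the minimum in
the invariant covers the idle iterations afterwards. -/
theorem wp_logLoop (H : Fits c mem n M i t I) {σ : LocalState}
    (hσ : Frame [n, M, i, t, I.length] mem σ) :
    wp c .logLoop σ fun σ' => Frame [n, M, i, t, I.length] mem σ' ∧
      σ'.reg 5 = Nat.log 2 n + 1 ∧ σ'.out = σ.out ∧ σ'.used = σ.used := by
  have h3 := H.n_words
  have h4 := H.n_pos
  have h5 := H.one_lt
  have hlog : Nat.log 2 n < n := Nat.log_lt_self 2 (by omega)
  apply wp_seq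
  apply wp_assign
  apply wp_seq
  apply wp_assign
  refine (wp_forLoop (fun k σ' => Frame [n, M, i, t, I.length] mem σ' ∧
    σ'.reg 5 = min k (Nat.log 2 n + 1) ∧ σ'.reg 6 = 2 ^ min k (Nat.log 2 n + 1) ∧
    σ'.out = σ.out ∧ σ'.used = σ.used) n H.n_le H.n_lt ?_ ?_ ?_).mono ?_
  · exact fun k hk σ h => EvalsTo.reg rfl H.n_lt _ h.1.1
  · refine ⟨((hσ.update_of_le (by simp) _).update_of_le (by simp) _).update_of_le (by simp) _, ?_, ?_,
      rfl, rfl⟩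
    · simp [Expr.eval, Function.update]
    · simp [Expr.eval, Function.update, Nat.mod_eq_of_lt (show 1 < c.W by omega)]
  · rintro k hk σ₁ ⟨f, r5, r6, ho, hu⟩ r7
    have hn : (Expr.reg 0).eval c.W σ₁.reg = n := EvalsTo.reg rfl H.n_lt _ f.1
    have hp : 2 ^ Nat.log 2 n ≤ n := Nat.pow_log_le_self 2 (by omega)
    have hy : 2 ^ min k (Nat.log 2 n + 1) ≤ 2 * n :=
      calc 2 ^ min k (Nat.log 2 n + 1) ≤ 2 ^ (Nat.log 2 n + 1) := by
            gcongr
            · simp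
            · simp
        _ ≤ 2 * n := by rw [pow_succ]; omega
    have h6 : (Expr.reg 6).eval c.W σ₁.reg = 2 ^ min k (Nat.log 2 n + 1) := by
      simp only [Expr.eval, r6]
      exact Nat.mod_eq_of_lt (by omega)
    have hiff : n < 2 ^ min k (Nat.log 2 n + 1) ↔ Nat.log 2 n + 1 ≤ k := by
      rw [← Nat.log_lt_iff_lt_pow (by omega) (by omega)]
      omega
    have hlt : (Expr.lt (.reg 0) (.reg 6)).eval c.W σ₁.reg = if Nat.log 2 n + 1 ≤ k then 1 else 0 := by
      rw [Expr.eval, hn, h6]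
      simp only [hiff]
      exact Nat.mod_eq_of_lt (by split_ifs <;> omega)
    apply wp_ite
    · intro h
      rw [hlt] at h
      have h' : Nat.log 2 n + 1 ≤ k := by
        by_contra h'
        simp [h'] at h
      refine wp_skip ⟨r7, f.update_of_le (by simp) _, ?_, ?_, ho, hu⟩
      · simp [r5]
        omega
      · rw [show min (k + 1) (Nat.log 2 n + 1) = min k (Nat.log 2 n + 1) by omega, ← r6]
        rfl
    · intro h
      rw [hlt] at h
      have h' : ¬ Nat.log 2 n + 1 ≤ k := by
        intro h'
        simp [h'] at h
      have e1 : min k (Nat.log 2 n + 1) = k := by omega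
      have e2 : min (k + 1) (Nat.log 2 n + 1) = k + 1 := by omega
      rw [e1] at h6 hy r5
      have ev6 : (Expr.mul (.const 2) (.reg 6)).eval c.W σ₁.reg = 2 ^ (k + 1) := by
        rw [Expr.eval, h6, Expr.eval, Nat.mod_eq_of_lt (show 2 < c.W by omega),
          Nat.mod_eq_of_lt (by omega), pow_succ, mul_comm]
      apply wp_seq
      apply wp_assign
      apply wp_assign
      refine ⟨by simpa [Function.update] using r7,
        ((f.update_of_le (by simp) _).update_of_le (by simp) _).update_of_le (by simp) _, ?_, ?_, ho, hu⟩
      · simp only [e2, Expr.eval, Function.update, r5]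
        simp [Nat.mod_eq_of_lt (show k + 1 < c.W by omega)]
      · rw [ev6, e2]
        simp [Function.update]
  · rintro σ' ⟨f, r5, -, ho, hu⟩
    exact ⟨f, by rw [r5]; omega, ho, hu⟩

/-- Vertex `v` consumes the block of `e` bits from position `v * e` on, and its cell is their
product. The blocks are disjoint, which later gives independence of the samples. -/
theorem wp_drawLoop (H : Fits c mem n M i t I) {σ : LocalState} {e : ℕ} (he : e ≤ n)
    (hσ : Frame [n, M, i, t, I.length] mem σ) (h8 : σ.reg 8 = e) (hu : σ.used = 0) :
    wp c .drawLoop σ fun σ' => ∃ mem', Frame [n, M, i, t, I.length] mem' σ' ∧ MemHolds mem' I ∧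
      (∀ v < n, mem' (2 * I.length + v) = sampleCell c.coin e v) ∧ σ'.out = σ.out := by
  have h3 := H.n_words
  have h5 := H.one_lt
  have h7 := H.cells
  refine (wp_forLoop (fun k σ' => ∃ mem', Frame [n, M, i, t, I.length] mem' σ' ∧ MemHolds mem' I ∧
      (∀ v < k, mem' (2 * I.length + v) = sampleCell c.coin e v) ∧ σ'.out = σ.out ∧
      σ'.reg 8 = e ∧ σ'.used = k * e) n H.n_le H.n_lt ?_ ?_ ?_).mono ?_
  · exact fun k hk σ ⟨mem', h, _⟩ => EvalsTo.reg rfl H.n_lt _ h.1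
  · exact ⟨mem, hσ.update_of_le (by simp) _, H.mem, by simp, rfl, by simpa [Function.update] using h8,
      by simpa using hu⟩
  · rintro k hk σ₁ ⟨mem', f, hm, hc, ho, r8, hu⟩ r9
    apply wp_seq
    apply wp_assign
    apply wp_seq
    classical
    refine (wp_forLoop (fun j σ' => Frame [n, M, i, t, I.length] mem' σ' ∧ σ'.out = σ.out ∧
      σ'.reg 8 = e ∧ σ'.reg 9 = k ∧ σ'.used = k * e + j ∧
      σ'.reg 10 = if ∀ l < j, c.coin (k * e + l) = true then 1 else 0) e
      (he.trans H.n_le) (by omega) ?_ ?_ ?_).mono ?_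
    · rintro j hj σ₂ h
      simp only [Expr.eval, h.2.2.1]
      exact Nat.mod_eq_of_lt (by omega)
    · refine ⟨(f.update_of_le (by simp) _).update_of_le (by simp) _, ho, ?_, ?_, hu, ?_⟩
      · simpa [Function.update] using r8
      · simpa [Function.update] using r9
      · simp [Function.update, Expr.eval, Nat.mod_eq_of_lt (show 1 < c.W by omega)]
    · rintro j hj σ₂ ⟨f2, ho2, s8, s9, hu2, s10⟩ s11
      apply wp_seq
      apply wp_flip
      apply wp_assign
      refine ⟨by simpa [Function.update] using s11,
        ((f2.update_of_le (x := 12) (by simp) (c.coin σ₂.used).toNat).update_of_le (x := 10)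
          (by simp) _).update_of_le (x := 11) (by simp) _, ho2,
        by simpa [Function.update] using s8, by simpa [Function.update] using s9,
        by simp [hu2, add_assoc], ?_⟩
      simp only [Function.update, Expr.eval, s10, hu2]
      simp only [Nat.forall_lt_succ_right]
      by_cases hA : ∀ l < j, c.coin (k * e + l) = true
      · rw [if_pos hA]
        cases hB : c.coin (k * e + j) <;> simp [Nat.mod_eq_of_lt (show 1 < c.W by omega)]
        exact hA
      · simp [hA]
    · rintro σ₂ ⟨f2, ho2, s8, s9, hu2, s10⟩
      have ea : (cellExpr (.reg 9)).eval c.W σ₂.reg = 2 * I.length + k := by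
        have := (f2.snoc (x := 5) rfl (v := σ₂.reg 5) rfl).snoc (x := 6) rfl (v := σ₂.reg 6) rfl
        have := (this.snoc (x := 7) rfl (v := σ₂.reg 7) rfl).snoc (x := 8) rfl (v := σ₂.reg 8) rfl
        have := this.snoc (x := 9) rfl s9
        exact (H.evalsTo_cell (ext := [σ₂.reg 5, σ₂.reg 6, σ₂.reg 7, σ₂.reg 8, k]) hk
          (.reg rfl (by omega))) _ this.1
      have ev : (Expr.reg 10).eval c.W σ₂.reg = sampleCell c.coin e k := by
        simp only [Expr.eval, s10]
        unfold sampleCell sampled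
        by_cases hA : ∀ j < e, c.coin (k * e + j) = true
        · rw [if_pos hA, if_pos hA, Nat.mod_eq_of_lt (by omega)]
        · rw [if_neg hA, if_neg hA, Nat.zero_mod]
      apply wp_store
      · rw [ea]
        omega
      · rw [ea, ev]
        refine ⟨s9, Function.update σ₂.mem (2 * I.length + k) (sampleCell c.coin e k),
          ⟨(f2.update_of_le (x := 9) (by simp) (k + 1)).1, rfl⟩, ?_, ?_, ho2, ?_, ?_⟩
        · rw [f2.2]
          exact hm.update (by omega) _
        · intro v hv
          by_cases hvk : v = k
          · simp [hvk]
          · rw [Function.update_of_ne (by omega), f2.2]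
            exact hc v (by omega)
        · simpa [Function.update] using s8
        · simp [hu2, add_mul]
  · rintro σ' ⟨mem', h1, h2, h3, h4, -⟩
    exact ⟨mem', h1, h2, h3, h4⟩

theorem wp_sample (H : Fits c mem n M i t I) {q : ℕ} (hq : q < c.W)
    (ht : (t / 8 + 1) * (Nat.log 2 n + 1) < c.W) (htW : t < c.W) {σ : LocalState}
    (hσ : Frame [n, M, i, t, I.length] mem σ) (hu : σ.used = 0) :
    wp c (.sample q) σ fun σ' => ∃ mem', Frame [n, M, i, t, I.length] mem' σ' ∧ MemHolds mem' I ∧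
      (∀ v < n, mem' (2 * I.length + v) = sampleCell c.coin (sampleExp q n (t / 8)) v) ∧
      σ'.out = σ.out := by
  have h3 := H.n_words
  have h5 := H.one_lt
  have hlog : Nat.log 2 n < n := Nat.log_lt_self 2 H.n_pos.ne'
  apply wp_seq
  refine (wp_logLoop H hσ).mono ?_
  rintro σ₁ ⟨f1, r5, ho, hu1⟩
  apply wp_seq
  apply wp_assign
  have f1' := f1.snoc (x := 5) rfl r5
  have ev : (Expr.sub (.reg 5)
    (.mul (.add (.div (.reg 3) (.const 8)) (.const 1)) (.div (.reg 5) (.const q)))).eval c.W σ₁.reg =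
      sampleExp q n (t / 8) := by
    have hd : (Nat.log 2 n + 1) / q ≤ Nat.log 2 n + 1 := Nat.div_le_self _ _
    have htd : t / 8 + 1 < c.W := by omega
    refine EvalsTo.sub (.reg rfl (by omega)) (.mul (.add (.div (.reg rfl htW) (.const (by omega)) htW)
      (.const (by omega)) htd) (.div (.reg rfl (by omega)) (.const hq) (by omega)) ?_) (by omega) _
        f1'.1
    exact lt_of_le_of_lt (Nat.mul_le_mul_left _ hd) ht
  rw [ev]
  refine (wp_drawLoop (e := sampleExp q n (t / 8)) H ?_ (f1.update_of_le (by simp) _) (by simp)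
    (hu1.trans hu)).mono ?_
  · unfold sampleExp
    omega
  · rintro σ' ⟨mem', a1, a2, a3, a4⟩
    exact ⟨mem', a1, a2, a3, a4.trans ho⟩

-- By `hX` the recursion `hpick` refers only to smaller vertices, whose cells are final when they
-- are read. The bound `1` on the cells not yet written serves only to exclude overflow of the sum.
open Classical in
theorem wp_greedy (H : Fits c mem n M i t I) (hmem : ∀ v < n, mem (2 * I.length + v) ≤ 1)
    {pick : ℕ → ℕ} (hX : ∀ p ∈ sel n 5 I, p.2 < p.1)
    (hpick : ∀ x < n, pick x = if ∀ y, (x, y) ∈ sel n 5 I → pick y = 0 then 1 else 0)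
    {σ : LocalState} (hσ : Frame [n, M, i, t, I.length] mem σ) :
    wp c .greedy σ fun σ' => ∃ mem', Frame [n, M, i, t, I.length] mem' σ' ∧ MemHolds mem' I ∧
      (∀ v < n, mem' (2 * I.length + v) = pick v) ∧ σ'.out = σ.out := by
  have h3 := H.n_words
  have h5 := H.one_lt
  have h7 := H.cells
  refine (wp_forLoop (fun k σ' => ∃ mem', Frame [n, M, i, t, I.length] mem' σ' ∧ MemHolds mem' I ∧
      (∀ v < k, mem' (2 * I.length + v) = pick v) ∧ (∀ v < n, mem' (2 * I.length + v) ≤ 1) ∧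
      σ'.out = σ.out) n H.n_le H.n_lt ?_ ?_ ?_).mono ?_
  · exact fun k hk σ ⟨mem', h, _⟩ => EvalsTo.reg rfl H.n_lt _ h.1
  · exact ⟨mem, hσ.update_of_le (by simp) _, H.mem, by simp, hmem, rfl⟩
  · rintro x hx σ₁ ⟨mem', f, hm, hc, hc1, ho⟩ r5
    have H' := H.change hm
    have f' := f.snoc (x := 5) rfl r5
    set g : ℕ × ℕ → ℕ := fun p => (if p.1 = x then 1 else 0) * mem' (2 * I.length + p.2) with hg
    have hlt : ∀ a y, (a, y) ∈ sel n 5 I → y < n := fun a y h =>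
      (hX _ h).trans (H.sel_lt h).1
    have hs : ((sel n 5 I).map g).sum < c.W := by
      have h1 := sum_map_le_card (sel n 5 I) g 1 (fun p hp => by
        have := hc1 p.2 (hlt p.1 p.2 hp)
        simp only [hg]
        split_ifs <;> simp [this])
      have h2 := card_sel_le n 5 I
      have h8 := H.len_lt
      rw [Multiset.coe_card] at h2
      omega
    have s1 := Tr.sumTag (x := 6) (p := .load 11 (cellExpr (.reg 9))) (mem := mem') (τ := 5)
      (e := .mul (.eq (.reg 10) (.reg 5)) (.reg 11)) (H'.append [x]) (by omega) rfl hs (by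
        intro acc k key a y hp
        have hy := hlt a y hp
        have ha := (H.sel_lt hp).1
        have hcy := hc1 y hy
        refine ⟨[mem' (2 * I.length + y)], ?_, ?_⟩
        · rw [List.append_assoc]
          exact .load rfl (H'.evalsTo_cell hy (.reg rfl (by omega))) (by omega)
        · refine .mul (.eq (.reg rfl (by omega)) (.reg rfl (by omega)) (by omega))
            (.reg rfl (by dsimp only; omega)) ?_
          split_ifs <;> simp <;> omega)
    apply wp_seq
    refine (s1 σ₁ f').mono ?_
    rintro σ₂ ⟨f2, l, hl, hz⟩
    obtain rfl : l = [] := by simpa using hz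
    rw [List.append_nil] at hl
    have ea : (cellExpr (.reg 5)).eval c.W σ₂.reg = 2 * I.length + x :=
      (H'.evalsTo_cell (ext := [x] ++ [((sel n 5 I).map g).sum]) hx (.reg rfl (by omega))) _ f2.1
    have ev : (Expr.eq (.reg 6) (.const 0)).eval c.W σ₂.reg = pick x := by
      rw [EvalsTo.eq (.reg rfl hs) (.const (by omega)) (by omega) _ f2.1, hpick x hx]
      refine if_congr ?_ rfl rfl
      rw [Multiset.sum_eq_zero_iff]
      constructor
      · intro h y hy
        have h0 := h _ (Multiset.mem_map_of_mem g hy)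
        simp only [hg, if_true, one_mul] at h0
        rwa [hc y (hX _ hy)] at h0
      · intro h z hz
        obtain ⟨⟨u, w⟩, hp, rfl⟩ := Multiset.mem_map.1 hz
        simp only [hg]
        split_ifs with hu
        · simp only [hu] at hp
          rw [hc w (hX _ hp), h w hp, mul_zero]
        · simp
    have hp1 : pick x ≤ 1 := by
      rw [hpick x hx]
      split_ifs <;> simp
    apply wp_store
    · rw [ea]
      omega
    · rw [ea, ev]
      have f3 := (f2.of_append).of_append
      refine ⟨f2.1 5 x rfl, Function.update σ₂.mem (2 * I.length + x) (pick x),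
        ⟨(f3.update_of_le (x := 5) (by simp) (x + 1)).1, rfl⟩, ?_, ?_, ?_, hl.trans ho⟩
      · rw [f2.2]
        exact hm.update (by omega) _
      · intro v hv
        by_cases hvk : v = x
        · simp [hvk]
        · rw [Function.update_of_ne (by omega), f2.2]
          exact hc v (by omega)
      · intro v hv
        by_cases hvk : v = x
        · simp [hvk, hp1]
        · rw [Function.update_of_ne (by omega), f2.2]
          exact hc1 v hv
  · rintro σ' ⟨mem', h1, h2, h3, h4, h5⟩
    exact ⟨mem', h1, h2, h3, h5⟩

end

/-! ### The whole program and its rounds -/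

/-- In round `t` execute the program of stage `t % 8`; the output is sent in round `last`. -/
def Program.clique (q last : ℕ) : Program :=
  let stage (k : ℕ) : Expr := .eq (.mod (.reg 3) (.const 8)) (.const k)
  .ite (stage 0) .countRound <| .ite (stage 1) .activeRound <|
  .ite (stage 2) (.seq (.sample q) .labelRound) <| .ite (stage 3) .shareRound <|
  .ite (stage 4) .rowRound <| .ite (stage 5) .missingRound <|
  .ite (stage 6) (.seq .greedy (.ite (.eq (.reg 3) (.const last)) .outputRound .chosenRound))
    .extendRound

/-- Started in round `t` on the received pairs `I`, the program `p` sends the messages `L`. -/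
def Sends (c : Machine) (p : Program) (n M i t : ℕ) (I : Inbox) (L : Multiset Message) : Prop :=
  wp c p (initState n M i t I) fun σ => (σ.out : Multiset Message) = L

theorem Tr.sends {c : Machine} {p : Program} {n M i t : ℕ} {I : Inbox} {L : Multiset Message}
    {ext : List ℕ} (h : Tr c (initState n M i t I).mem p [n, M, i, t, I.length] ext L) :
    Sends c p n M i t I L := by
  refine (h _ (frame_initState n M i t I)).mono ?_
  rintro σ ⟨-, l, hl, rfl⟩
  simp [hl, initState]

/-- The first command writes to memory, which `Tr` does not allow, so only the second one is
described by `Tr`, for whatever memory the first leaves. -/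
theorem Tr.sends_seq {c : Machine} {p q : Program} {n M i t : ℕ} {I : Inbox} {L : Multiset Message}
    {ext : List ℕ} {A : (ℕ → ℕ) → Prop}
    (hp : wp c p (initState n M i t I) fun σ' => ∃ mem',
      Frame [n, M, i, t, I.length] mem' σ' ∧ A mem' ∧ σ'.out = [])
    (hq : ∀ mem', A mem' → Tr c mem' q [n, M, i, t, I.length] ext L) :
    Sends c (.seq p q) n M i t I L := by
  apply wp_seq
  refine hp.mono ?_
  rintro σ ⟨mem', f, hA, ho⟩
  refine (hq mem' hA σ f).mono ?_
  rintro σ' ⟨-, l, hl, rfl⟩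
  simp [hl, ho]

theorem Sends.ite_neg {c : Machine} {p q : Program} {n M i t : ℕ} {I : Inbox} {L : Multiset Message}
    {e : Expr} (he : EvalsTo c.W [n, M, i, t, I.length] e 0)
    (h : Sends c q n M i t I L) : Sends c (.ite e p q) n M i t I L :=
  wp_ite (fun h' => absurd (he _ (frame_initState n M i t I).1) h') fun _ => h

theorem Sends.ite_pos {c : Machine} {p q : Program} {n M i t : ℕ} {I : Inbox} {L : Multiset Message}
    {e : Expr} (he : EvalsTo c.W [n, M, i, t, I.length] e 1)
    (h : Sends c p n M i t I L) : Sends c (.ite e p q) n M i t I L :=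
  wp_ite (fun _ => h) fun h' => by
    rw [he _ (frame_initState n M i t I).1] at h'
    exact absurd h' one_ne_zero

/-- The pairs delivered to machine `j`. -/
def inboxHom (j : ℕ) : Multiset Message →+ Multiset (ℕ × ℕ) where
  toFun L := (L.filter fun m => m.dest = j).map fun m => (m.key, m.val)
  map_zero' := by simp
  map_add' := by simp

theorem inboxHom_apply (j : ℕ) (L : Multiset Message) :
    inboxHom j L = (L.filter fun m => m.dest = j).map fun m => (m.key, m.val) := rfl

theorem inboxHom_msg (n j d τ a y : ℕ) :
    inboxHom j {msg n d τ a y} = if d = j then {(τ * n + a, y)} else 0 := by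
  rw [inboxHom_apply]
  simp only [msg]
  split_ifs with h <;> simp [h, Multiset.filter_singleton]

/-- As multisets, deliveries depend additively on the messages, so the contents of an inbox can be
computed by rearranging finite sums. -/
theorem coe_deliver {M : ℕ} (out : Fin M → List Message) (j : Fin M) :
    (deliver out j : Multiset (ℕ × ℕ)) = ∑ i, inboxHom j (out i : Multiset Message) := by
  have h1 : ∀ l : List Message, ((l.filterMap fun m => if m.dest = (j : ℕ) then
      some (m.key, m.val) else none : List (ℕ × ℕ)) : Multiset (ℕ × ℕ)) =
      inboxHom j (l : Multiset Message) := by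
    intro l
    rw [inboxHom_apply]
    induction l with
    | nil => simp
    | cons m l ih =>
      rw [← Multiset.cons_coe, Multiset.filter_cons]
      by_cases h : m.dest = j
      · simpa [List.filterMap_cons, h] using ih
      · simpa [List.filterMap_cons, h] using ih
  rw [deliver, ← Multiset.coe_bind, Fin.sum_univ_def]
  simp only [Multiset.bind, Multiset.join, Multiset.map_coe, Multiset.sum_coe, h1]

/-- The received pairs of a machine, by tag. -/
structure Box where
  e : Multiset (ℕ × ℕ) := 0
  a : Multiset (ℕ × ℕ) := 0
  t : Multiset (ℕ × ℕ) := 0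
  c : Multiset (ℕ × ℕ) := 0
  r : Multiset (ℕ × ℕ) := 0
  d : Multiset (ℕ × ℕ) := 0
  p : Multiset (ℕ × ℕ) := 0

/-- Add the tag `τ`. -/
def enc (n τ : ℕ) (X : Multiset (ℕ × ℕ)) : Multiset (ℕ × ℕ) := X.map fun p => (τ * n + p.1, p.2)

/-- All received pairs with their tags. -/
def Box.inbox (n : ℕ) (b : Box) : Multiset (ℕ × ℕ) :=
  enc n 0 b.e + enc n 1 b.a + enc n 2 b.t + enc n 3 b.c + enc n 4 b.r + enc n 5 b.d + enc n 6 b.p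

/-- All received pairs without their tags. -/
def Box.total (b : Box) : Multiset (ℕ × ℕ) := b.e + b.a + b.t + b.c + b.r + b.d + b.p

/-- The received pairs are in range and not too many. -/
structure Box.Valid (n cap : ℕ) (b : Box) : Prop where
  lt : ∀ p ∈ b.total, p.1 < n ∧ p.2 ≤ n
  card : Multiset.card b.total ≤ 15 * cap

theorem sel_add (n τ : ℕ) (X Y : Multiset (ℕ × ℕ)) : sel n τ (X + Y) = sel n τ X + sel n τ Y := by
  simp [sel]

/-- For keys below `n`, division by `n` with remainder separates the tag from the key. -/
theorem sel_enc {n : ℕ} (τ τ' : ℕ) (X : Multiset (ℕ × ℕ)) (h : ∀ p ∈ X, p.1 < n) :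
    sel n τ (enc n τ' X) = if τ' = τ then X else 0 := by
  rw [sel, enc]
  have h1 : ∀ p ∈ X, (τ' * n + p.1) / n = τ' ∧ (τ' * n + p.1) % n = p.1 := fun p hp => by
    have := h p hp
    rw [mul_comm, Nat.mul_add_div (by omega), Nat.div_eq_of_lt this, Nat.mul_add_mod,
      Nat.mod_eq_of_lt this]
    simp
  split_ifs with hτ
  · rw [Multiset.filter_eq_self.2, Multiset.map_map]
    · conv_rhs => rw [← Multiset.map_id X]
      refine Multiset.map_congr rfl fun p hp => ?_
      simp [(h1 p hp).2]
    · intro p hp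
      obtain ⟨p', hp', rfl⟩ := Multiset.mem_map.1 hp
      simpa [hτ] using (h1 p' hp').1
  · rw [Multiset.filter_eq_nil.2, Multiset.map_zero]
    intro p hp
    obtain ⟨p', hp', rfl⟩ := Multiset.mem_map.1 hp
    simpa [(h1 p' hp').1] using hτ

namespace Box

variable {n cap : ℕ} {b : Box}

theorem Valid.sel (h : b.Valid n cap) : sel n 0 (b.inbox n) = b.e ∧ sel n 1 (b.inbox n) = b.a ∧
    sel n 2 (b.inbox n) = b.t ∧ sel n 3 (b.inbox n) = b.c ∧ sel n 4 (b.inbox n) = b.r ∧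
    sel n 5 (b.inbox n) = b.d ∧ sel n 6 (b.inbox n) = b.p := by
  have h' := h.lt
  simp only [total, Multiset.mem_add] at h'
  simp only [inbox, sel_add]
  have h0 := fun τ => sel_enc τ 0 b.e fun p hp => (h' p (by tauto)).1
  have h1 := fun τ => sel_enc τ 1 b.a fun p hp => (h' p (by tauto)).1
  have h2 := fun τ => sel_enc τ 2 b.t fun p hp => (h' p (by tauto)).1
  have h3 := fun τ => sel_enc τ 3 b.c fun p hp => (h' p (by tauto)).1
  have h4 := fun τ => sel_enc τ 4 b.r fun p hp => (h' p (by tauto)).1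
  have h5 := fun τ => sel_enc τ 5 b.d fun p hp => (h' p (by tauto)).1
  have h6 := fun τ => sel_enc τ 6 b.p fun p hp => (h' p (by tauto)).1
  simp [h0, h1, h2, h3, h4, h5, h6]

theorem card_inbox (n : ℕ) (b : Box) : Multiset.card (b.inbox n) = Multiset.card b.total := by
  simp [inbox, total, enc]

theorem Valid.mem_inbox (h : b.Valid n cap) {p : ℕ × ℕ} (hp : p ∈ b.inbox n) :
    p.1 < 7 * n ∧ p.2 ≤ n := by
  have h' := h.lt
  simp only [total, Multiset.mem_add] at h'
  simp only [inbox, enc, Multiset.mem_add, Multiset.mem_map] at hp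
  rcases hp with (((((⟨p, hp, rfl⟩ | ⟨p, hp, rfl⟩) | ⟨p, hp, rfl⟩) | ⟨p, hp, rfl⟩) | ⟨p, hp, rfl⟩) |
    ⟨p, hp, rfl⟩) | ⟨p, hp, rfl⟩ <;>
  · obtain ⟨h1, h2⟩ := h' p (by tauto)
    exact ⟨by dsimp only; omega, h2⟩

end Box

/-- The numerical parameters: `n` vertices, `M` machines, at most `cap` edges per machine, `W` words,
`S` cells, constants `q` and `r`. -/
structure Params (n M cap q r : ℕ) (R : Resources) : Prop where
  n_pos : 0 < n
  M_pos : 0 < M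
  M_le : M ≤ n
  n_le : n ≤ cap
  cap_le : 64 * cap ≤ R.S
  words : 4 * R.S * R.S + 8 < R.W
  q_le : q ≤ n
  r_le : r ≤ n

namespace Params

variable {n M cap q r : ℕ} {R : Resources}

theorem S_lt (h : Params n M cap q r R) : 4 * R.S < R.W ∧ 64 ≤ R.S := by
  have := h.n_pos
  have := h.n_le
  have := h.cap_le
  have := h.words
  refine ⟨?_, by omega⟩
  have : 4 * R.S * 1 ≤ 4 * R.S * R.S := Nat.mul_le_mul_left _ (by omega)
  omega

/-- The loop bound is taken to be `R.S`: loops range over received pairs, vertices, machines or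
random bits, and there are at most `R.S` of each. -/
theorem fits (h : Params n M cap q r R) (coin : ℕ → Bool) {i t : ℕ} (hi : i < M) {I : Inbox}
    {b : Box} (hb : b.Valid n cap) (hI : (I : Multiset (ℕ × ℕ)) = b.inbox n) :
    Fits ⟨R.W, R.S, R.S, coin⟩ (initState n M i t I).mem n M i t I := by
  obtain ⟨h1, h2⟩ := h.S_lt
  have h3 := h.n_pos
  have h4 := h.n_le
  have h5 := h.cap_le
  have h6 := h.words
  have h7 := h.M_le
  have hl : I.length ≤ 15 * cap := by
    rw [← Multiset.coe_card, hI, b.card_inbox]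
    exact hb.card
  have hm : ∀ p ∈ I, p.1 < 7 * n ∧ p.2 ≤ n := fun p hp =>
    hb.mem_inbox (by rw [← hI]; simpa using hp)
  refine
    { mem := memHolds_initState n M i t I
      key_lt := fun p hp => ?_
      val_lt := fun p hp => ?_
      n_reg := rfl
      len_reg := rfl
      n_lt := ?_
      len_lt := ?_
      len_le := ?_
      len_mem := ?_
      one_lt := ?_
      M_lt := ?_
      i_lt := hi
      n_pos := h3
      M_le := ?_
      n_le := ?_
      n_words := ?_
      cells := ?_
      cells_lt := ?_ }
  · have := hm p hp
    dsimp only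
    omega
  · have := hm p hp
    dsimp only
    omega
  all_goals
    dsimp only
    omega

end Params

/-- After `t` rounds the machines have received the pairs `b`. -/
def Reaches (P : Program) (R : Resources) (n M : ℕ) (coin : ℕ × ℕ × ℕ → Bool)
    (input : Fin M → Inbox) (t : ℕ) (b : Fin M → Box) : Prop :=
  ∃ cur, Run P R n M coin input t cur ∧
    ∀ j, (cur j : Multiset (ℕ × ℕ)) = (b j).inbox n

section step

variable {n M cap q r : ℕ} {R : Resources} {coin : ℕ × ℕ × ℕ → Bool} {input : Fin M → Inbox}
  {P : Program} {t : ℕ} {b : Fin M → Box}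

/-- Stated without a `Box` for the result, because the output round delivers pairs in another
format. -/
theorem Reaches.round (hp : Params n M cap q r R) (hT : P.time R.S ≤ R.T)
    (h : Reaches P R n M coin input t b) (hb : ∀ i, (b i).Valid n cap)
    (L : Fin M → Multiset Message) (hL : ∀ i, Multiset.card (L i) ≤ 21 * cap)
    (hs : ∀ (i : Fin M) (I : Inbox), (I : Multiset (ℕ × ℕ)) = (b i).inbox n →
      Fits ⟨R.W, R.S, R.S, fun k => coin (t, i, k)⟩ (initState n M i t I).mem n M i t I →
      Sends ⟨R.W, R.S, R.S, fun k => coin (t, i, k)⟩ P n M i t I (L i)) :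
    ∃ cur, Run P R n M coin input (t + 1) cur ∧
      ∀ j, (cur j : Multiset (ℕ × ℕ)) = ∑ i, inboxHom j (L i) := by
  obtain ⟨cur, hrun, hcur⟩ := h
  have hcap := hp.cap_le
  have key : ∀ i : Fin M, ∃ out, LocalRun P R n M i t (cur i) (fun k => coin (t, i, k)) out ∧
      (out : Multiset Message) = L i := by
    intro i
    have hf := hp.fits (fun k => coin (t, i, k)) (t := t) i.2 (hb i) (hcur i)
    obtain ⟨s, hs, σ, h1, h2⟩ := hs i (cur i) (hcur i) hf
    refine ⟨σ.out, ⟨hf.len_mem, ?_, s, hs.trans hT, σ, h1, rfl⟩, h2⟩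
    -- Three words per message: `3 * (21 * cap) ≤ 64 * cap ≤ R.S`.
    rw [← Multiset.coe_card, h2]
    have := hL i
    omega
  choose out h1 h2 using key
  refine ⟨deliver out, .round hrun h1, fun j => ?_⟩
  rw [coe_deliver]
  simp only [h2]

theorem Reaches.step (hp : Params n M cap q r R) (hT : P.time R.S ≤ R.T)
    (h : Reaches P R n M coin input t b) (hb : ∀ i, (b i).Valid n cap)
    (L : Fin M → Multiset Message) (hL : ∀ i, Multiset.card (L i) ≤ 21 * cap)
    (hs : ∀ (i : Fin M) (I : Inbox), (I : Multiset (ℕ × ℕ)) = (b i).inbox n →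
      Fits ⟨R.W, R.S, R.S, fun k => coin (t, i, k)⟩ (initState n M i t I).mem n M i t I →
      Sends ⟨R.W, R.S, R.S, fun k => coin (t, i, k)⟩ P n M i t I (L i))
    (b' : Fin M → Box) (hb' : ∀ j : Fin M, ∑ i, inboxHom j (L i) = (b' j).inbox n) :
    Reaches P R n M coin input (t + 1) b' := by
  obtain ⟨cur, h1, h2⟩ := h.round hp hT hb L hL hs
  exact ⟨cur, h1, fun j => (h2 j).trans (hb' j)⟩

end step

section dispatch

variable {c : Machine} {n M i t q last : ℕ} {I : Inbox} {L : Multiset Message}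

theorem EvalsTo.stage {k : ℕ} (hW : 8 < c.W) (ht : t < c.W) (hk : k < 8) :
    EvalsTo c.W [n, M, i, t, I.length] (.eq (.mod (.reg 3) (.const 8)) (.const k))
      (if t % 8 = k then 1 else 0) :=
  .eq (.mod (.reg rfl ht) (.const hW) ht) (.const (by omega)) (by omega)

theorem Sends.clique (hW : 8 < c.W) (ht : t < c.W)
    (h0 : t % 8 = 0 → Sends c .countRound n M i t I L)
    (h1 : t % 8 = 1 → Sends c .activeRound n M i t I L)
    (h2 : t % 8 = 2 → Sends c (.seq (.sample q) .labelRound) n M i t I L)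
    (h3 : t % 8 = 3 → Sends c .shareRound n M i t I L)
    (h4 : t % 8 = 4 → Sends c .rowRound n M i t I L)
    (h5 : t % 8 = 5 → Sends c .missingRound n M i t I L)
    (h6 : t % 8 = 6 → Sends c (.seq .greedy (.ite (.eq (.reg 3) (.const last)) .outputRound
      .chosenRound)) n M i t I L)
    (h7 : t % 8 = 7 → Sends c .extendRound n M i t I L) :
    Sends c (.clique q last) n M i t I L := by
  have ev : ∀ k < 8, EvalsTo c.W [n, M, i, t, I.length] (.eq (.mod (.reg 3) (.const 8)) (.const k))
      (if t % 8 = k then 1 else 0) := fun k hk => .stage hW ht hk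
  have hi : ∀ {k : ℕ} {p q : Program}, k < 8 → (t % 8 = k → Sends c p n M i t I L) →
      (t % 8 ≠ k → Sends c q n M i t I L) →
      Sends c (.ite (.eq (.mod (.reg 3) (.const 8)) (.const k)) p q) n M i t I L := by
    intro k p q hk hp hq
    by_cases h : t % 8 = k
    · exact .ite_pos (by simpa [h] using ev k hk) (hp h)
    · exact .ite_neg (by simpa [h] using ev k hk) (hq h)
  exact hi (by omega) h0 fun _ => hi (by omega) h1 fun _ => hi (by omega) h2 fun _ =>
    hi (by omega) h3 fun _ => hi (by omega) h4 fun _ => hi (by omega) h5 fun _ =>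
    hi (by omega) h6 fun _ => h7 (by omega)

end dispatch

/-! ### The rounds of a phase -/

/-- The machines hold each edge of the graph `adj` exactly once. -/
structure Represents (n cap : ℕ) {M : ℕ} (adj : ℕ → ℕ → Prop) (E : Fin M → Multiset (ℕ × ℕ)) :
    Prop where
  symm : ∀ x y, adj x y → adj y x
  irrefl : ∀ x, ¬ adj x x
  lt : ∀ i, ∀ p ∈ E i, p.1 < n ∧ p.2 < n
  card : ∀ i, Multiset.card (E i) ≤ cap
  hit_of_adj : ∀ x y, adj x y → ∑ i, ((E i).map (hit x y)).sum = 1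
  hit_of_not_adj : ∀ x y, ¬ adj x y → ∑ i, ((E i).map (hit x y)).sum = 0

open Classical in
/-- The vertices adjacent to all of `C`. -/
noncomputable def active (adj : ℕ → ℕ → Prop) (n : ℕ) (C : Finset ℕ) : Finset ℕ :=
  (Finset.range n).filter fun v => ∀ c ∈ C, adj v c

theorem mem_active {adj : ℕ → ℕ → Prop} {n : ℕ} {C : Finset ℕ} {v : ℕ} :
    v ∈ active adj n C ↔ v < n ∧ ∀ c ∈ C, adj v c := by
  classical
  simp [active]

/-- The rank of `v` in `T`. -/
def rk (T : Finset ℕ) (v : ℕ) : ℕ := (T.filter (· < v)).card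

/-- The vertices as received pairs. -/
def plain (C : Finset ℕ) : Multiset (ℕ × ℕ) := C.val.map fun c => (c, 0)

/-- The vertices with their labels. -/
def lab (T : Finset ℕ) (S : Finset ℕ) : Multiset (ℕ × ℕ) := S.val.map fun v => (rk T v, v)

/-- The vertices in `S` whose labels in `T` belong to machine `j`. -/
def atMachine (M : ℕ) (T S : Finset ℕ) (j : ℕ) : Finset ℕ := S.filter fun v => rk T v % M = j

open Classical in
/-- The missing edges between vertices of `T`. -/
noncomputable def missing (adj : ℕ → ℕ → Prop) (T : Finset ℕ) : Multiset (ℕ × ℕ) :=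
  ∑ x ∈ T, (T.filter fun y => y < x ∧ ¬ adj x y).val.map fun y => (x, y)

open Classical in
/-- The vertices below `u` chosen by the greedy algorithm from `T`. -/
noncomputable def greedySet (adj : ℕ → ℕ → Prop) (T : Finset ℕ) : ℕ → Finset ℕ
  | 0 => ∅
  | u + 1 => if u ∈ T ∧ ∀ w ∈ greedySet adj T u, adj u w then insert u (greedySet adj T u)
      else greedySet adj T u

/-! ### The greedy clique in a set of vertices -/

section greedySet

variable {adj : ℕ → ℕ → Prop} {T : Finset ℕ} {u v : ℕ}

theorem lt_of_mem_greedySet (h : v ∈ greedySet adj T u) : v < u := by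
  induction u with
  | zero => simp [greedySet] at h
  | succ u ih =>
    rw [greedySet] at h
    split_ifs at h
    · rcases Finset.mem_insert.1 h with rfl | h
      · omega
      · exact (ih h).trans (by omega)
    · exact (ih h).trans (by omega)

theorem mem_of_mem_greedySet (h : v ∈ greedySet adj T u) : v ∈ T := by
  induction u with
  | zero => simp [greedySet] at h
  | succ u ih =>
    rw [greedySet] at h
    split_ifs at h with h'
    · rcases Finset.mem_insert.1 h with rfl | h
      · exact h'.1
      · exact ih h
    · exact ih h

theorem greedySet_mono {u u' : ℕ} (h : u ≤ u') : greedySet adj T u ⊆ greedySet adj T u' := by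
  induction u', h using Nat.le_induction with
  | base => exact subset_rfl
  | succ u' h ih =>
    refine ih.trans ?_
    rw [greedySet]
    split_ifs
    · exact Finset.subset_insert _ _
    · exact subset_rfl

/-- The fate of `v` is settled when the scan reaches it; later steps add only larger vertices. -/
theorem mem_greedySet_iff (hv : v ∈ T) (hu : v < u) :
    v ∈ greedySet adj T u ↔ ∀ w ∈ greedySet adj T v, adj v w := by
  induction u, (show v + 1 ≤ u by omega) using Nat.le_induction with
  | base =>
    rw [greedySet]
    split_ifs with h
    · exact iff_of_true (Finset.mem_insert_self _ _) h.2
    · constructor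
      · exact fun h' => absurd (lt_of_mem_greedySet h') (lt_irrefl v)
      · exact fun h' => absurd ⟨hv, h'⟩ h
  | succ u hu' ih =>
    rw [← ih (by omega), greedySet]
    split_ifs
    · rw [Finset.mem_insert, or_iff_right (by omega)]
    · rfl

theorem mem_greedySet_of_lt {w : ℕ} (hw : w ∈ greedySet adj T u) (h : w < v) :
    w ∈ greedySet adj T v := by
  have hT := mem_of_mem_greedySet hw
  rw [mem_greedySet_iff hT h]
  rwa [mem_greedySet_iff hT (lt_of_mem_greedySet hw)] at hw

theorem greedySet_clique (hs : ∀ x y, adj x y → adj y x) {v w : ℕ} (hv : v ∈ greedySet adj T u)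
    (hw : w ∈ greedySet adj T u) (h : v ≠ w) : adj v w := by
  have key : ∀ {v w}, v ∈ greedySet adj T u → w ∈ greedySet adj T u → w < v → adj v w :=
    fun {v w} hv hw h => (mem_greedySet_iff (mem_of_mem_greedySet hv) (lt_of_mem_greedySet hv)).1 hv w
      (mem_greedySet_of_lt hw h)
  rcases lt_or_gt_of_ne h with h | h
  · exact hs _ _ (key hw hv h)
  · exact key hv hw h

end greedySet

/-! ### Ranks, shares of the machines, and sums of delivered messages -/

section counting

theorem sum_singleton_map {α β : Type*} (T : Finset α) (g : α → β) :
    ∑ v ∈ T, ({g v} : Multiset β) = T.val.map g := sum_map_singleton' _ _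

theorem sum_map_map {α β γ : Type*} [AddCommMonoid γ] (T : Finset α) (g : α → β) (f : β → γ) :
    ((T.val.map g).map f).sum = ∑ v ∈ T, f (g v) := by
  rw [Multiset.map_map]
  rfl

theorem sum_ite_singleton {α β : Type*} (T : Finset α) (p : α → Prop) [DecidablePred p] (g : α → β) :
    ∑ v ∈ T, (if p v then ({g v} : Multiset β) else 0) = (T.filter p).val.map g := by
  rw [← Finset.sum_filter, sum_singleton_map]

theorem enc_add (n τ : ℕ) (X Y : Multiset (ℕ × ℕ)) : enc n τ (X + Y) = enc n τ X + enc n τ Y := by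
  simp [enc]

theorem enc_zero (n τ : ℕ) : enc n τ 0 = 0 := by simp [enc]

theorem enc_sum {ι : Type*} (n τ : ℕ) (s : Finset ι) (X : ι → Multiset (ℕ × ℕ)) :
    enc n τ (∑ i ∈ s, X i) = ∑ i ∈ s, enc n τ (X i) := by
  classical
  induction s using Finset.induction_on with
  | empty => simp [enc_zero]
  | insert a s ha ih => rw [Finset.sum_insert ha, Finset.sum_insert ha, enc_add, ih]

theorem rk_lt {T : Finset ℕ} {v : ℕ} (hv : v ∈ T) : rk T v < T.card :=
  Finset.card_lt_card ⟨Finset.filter_subset _ _, fun h => by simpa using h hv⟩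

theorem rk_strictMono {T : Finset ℕ} {v w : ℕ} (hv : v ∈ T) (h : v < w) : rk T v < rk T w := by
  refine Finset.card_lt_card ⟨fun x hx => ?_, fun h' => ?_⟩
  · simp only [Finset.mem_filter] at hx ⊢
    exact ⟨hx.1, hx.2.trans h⟩
  · simpa using h' (Finset.mem_filter.2 ⟨hv, h⟩)

theorem rk_injOn (T : Finset ℕ) : Set.InjOn (rk T) T := by
  intro v hv w hw h
  rcases lt_trichotomy v w with h' | h' | h'
  · exact absurd h (rk_strictMono hv h').ne
  · exact h'
  · exact absurd h (rk_strictMono hw h').ne'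

theorem card_filter_mod_le {M : ℕ} (hM : 0 < M) (N j : ℕ) :
    ((Finset.range N).filter fun v => v % M = j).card ≤ N / M + 1 := by
  by_cases hj : j < M
  · have h := Nat.count_modEq_card N hM j
    rw [Nat.count_eq_card_filter_range] at h
    have h2 : ((Finset.range N).filter fun v => v % M = j) =
        (Finset.range N).filter fun v => v ≡ j [MOD M] := by
      refine Finset.filter_congr fun v _ => ?_
      rw [Nat.ModEq, Nat.mod_eq_of_lt hj]
    rw [h2, h]
    split_ifs <;> omega
  · rw [Finset.filter_false_of_mem]
    · simp
    · intro v _ h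
      exact hj (h ▸ Nat.mod_lt _ hM)

/-- `rk T` is injective from `T` into the numbers below `T.card`, and a residue class modulo `M` has
at most `T.card / M + 1` of these. -/
theorem card_atMachine_le {M : ℕ} (hM : 0 < M) {T S : Finset ℕ} (hS : S ⊆ T) (j : ℕ) :
    (atMachine M T S j).card ≤ T.card / M + 1 := by
  refine le_trans ?_ (card_filter_mod_le hM T.card j)
  refine Finset.card_le_card_of_injOn (rk T) ?_ ?_
  · intro v hv
    have hv := Finset.mem_filter.1 hv
    simpa using ⟨rk_lt (hS hv.1), hv.2⟩
  · exact (rk_injOn T).mono fun v hv => hS (Finset.mem_filter.1 hv).1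

theorem mul_div_add_one_le {M n : ℕ} (T : ℕ) (hT : T ≤ n) (hMn : M ≤ n) : (T / M + 1) * M ≤ 2 * n := by
  have := Nat.div_mul_le_self T M
  rw [add_mul]
  omega

theorem sum_machines {M : ℕ} (hM : 0 < M) {α : Type*} [AddCommMonoid α] (k : ℕ) (f : α) :
    ∑ i : Fin M, (if k % M = (i : ℕ) then f else 0) = f := by
  have h := Nat.mod_lt k hM
  rw [Finset.sum_eq_single (⟨k % M, h⟩ : Fin M)]
  · simp
  · intro i _ hi
    rw [if_neg]
    rintro hk
    exact hi (Fin.ext hk.symm)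
  · simp

theorem inboxHom_map (n j d τ : ℕ) (X : Multiset (ℕ × ℕ)) :
    inboxHom j (X.map fun p => msg n d τ p.1 p.2) = if d = j then enc n τ X else 0 := by
  rw [← sum_map_singleton', map_multiset_sum, Multiset.map_map]
  simp only [Function.comp_def, inboxHom_msg]
  split_ifs
  · exact sum_map_singleton' _ _
  · simp

theorem sum_keep {M : ℕ} (n τ : ℕ) (X : Fin M → Multiset (ℕ × ℕ)) (j : Fin M) :
    ∑ i : Fin M, inboxHom j ((X i).map fun p => msg n i τ p.1 p.2) = enc n τ (X j) := by
  simp only [inboxHom_map]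
  simp [Fin.val_inj]

end counting

/-! ### Counting edges held by the machines -/

section graph

variable {n M cap : ℕ} {adj : ℕ → ℕ → Prop} {E : Fin M → Multiset (ℕ × ℕ)}

/-- Since each edge is held exactly once, a clique vertex contributes `1` in total if it is adjacent
to `v` and `0` otherwise. -/
theorem Represents.sum_edgesTo (hE : Represents n cap adj E) (C : Finset ℕ) (v : ℕ)
    [DecidablePred (adj v)] :
    ∑ i, edgesTo (E i) (plain C) v = (C.filter (adj v)).card := by
  simp only [edgesTo, plain, sum_map_map]
  rw [Finset.sum_comm, Finset.card_filter]
  refine Finset.sum_congr rfl fun c _ => ?_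
  split_ifs with h
  · exact hE.hit_of_adj v c h
  · exact hE.hit_of_not_adj v c h

theorem Represents.edgesTo_le (hE : Represents n cap adj E) (C : Finset ℕ) (v : ℕ) (i : Fin M) :
    edgesTo (E i) (plain C) v ≤ C.card := by
  classical
  calc edgesTo (E i) (plain C) v ≤ ∑ i, edgesTo (E i) (plain C) v :=
        Finset.single_le_sum (f := fun i => edgesTo (E i) (plain C) v) (fun _ _ => Nat.zero_le _)
          (Finset.mem_univ i)
    _ = (C.filter (adj v)).card := hE.sum_edgesTo C v
    _ ≤ C.card := Finset.card_filter_le _ _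

/-- A stored pair matches at most two ordered pairs: itself and its reversal. -/
theorem sum_hit_le (T : Finset ℕ) (p : ℕ × ℕ) : ∑ x ∈ T, ∑ y ∈ T, hit x y p ≤ 2 := by
  have h : ∀ a b : ℕ, ∑ x ∈ T, ∑ y ∈ T, (if a = x then 1 else 0) * (if b = y then 1 else 0) ≤ 1 := by
    intro a b
    rw [← Finset.sum_mul_sum]
    simp only [Finset.sum_ite_eq]
    split_ifs <;> simp
  have h1 := h p.1 p.2
  have h2 := h p.2 p.1
  simp only [hit, Finset.sum_add_distrib]
  have h3 : ∑ x ∈ T, ∑ y ∈ T, (if p.1 = y then 1 else 0) * (if p.2 = x then 1 else 0) =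
      ∑ x ∈ T, ∑ y ∈ T, (if p.2 = x then 1 else 0) * (if p.1 = y then 1 else 0) := by
    simp only [mul_comm]
  omega

theorem sum_sum_hit_le (T : Finset ℕ) (X : Multiset (ℕ × ℕ)) :
    ∑ x ∈ T, ∑ y ∈ T, (X.map (hit x y)).sum ≤ 2 * Multiset.card X := by
  induction X using Multiset.induction_on with
  | empty => simp
  | cons p X ih =>
    simp only [Multiset.map_cons, Multiset.sum_cons, Finset.sum_add_distrib, Multiset.card_cons]
    have := sum_hit_le T p
    omega

/-- The rows of a dense sample fit into the machines. -/
theorem Represents.row_le (hE : Represents n cap adj E) (hM : 0 < M) (hn : n ≤ cap) {T : Finset ℕ}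
    (hT : T.card ≤ n) (hmiss : Multiset.card (missing adj T) ≤ cap) :
    (T.card / M + 1) * T.card ≤ 6 * cap := by
  classical
  -- Ordered adjacent pairs in `T` number at most twice the edges held by all machines.
  have h1 : ∑ x ∈ T, ∑ y ∈ T, (if adj x y then 1 else 0) ≤ 2 * (M * cap) := by
    calc ∑ x ∈ T, ∑ y ∈ T, (if adj x y then 1 else 0)
        = ∑ x ∈ T, ∑ y ∈ T, ∑ i, ((E i).map (hit x y)).sum := by
          refine Finset.sum_congr rfl fun x _ => Finset.sum_congr rfl fun y _ => ?_
          split_ifs with h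
          · exact (hE.hit_of_adj x y h).symm
          · exact (hE.hit_of_not_adj x y h).symm
      _ = ∑ i, ∑ x ∈ T, ∑ y ∈ T, ((E i).map (hit x y)).sum := by
          rw [Finset.sum_comm]
          rw [Finset.sum_congr rfl fun x _ => Finset.sum_comm]
          rw [Finset.sum_comm]
          refine Finset.sum_congr rfl fun i _ => Finset.sum_comm
      _ ≤ ∑ i : Fin M, 2 * cap := Finset.sum_le_sum fun i _ =>
          (sum_sum_hit_le T (E i)).trans (by have := hE.card i; omega)
      _ = 2 * (M * cap) := by simp; ring
  -- Every ordered pair is diagonal, a non-edge in one of its two orientations, or adjacent.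
  have h2 : T.card * T.card ≤ T.card + 2 * Multiset.card (missing adj T) +
      ∑ x ∈ T, ∑ y ∈ T, (if adj x y then 1 else 0) := by
    have hm : Multiset.card (missing adj T) = ∑ x ∈ T, ∑ y ∈ T, if y < x ∧ ¬ adj x y then 1 else 0 := by
      simp only [missing, Multiset.card_sum, Multiset.card_map, Finset.card_val, Finset.card_filter]
    have hm' : Multiset.card (missing adj T) = ∑ x ∈ T, ∑ y ∈ T, if x < y ∧ ¬ adj x y then 1 else 0 := by
      rw [hm, Finset.sum_comm]
      refine Finset.sum_congr rfl fun x _ => Finset.sum_congr rfl fun y _ => ?_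
      refine if_congr (and_congr_right fun _ => not_congr ⟨hE.symm _ _, hE.symm _ _⟩) rfl rfl
    have hd : T.card = ∑ x ∈ T, ∑ y ∈ T, if x = y then 1 else 0 := by simp
    have hsq : T.card * T.card = ∑ x ∈ T, ∑ y ∈ T, 1 := by simp
    calc T.card * T.card = _ := hsq
      _ ≤ (∑ x ∈ T, ∑ y ∈ T, if x = y then 1 else 0) +
          ((∑ x ∈ T, ∑ y ∈ T, if y < x ∧ ¬ adj x y then 1 else 0) +
            ∑ x ∈ T, ∑ y ∈ T, if x < y ∧ ¬ adj x y then 1 else 0) +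
          ∑ x ∈ T, ∑ y ∈ T, (if adj x y then 1 else 0) := ?_
      _ = _ := by rw [← hm, ← hm', ← hd, two_mul]
    simp only [← Finset.sum_add_distrib]
    refine Finset.sum_le_sum fun x _ => Finset.sum_le_sum fun y _ => ?_
    rcases lt_trichotomy x y with h | h | h
    · by_cases ha : adj x y <;> simp [h, ha, h.ne, h.not_gt]
    · simp [h]
    · by_cases ha : adj x y <;> simp [h, ha, h.ne', h.not_gt]
  -- The three summands are at most `cap`, `2 * cap` and `2 * (M * cap)`, and `cap ≤ M * cap`.
  have h3 : T.card * T.card ≤ (5 * cap) * M := by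
    have : 1 * cap ≤ M * cap := Nat.mul_le_mul_right _ hM
    nlinarith
  have h4 : T.card / M * T.card ≤ 5 * cap := by
    calc T.card / M * T.card ≤ T.card * T.card / M := by
          rw [mul_comm (T.card / M)]
          exact Nat.mul_div_le_mul_div_assoc _ _ _
      _ ≤ (5 * cap) * M / M := Nat.div_le_div_right h3
      _ = 5 * cap := Nat.mul_div_cancel _ hM
  rw [add_mul]
  omega

end graph

/-! ### One round of each stage: received boxes, sent messages, size bounds -/

section stages

variable {n M cap q r : ℕ} {R : Resources} {coin : ℕ × ℕ × ℕ → Bool} {input : Fin M → Inbox}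
  {adj : ℕ → ℕ → Prop} {E : Fin M → Multiset (ℕ × ℕ)} {t : ℕ} {C : Finset ℕ}

/-- The standing assumptions about the parameters, the graph and the current clique. -/
structure Setting (n M cap q r : ℕ) (R : Resources) (adj : ℕ → ℕ → Prop)
    (E : Fin M → Multiset (ℕ × ℕ)) (t : ℕ) (C : Finset ℕ) : Prop
    extends Params n M cap q r R where
  graph : Represents n cap adj E
  time : (Program.clique q (r - 1)).time R.S ≤ R.T
  round : t ≤ r
  clique_lt : ∀ c ∈ C, c < n

namespace Setting

theorem card_le (h : Setting n M cap q r R adj E t C) : C.card ≤ n := by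
  have : C ⊆ Finset.range n := fun c hc => Finset.mem_range.2 (h.clique_lt c hc)
  simpa using Finset.card_le_card this

theorem t_lt (h : Setting n M cap q r R adj E t C) : t < R.W := by
  have := h.S_lt
  have := h.round
  have := h.r_le
  have := h.n_le
  have := h.cap_le
  omega

theorem mem_plain (h : Setting n M cap q r R adj E t C) {p : ℕ × ℕ} (hp : p ∈ plain C) :
    p.1 < n ∧ p.2 ≤ n := by
  simp only [plain, Multiset.mem_map, Finset.mem_val] at hp
  obtain ⟨c, hc, rfl⟩ := hp
  exact ⟨h.clique_lt c hc, Nat.zero_le _⟩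

/-- Edges and clique take at most `2 * cap` of the permitted `15 * cap` pairs; the stages only have
to bound the rest. -/
theorem valid (h : Setting n M cap q r R adj E t C) (i : Fin M) (b : Box) (he : b.e = E i)
    (hc : b.c = plain C) (hlt : ∀ p ∈ b.a + b.t + b.r + b.d + b.p, p.1 < n ∧ p.2 ≤ n)
    (hcard : Multiset.card (b.a + b.t + b.r + b.d + b.p) ≤ 13 * cap) : b.Valid n cap := by
  constructor
  · intro p hp
    simp only [Box.total, Multiset.mem_add] at hp hlt
    rcases hp with (((((hp | hp) | hp) | hp) | hp) | hp) | hp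
    · rw [he] at hp
      have := h.graph.lt i p hp
      exact ⟨this.1, this.2.le⟩
    · exact hlt p (by tauto)
    · exact hlt p (by tauto)
    · rw [hc] at hp
      exact h.mem_plain hp
    all_goals exact hlt p (by tauto)
  · have h1 := h.graph.card i
    have h2 := h.card_le
    have h3 := h.n_le
    simp only [Box.total, Multiset.card_add, he, hc, plain, Multiset.card_map, Finset.card_val]
      at hcard ⊢
    omega

end Setting

theorem sel_of_eq {n : ℕ} {I : Inbox} {b : Box} (h : (I : Multiset (ℕ × ℕ)) = b.inbox n)
    (hb : b.Valid n cap) : sel n 0 I = b.e ∧ sel n 1 I = b.a ∧ sel n 2 I = b.t ∧ sel n 3 I = b.c ∧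
      sel n 4 I = b.r ∧ sel n 5 I = b.d ∧ sel n 6 I = b.p := by
  rw [h]
  exact hb.sel

open Classical in
/-- The partial counts for the vertices of machine `j`. -/
noncomputable def countBox (n : ℕ) (E : Fin M → Multiset (ℕ × ℕ)) (C : Finset ℕ) (j : Fin M) : Box where
  e := E j
  c := plain C
  p := ∑ i, ((Finset.range n).filter fun v => v % M = j).val.map
    fun v => (v, edgesTo (E i) (plain C) v)

/-- Each of the `M` machines sends at most `n / M + 1` counts to one destination, at most `2 * n` in
all because `M ≤ n`. -/
theorem countBox_valid (h : Setting n M cap q r R adj E t C) (j : Fin M) :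
    (countBox n E C j).Valid n cap := by
  refine h.valid j _ rfl rfl ?_ ?_
  · intro p hp
    simp only [countBox, Multiset.mem_add, Multiset.mem_sum, Multiset.mem_map, Finset.mem_val,
      Finset.mem_filter, Finset.mem_range] at hp
    simp only [Multiset.notMem_zero, false_or] at hp
    obtain ⟨i, -, v, ⟨hv, -⟩, rfl⟩ := hp
    exact ⟨hv, (h.graph.edgesTo_le C v i).trans h.card_le⟩
  · have h1 := card_filter_mod_le h.M_pos n j
    have h2 := mul_div_add_one_le (M := M) n le_rfl h.M_le
    have h3 := Nat.mul_le_mul_right M h1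
    have h4 := h.n_le
    simp only [countBox, zero_add, Multiset.card_sum, Multiset.card_map, Finset.card_val,
      Finset.sum_const, Finset.card_univ, Fintype.card_fin, smul_eq_mul]
    rw [mul_comm]
    omega

theorem sum_map_sum {α β γ : Type*} [AddCommMonoid γ] (T : Finset α) (X : α → Multiset β) (f : β → γ) :
    ((∑ i ∈ T, X i).map f).sum = ∑ i ∈ T, ((X i).map f).sum := by
  have := map_sum (Multiset.sumAddMonoidHom.comp (Multiset.mapAddMonoidHom f)) X T
  exact this

theorem card_msgs {α : Type*} (T : Finset α) (f : α → Multiset Message) (b : ℕ)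
    (h : ∀ x ∈ T, Multiset.card (f x) ≤ b) : Multiset.card (∑ x ∈ T, f x) ≤ T.card * b := by
  rw [Multiset.card_sum]
  simpa using Finset.sum_le_card_nsmul T _ b h

/-- The messages that keep the edges and the clique. -/
def keepMsgs (n : ℕ) (E : Fin M → Multiset (ℕ × ℕ)) (C : Finset ℕ) (X : Multiset Message)
    (i : Fin M) : Multiset Message :=
  (E i).map (fun p => msg n i 0 p.1 p.2) + ((plain C).map (fun p => msg n i 3 p.1 p.2) + X)

theorem card_keepMsgs (h : Setting n M cap q r R adj E t C) (X : Multiset Message) (i : Fin M)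
    (hX : Multiset.card X ≤ 19 * cap) : Multiset.card (keepMsgs n E C X i) ≤ 21 * cap := by
  have h1 := h.graph.card i
  have h2 := h.card_le
  have h3 := h.n_le
  simp only [keepMsgs, Multiset.card_add, Multiset.card_map, plain, Finset.card_val]
  omega

theorem sum_keepMsgs (n : ℕ) (E : Fin M → Multiset (ℕ × ℕ)) (C : Finset ℕ)
    (X : Fin M → Multiset Message) (j : Fin M) :
    ∑ i, inboxHom j (keepMsgs n E C (X i) i) =
      enc n 0 (E j) + enc n 3 (plain C) + ∑ i, inboxHom j (X i) := by
  simp only [keepMsgs, map_add, Finset.sum_add_distrib]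
  rw [sum_keep n 0 E j, sum_keep n 3 (fun _ => plain C) j, add_assoc]

theorem reaches_count (h : Setting n M cap q r R adj E t C) (ht : t % 8 = 0)
    (hr : Reaches (.clique q (r - 1)) R n M coin input t fun i => { e := E i, c := plain C }) :
    Reaches (.clique q (r - 1)) R n M coin input (t + 1) (countBox n E C) := by
  have hb : ∀ i, Box.Valid n cap { e := E i, c := plain C } := fun i =>
    h.valid i _ rfl rfl (by simp) (by simp)
  refine hr.step h.toParams h.time hb (fun i => keepMsgs n E C (∑ v ∈ Finset.range n,
    {msg n (v % M) 6 v (edgesTo (E i) (plain C) v)}) i) ?_ ?_ _ ?_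
  · intro i
    refine card_keepMsgs h _ i ?_
    have h1 := h.n_le
    simp only [Multiset.card_sum, Multiset.card_singleton, Finset.sum_const, Finset.card_range,
      smul_eq_mul, mul_one]
    omega
  · intro i I hI H
    refine Sends.clique H.one_lt h.t_lt (fun _ => ?_) (by intro; omega) (by intro; omega)
      (by intro; omega) (by intro; omega) (by intro; omega) (by intro; omega) (by intro; omega)
    obtain ⟨s0, -, -, s3, -⟩ := sel_of_eq hI (hb i)
    have hl := H.len_mem
    have := Tr.countRound H (by
      have h1 := h.words
      dsimp only at hl ⊢
      nlinarith)
    rw [s0, s3] at this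
    exact this.sends
  · intro j
    rw [sum_keepMsgs]
    simp only [map_sum, inboxHom_msg, sum_ite_singleton, Box.inbox, countBox, enc_zero, enc_sum,
      add_zero]
    congr 1
    refine Finset.sum_congr rfl fun i _ => ?_
    simp [enc]

theorem active_lt {adj : ℕ → ℕ → Prop} {n : ℕ} {C : Finset ℕ} {v : ℕ} (hv : v ∈ active adj n C) : v < n :=
  (mem_active.1 hv).1

/-- Machine `0` knows the active vertices. -/
noncomputable def activeBox (n : ℕ) (adj : ℕ → ℕ → Prop) (E : Fin M → Multiset (ℕ × ℕ)) (C : Finset ℕ)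
    (j : Fin M) : Box where
  e := E j
  c := plain C
  a := if (j : ℕ) = 0 then plain (active adj n C) else 0

theorem card_active_le (adj : ℕ → ℕ → Prop) (n : ℕ) (C : Finset ℕ) : (active adj n C).card ≤ n := by
  have h : active adj n C ⊆ Finset.range n := fun v hv => Finset.mem_range.2 (active_lt hv)
  simpa using Finset.card_le_card h

theorem activeBox_valid (h : Setting n M cap q r R adj E t C) (j : Fin M) :
    (activeBox n adj E C j).Valid n cap := by
  refine h.valid j _ rfl rfl ?_ ?_
  · intro p hp
    simp only [activeBox, add_zero] at hp
    split_ifs at hp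
    · simp only [plain, Multiset.mem_map, Finset.mem_val] at hp
      obtain ⟨v, hv, rfl⟩ := hp
      exact ⟨active_lt hv, Nat.zero_le _⟩
    · simp at hp
  · have h1 := h.n_le
    have h2 := card_active_le adj n C
    simp only [activeBox, add_zero]
    split_ifs
    · simp only [plain, Multiset.card_map, Finset.card_val]
      omega
    · simp

theorem reaches_active (h : Setting n M cap q r R adj E t C) (ht : t % 8 = 1)
    (hr : Reaches (.clique q (r - 1)) R n M coin input t (countBox n E C)) :
    Reaches (.clique q (r - 1)) R n M coin input (t + 1) (activeBox n adj E C) := by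
  classical
  have hb := countBox_valid h
  refine hr.step h.toParams h.time hb (fun i => keepMsgs n E C (∑ v ∈ Finset.range n,
    if v % M = i ∧ v ∈ active adj n C then {msg n 0 1 v 0} else 0) i) ?_ ?_ _ ?_
  · intro i
    refine card_keepMsgs h _ i ?_
    have h1 := h.n_le
    refine (card_msgs _ _ 1 fun v _ => ?_).trans ?_
    · split_ifs <;> simp
    · simp
      omega
  · intro i I hI H
    refine Sends.clique H.one_lt h.t_lt (by intro; omega) (fun _ => ?_) (by intro; omega)
      (by intro; omega) (by intro; omega) (by intro; omega) (by intro; omega) (by intro; omega)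
    obtain ⟨s0, -, -, s3, -, -, s6⟩ := sel_of_eq hI (hb i)
    have hl := H.len_mem
    have := Tr.activeRound H (by
      have h1 := h.words
      have h2 := sum_map_le_card (sel n 6 I) (fun p => p.2) n (by
        rw [s6]
        intro p hp
        exact ((hb i).lt p (by simp [Box.total, hp])).2)
      have h3 := card_sel_le n 6 (I : Multiset (ℕ × ℕ))
      rw [Multiset.coe_card] at h3
      have h4 := h.n_le
      have h5 := h.cap_le
      dsimp only at hl ⊢
      have h6 : Multiset.card (sel n 6 (I : Multiset (ℕ × ℕ))) * n ≤ R.S * R.S :=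
        Nat.mul_le_mul (by omega) (by omega)
      have h7 : 4 * R.S * R.S = 4 * (R.S * R.S) := by ring
      omega)
    rw [s0, s3, s6] at this
    -- The sum of the partial counts is the number of clique vertices adjacent to `v`; it equals the
    -- size of the clique exactly when `v` is active.
    have key : ∀ v ∈ Finset.range n, (v % M = i ∧ ((countBox n E C i).p.map fun p =>
        (if p.1 = v then 1 else 0) * p.2).sum = Multiset.card (countBox n E C i).c ↔
        v % M = i ∧ v ∈ active adj n C) := by
      intro v hv
      refine and_congr_right fun hvi => ?_
      have hsum : ((countBox n E C i).p.map fun p => (if p.1 = v then 1 else 0) * p.2).sum =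
          (C.filter (adj v)).card := by
        simp only [countBox]
        rw [← h.graph.sum_edgesTo C v, sum_map_sum]
        refine Finset.sum_congr rfl fun i' _ => ?_
        rw [sum_map_map]
        simp only [ite_mul, one_mul, zero_mul]
        rw [Finset.sum_ite_eq', if_pos]
        simpa using ⟨Finset.mem_range.1 hv, hvi⟩
      have hcard : Multiset.card (countBox n E C i).c = C.card := by simp [countBox, plain]
      rw [hsum, hcard, Finset.card_filter_eq_iff, mem_active]
      simp only [Finset.mem_range.1 hv, true_and]
    rw [Finset.sum_congr rfl fun v hv => if_congr (key v hv) rfl rfl] at this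
    exact this.sends
  · intro j
    rw [sum_keepMsgs]
    simp only [map_sum, Box.inbox, activeBox, enc_zero, add_zero]
    have h1 : ∀ (i : Fin M) (v : ℕ), inboxHom j (if v % M = i ∧ v ∈ active adj n C then
        {msg n 0 1 v 0} else 0) = if v % M = i then (if v ∈ active adj n C then
          (if 0 = (j : ℕ) then {(1 * n + v, 0)} else 0) else 0) else 0 := by
      intro i v
      rw [apply_ite (inboxHom j), inboxHom_msg, map_zero, ite_and]
    simp only [h1]
    rw [Finset.sum_comm]
    simp only [sum_machines h.M_pos]
    rw [← Finset.sum_filter]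
    have h2 : (Finset.range n).filter (· ∈ active adj n C) = active adj n C := by
      ext v
      simp only [Finset.mem_filter, Finset.mem_range, and_iff_right_iff_imp]
      exact active_lt
    rw [h2, add_assoc, add_comm, add_assoc]
    split_ifs with hj hj' hj'
    · rw [sum_singleton_map]
      simp [enc, plain, add_comm]
    · omega
    · omega
    · simp [enc_zero, add_comm]

end stages

open Classical in
/-- The sampled vertices of `A`. -/
noncomputable def sampleSet (coin : ℕ → Bool) (e : ℕ) (A : Finset ℕ) : Finset ℕ :=
  A.filter (sampled coin e)

section stages

variable {n M cap q r : ℕ} {R : Resources} {coin : ℕ × ℕ × ℕ → Bool} {input : Fin M → Inbox}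
  {adj : ℕ → ℕ → Prop} {E : Fin M → Multiset (ℕ × ℕ)} {t : ℕ} {C T D : Finset ℕ}

theorem sum_lab {α : Type*} [AddCommMonoid α] (T S : Finset ℕ) (f : ℕ × ℕ → α) :
    ((lab T S).map f).sum = ∑ v ∈ S, f (rk T v, v) := sum_map_map _ _ _

theorem sum_plain {α : Type*} [AddCommMonoid α] (S : Finset ℕ) (f : ℕ × ℕ → α) :
    ((plain S).map f).sum = ∑ v ∈ S, f (v, 0) := sum_map_map _ _ _

theorem card_le_of_lt (hT : ∀ v ∈ T, v < n) : T.card ≤ n := by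
  have : T ⊆ Finset.range n := fun v hv => Finset.mem_range.2 (hT v hv)
  simpa using Finset.card_le_card this

theorem lab_lt {S : Finset ℕ} (hS : S ⊆ T) (hT : ∀ v ∈ T, v < n) {p : ℕ × ℕ} (hp : p ∈ lab T S) :
    p.1 < n ∧ p.2 < n := by
  simp only [lab, Multiset.mem_map, Finset.mem_val] at hp
  obtain ⟨v, hv, rfl⟩ := hp
  exact ⟨(rk_lt (hS hv)).trans_le (card_le_of_lt hT), hT v (hS hv)⟩

/-- The labelled vertices `S ⊆ T` are scattered. -/
def labelBox (E : Fin M → Multiset (ℕ × ℕ)) (C T S : Finset ℕ) (j : Fin M) : Box where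
  e := E j
  c := plain C
  t := lab T (atMachine M T S j)

theorem labelBox_valid (h : Setting n M cap q r R adj E t C) {S : Finset ℕ} (hS : S ⊆ T)
    (hT : ∀ v ∈ T, v < n) (j : Fin M) : (labelBox E C T S j).Valid n cap := by
  have hS' : atMachine M T S j ⊆ T := (Finset.filter_subset _ _).trans hS
  refine h.valid j _ rfl rfl ?_ ?_
  · intro p hp
    simp only [labelBox, add_zero, zero_add] at hp
    have := lab_lt hS' hT hp
    exact ⟨this.1, this.2.le⟩
  · have h1 := Finset.card_le_card hS'
    have h2 := card_le_of_lt hT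
    have h3 := h.n_le
    simp only [labelBox, add_zero, zero_add, lab, Multiset.card_map, Finset.card_val]
    omega

theorem scatter_labels (T S : Finset ℕ) (j : Fin M) :
    inboxHom j (∑ v ∈ S, {msg n (rk T v % M) 2 (rk T v) v}) = enc n 2 (lab T (atMachine M T S j)) := by
  simp only [map_sum, inboxHom_msg, sum_ite_singleton]
  simp [enc, lab, atMachine]

theorem sum_machine_zero (hM : 0 < M) {α : Type*} [AddCommMonoid α] (X : α) :
    ∑ i : Fin M, (if (i : ℕ) = 0 then X else 0) = X := by
  have := sum_machines hM 0 X
  simp only [Nat.zero_mod] at this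
  simpa only [eq_comm] using this

theorem reaches_label (h : Setting n M cap q r R adj E t C) (ht : t % 8 = 2)
    (hr : Reaches (.clique q (r - 1)) R n M coin input t (activeBox n adj E C))
    (hT : T = sampleSet (fun k => coin (t, 0, k)) (sampleExp q n (t / 8)) (active adj n C)) :
    Reaches (.clique q (r - 1)) R n M coin input (t + 1) (labelBox E C T T) := by
  classical
  have hb := activeBox_valid h
  have hTA : T ⊆ active adj n C := hT ▸ Finset.filter_subset _ _
  have hTn : T.card ≤ n := card_le_of_lt fun v hv => active_lt (hTA hv)
  refine hr.step h.toParams h.time hb (fun i => keepMsgs n E C (if (i : ℕ) = 0 then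
    ∑ v ∈ T, {msg n (rk T v % M) 2 (rk T v) v} else 0) i) ?_ ?_ _ ?_
  · intro i
    refine card_keepMsgs h _ i ?_
    have h1 := h.n_le
    split_ifs
    · refine (card_msgs _ _ 1 fun v _ => by simp).trans ?_
      omega
    · simp
  · intro i I hI H
    refine Sends.clique H.one_lt h.t_lt (by intro; omega) (by intro; omega) (fun _ => ?_)
      (by intro; omega) (by intro; omega) (by intro; omega) (by intro; omega) (by intro; omega)
    obtain ⟨s0, s1, -, s3, -, -, -⟩ := sel_of_eq hI (hb i)
    have h1 := h.words
    have h2 := h.S_lt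
    have h3 := h.n_le
    have h4 := h.cap_le
    have h5 := h.q_le
    have h6 := h.round
    have h7 := h.r_le
    have hlog : Nat.log 2 n < n := Nat.log_lt_self 2 h.n_pos.ne'
    refine Tr.sends_seq (A := fun mem' => MemHolds mem' I ∧ ∀ v < n, mem' (2 * I.length + v) =
      sampleCell (fun k => coin (t, i, k)) (sampleExp q n (t / 8)) v) ?_ ?_ (ext := [])
    · refine (wp_sample H (q := q) (by dsimp only; omega) ?_ h.t_lt (frame_initState n M i t I)
        rfl).mono ?_
      · dsimp only
        have : (t / 8 + 1) * (Nat.log 2 n + 1) ≤ R.S * R.S := Nat.mul_le_mul (by omega) (by omega)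
        have h8 : 4 * R.S * R.S = 4 * (R.S * R.S) := by ring
        omega
      · rintro σ ⟨mem', a1, a2, a3, a4⟩
        exact ⟨mem', a1, ⟨a2, a3⟩, a4⟩
    · rintro mem' ⟨hm, hc⟩
      have key := fun hrk => Tr.labelRound (H.change hm) hc (fun v _ => by
        unfold sampleCell; split_ifs <;> simp) hrk
      rw [s0, s1, s3] at key
      -- All machines draw bits, but only machine `0` holds active vertices; elsewhere the samples
      -- have no effect.
      by_cases hi : (i : ℕ) = 0
      · have ha : (activeBox n adj E C i).a = plain (active adj n C) := by simp [activeBox, hi]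
        rw [ha] at key
        simp only [hi] at key hm hc ⊢
        have hcell : ∀ v ∈ active adj n C, sampleCell (fun k => coin (t, 0, k))
            (sampleExp q n (t / 8)) v = if v ∈ T then 1 else 0 := by
          intro v hv
          unfold sampleCell
          simp [hT, sampleSet, hv]
        have hrank : ∀ v, rankIn (sampleCell (fun k => coin (t, 0, k)) (sampleExp q n (t / 8)))
            (plain (active adj n C)) v = rk T v := by
          intro v
          rw [rankIn, sum_plain, rk, Finset.card_filter, ← Finset.sum_subset hTA]
          · refine Finset.sum_congr rfl fun u hu => ?_
            simp [hcell u (hTA hu), hu]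
          · intro u hu hu'
            simp [hcell u hu, hu']
        simp only [hrank] at key
        refine (key ?_).congr ?_
        · intro p hp hp'
          simp only [plain, Multiset.mem_map, Finset.mem_val] at hp
          obtain ⟨v, hv, rfl⟩ := hp
          have hvT : v ∈ T := by
            by_contra hvT
            simp [hcell v hv, hvT] at hp'
          exact (rk_lt hvT).trans_le hTn
        · have hsum : ((plain (active adj n C)).map fun p =>
              if sampleCell (fun k => coin (t, 0, k)) (sampleExp q n (t / 8)) p.1 ≠ 0 then
                ({msg n (rk T p.1 % M) 2 (rk T p.1) p.1} : Multiset Message) else 0).sum =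
              ∑ v ∈ T, {msg n (rk T v % M) 2 (rk T v) v} := by
            rw [sum_plain, ← Finset.sum_subset hTA]
            · refine Finset.sum_congr rfl fun u hu => ?_
              simp [hcell u (hTA hu), hu]
            · intro u hu hu'
              simp [hcell u hu, hu']
          rw [hsum]
          simp only [keepMsgs, hi, if_true]
          rfl
      · have ha : (activeBox n adj E C i).a = 0 := by simp [activeBox, hi]
        rw [ha] at key
        refine (key (by simp)).congr ?_
        simp only [keepMsgs, hi, if_false, Multiset.map_zero, Multiset.sum_zero]
        rfl
  · intro j
    rw [sum_keepMsgs]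
    simp only [apply_ite (inboxHom (j : ℕ)), map_zero]
    rw [sum_machine_zero h.M_pos, scatter_labels]
    simp only [Box.inbox, labelBox, enc_zero, add_zero]
    rw [add_right_comm]

/-- All machines know the labelled vertices `T`. -/
def sharedBox (E : Fin M → Multiset (ℕ × ℕ)) (C T : Finset ℕ) (j : Fin M) : Box where
  e := E j
  c := plain C
  t := lab T T

theorem sharedBox_valid (h : Setting n M cap q r R adj E t C) (hT : ∀ v ∈ T, v < n) (j : Fin M) :
    (sharedBox E C T j).Valid n cap := by
  refine h.valid j _ rfl rfl ?_ ?_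
  · intro p hp
    simp only [sharedBox, add_zero, zero_add] at hp
    have := lab_lt subset_rfl hT hp
    exact ⟨this.1, this.2.le⟩
  · have h2 := card_le_of_lt hT
    have h3 := h.n_le
    simp only [sharedBox, add_zero, zero_add, lab, Multiset.card_map, Finset.card_val]
    omega

theorem sum_range_machine {α : Type*} [AddCommMonoid α] (j : Fin M) (X : α) :
    ∑ k ∈ Finset.range M, (if k = (j : ℕ) then X else 0) = X := by
  simp

theorem sum_atMachine (hM : 0 < M) {α : Type*} [AddCommMonoid α] (T S : Finset ℕ) (f : ℕ → α) :
    ∑ i : Fin M, ∑ v ∈ atMachine M T S i, f v = ∑ v ∈ S, f v := by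
  simp only [atMachine, Finset.sum_filter]
  rw [Finset.sum_comm]
  exact Finset.sum_congr rfl fun v _ => sum_machines hM _ _

/-- Each share has at most `T.card / M + 1` vertices and goes to `M` machines, so a machine sends at
most `2 * n` broadcast messages. -/
theorem card_broadcast_le (h : Setting n M cap q r R adj E t C) {S : Finset ℕ} (hS : S ⊆ T)
    (hT : ∀ v ∈ T, v < n) (i : ℕ) (f : ℕ → ℕ → Message) :
    Multiset.card (∑ v ∈ atMachine M T S i, ∑ j ∈ Finset.range M, ({f v j} : Multiset Message)) ≤
      19 * cap := by
  refine (card_msgs _ _ M fun v _ => by simp).trans ?_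
  have h1 := card_atMachine_le h.M_pos hS i
  have h2 := mul_div_add_one_le T.card (card_le_of_lt hT) h.M_le
  have h3 := Nat.mul_le_mul_right M h1
  have h4 := h.n_le
  omega

theorem reaches_share (h : Setting n M cap q r R adj E t C) (ht : t % 8 = 3) (hT : ∀ v ∈ T, v < n)
    (hr : Reaches (.clique q (r - 1)) R n M coin input t (labelBox E C T T)) :
    Reaches (.clique q (r - 1)) R n M coin input (t + 1) (sharedBox E C T) := by
  have hb := labelBox_valid h (subset_refl T) hT
  refine hr.step h.toParams h.time hb (fun i => keepMsgs n E C (∑ v ∈ atMachine M T T i,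
    ∑ j ∈ Finset.range M, {msg n j 2 (rk T v) v}) i) ?_ ?_ _ ?_
  · intro i
    exact card_keepMsgs h _ i (card_broadcast_le h subset_rfl hT i _)
  · intro i I hI H
    refine Sends.clique H.one_lt h.t_lt (by intro; omega) (by intro; omega) (by intro; omega)
      (fun _ => ?_) (by intro; omega) (by intro; omega) (by intro; omega) (by intro; omega)
    obtain ⟨s0, -, s2, s3, -⟩ := sel_of_eq hI (hb i)
    have := Tr.shareRound H
    rw [s0, s2, s3] at this
    simp only [labelBox, sum_lab] at this
    exact this.sends
  · intro j
    rw [sum_keepMsgs]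
    simp only [map_sum, inboxHom_msg, sum_range_machine, sum_atMachine h.M_pos]
    rw [sum_singleton_map]
    simp only [Box.inbox, sharedBox, enc_zero, add_zero]
    rw [add_right_comm]
    simp [enc, lab]

/-- All machines extend the clique by the scattered vertices. -/
theorem reaches_extend (h : Setting n M cap q r R adj E t C) (ht : t % 8 = 7) (hT : ∀ v ∈ T, v < n)
    (hD : D ⊆ T) (hCD : Disjoint C D)
    (hr : Reaches (.clique q (r - 1)) R n M coin input t (labelBox E C T D)) :
    Reaches (.clique q (r - 1)) R n M coin input (t + 1)
      fun i => { e := E i, c := plain (C ∪ D) } := by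
  have hb := labelBox_valid h hD hT
  refine hr.step h.toParams h.time hb (fun i => keepMsgs n E C (∑ v ∈ atMachine M T D i,
    ∑ j ∈ Finset.range M, {msg n j 3 v 0}) i) ?_ ?_ _ ?_
  · intro i
    exact card_keepMsgs h _ i (card_broadcast_le h hD hT i _)
  · intro i I hI H
    refine Sends.clique H.one_lt h.t_lt (by intro; omega) (by intro; omega) (by intro; omega)
      (by intro; omega) (by intro; omega) (by intro; omega) (by intro; omega) (fun _ => ?_)
    obtain ⟨s0, -, s2, s3, -⟩ := sel_of_eq hI (hb i)
    have := Tr.extendRound H (by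
      rw [s2]
      intro p hp
      exact (lab_lt ((Finset.filter_subset _ _).trans hD) hT hp).2)
    rw [s0, s2, s3] at this
    simp only [labelBox, sum_lab] at this
    exact this.sends
  · intro j
    rw [sum_keepMsgs]
    simp only [map_sum, inboxHom_msg, sum_range_machine, sum_atMachine h.M_pos]
    rw [sum_singleton_map]
    simp only [Box.inbox, enc_zero, add_zero]
    rw [add_assoc]
    congr 1
    -- Received pairs form a multiset, so disjointness matters: a clique vertex listed twice would
    -- spoil the comparison of counts in the next phase.
    have hval : (C ∪ D).val = C.val + D.val := by
      rw [← Finset.disjUnion_eq_union C D hCD]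
      rfl
    simp [enc, plain, hval]

open Classical in
/-- The rows of the adjacency matrix of `T` are distributed. -/
noncomputable def rowBox (E : Fin M → Multiset (ℕ × ℕ)) (C T : Finset ℕ) (j : Fin M) : Box where
  e := E j
  c := plain C
  t := lab T T
  r := ∑ i, ∑ x ∈ atMachine M T T j, (T.filter fun y => ((E i).map (hit x y)).sum ≠ 0).val.map
    fun y => (x, y)

theorem mem_rowBox (h : Setting n M cap q r R adj E t C) (j : Fin M) (x y : ℕ) :
    (x, y) ∈ (rowBox E C T j).r ↔ x ∈ T ∧ rk T x % M = j ∧ y ∈ T ∧ adj x y := by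
  have key : adj x y ↔ ∃ i, ((E i).map (hit x y)).sum ≠ 0 := by
    constructor
    · intro ha
      by_contra hne
      push Not at hne
      have := h.graph.hit_of_adj x y ha
      simp [hne] at this
    · rintro ⟨i, hi⟩
      by_contra ha
      have := h.graph.hit_of_not_adj x y ha
      exact hi (Finset.sum_eq_zero_iff.1 this i (Finset.mem_univ i))
  simp only [rowBox, Multiset.mem_sum, Multiset.mem_map, Finset.mem_val, Finset.mem_filter,
    Finset.mem_univ, true_and, atMachine, Prod.mk.injEq, key]
  constructor
  · rintro ⟨i, x', ⟨hx, hx'⟩, y', ⟨hy, hi⟩, rfl, rfl⟩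
    exact ⟨hx, hx', hy, i, hi⟩
  · rintro ⟨hx, hx', hy, i, hi⟩
    exact ⟨i, x, ⟨hx, hx'⟩, y, ⟨hy, hi⟩, rfl, rfl⟩

theorem rowBox_valid (h : Setting n M cap q r R adj E t C) (hT : ∀ v ∈ T, v < n)
    (hmiss : Multiset.card (missing adj T) ≤ cap) (j : Fin M) : (rowBox E C T j).Valid n cap := by
  have hTn := card_le_of_lt hT
  refine h.valid j _ rfl rfl ?_ ?_
  · rintro ⟨x, y⟩ hp
    simp only [Multiset.mem_add] at hp
    rcases hp with (((hp | hp) | hp) | hp) | hp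
    · simp [rowBox] at hp
    · have := lab_lt subset_rfl hT hp
      exact ⟨this.1, this.2.le⟩
    · obtain ⟨hx, -, hy, -⟩ := (mem_rowBox h j x y).1 hp
      exact ⟨hT x hx, (hT y hy).le⟩
    · simp [rowBox] at hp
    · simp [rowBox] at hp
  · have h1 := h.graph.row_le h.M_pos h.n_le hTn hmiss
    have h2 : Multiset.card (rowBox E C T j).r ≤ (T.card / M + 1) * T.card := by
      classical
      simp only [rowBox, Multiset.card_sum, Multiset.card_map, Finset.card_val, Finset.card_filter]
      rw [Finset.sum_comm]
      calc ∑ x ∈ atMachine M T T j, ∑ i, ∑ y ∈ T, (if ((E i).map (hit x y)).sum ≠ 0 then 1 else 0)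
          ≤ ∑ x ∈ atMachine M T T j, ∑ i, ∑ y ∈ T, ((E i).map (hit x y)).sum := by
            gcongr with x _ i _ y _
            split_ifs <;> omega
        -- Over all machines together, an ordered pair is hit at most once.
        _ ≤ ∑ x ∈ atMachine M T T j, ∑ y ∈ T, 1 := by
            refine Finset.sum_le_sum fun x _ => ?_
            rw [Finset.sum_comm]
            refine Finset.sum_le_sum fun y _ => ?_
            by_cases ha : adj x y
            · exact (h.graph.hit_of_adj x y ha).le
            · rw [h.graph.hit_of_not_adj x y ha]
              exact Nat.zero_le _
        _ = (atMachine M T T j).card * T.card := by simp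
        _ ≤ _ := Nat.mul_le_mul_right _ (card_atMachine_le h.M_pos subset_rfl j)
    have h3 : Multiset.card (rowBox E C T j).t ≤ n := by simpa [rowBox, lab] using hTn
    have h4 := h.n_le
    simp only [Multiset.card_add]
    have h5 : Multiset.card (rowBox E C T j).a = 0 ∧ Multiset.card (rowBox E C T j).d = 0 ∧
      Multiset.card (rowBox E C T j).p = 0 := by simp [rowBox]
    omega

theorem card_keep_lab_le (hT : ∀ v ∈ T, v < n) (i : ℕ) (X : Multiset Message) {b : ℕ}
    (hX : Multiset.card X ≤ b) :
    Multiset.card ((lab T T).map (fun p => msg n i 2 p.1 p.2) + X) ≤ n + b := by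
  have h2 := card_le_of_lt hT
  simp only [Multiset.card_add, Multiset.card_map, lab, Finset.card_val]
  omega

theorem reaches_row (h : Setting n M cap q r R adj E t C) (ht : t % 8 = 4) (hT : ∀ v ∈ T, v < n)
    (hr : Reaches (.clique q (r - 1)) R n M coin input t (sharedBox E C T)) :
    Reaches (.clique q (r - 1)) R n M coin input (t + 1) (rowBox E C T) := by
  classical
  have hb := sharedBox_valid h hT
  refine hr.step h.toParams h.time hb (fun i => keepMsgs n E C
    ((lab T T).map (fun p => msg n i 2 p.1 p.2) + ∑ x ∈ T, ∑ y ∈ T,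
      if ((E i).map (hit x y)).sum ≠ 0 then {msg n (rk T x % M) 4 x y} else 0) i) ?_ ?_ _ ?_
  · intro i
    have h1 := h.n_le
    refine card_keepMsgs h _ i ((card_keep_lab_le hT i _ (b := 2 * cap) ?_).trans (by omega))
    have h2 := sum_sum_hit_le T (E i)
    have h3 := h.graph.card i
    refine le_trans ?_ (h2.trans (by omega))
    simp only [Multiset.card_sum]
    gcongr with x _ y _
    split_ifs
    · simp
      omega
    · simp
  · intro i I hI H
    refine Sends.clique H.one_lt h.t_lt (by intro; omega) (by intro; omega) (by intro; omega)
      (by intro; omega) (fun _ => ?_) (by intro; omega) (by intro; omega) (by intro; omega)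
    obtain ⟨s0, -, s2, s3, -⟩ := sel_of_eq hI (hb i)
    have := Tr.rowRound H (by
      rw [s2]
      intro p hp
      exact (lab_lt subset_rfl hT hp).2)
    rw [s0, s2, s3] at this
    simp only [sharedBox, sum_lab] at this
    exact this.sends
  · intro j
    rw [sum_keepMsgs]
    simp only [map_add, Finset.sum_add_distrib]
    rw [sum_keep n 2 (fun _ => lab T T) j]
    simp only [Box.inbox, rowBox, enc_zero, add_zero, enc_sum]
    have : ∀ i : Fin M, inboxHom j (∑ x ∈ T, ∑ y ∈ T, if ((E i).map (hit x y)).sum ≠ 0 then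
        {msg n (rk T x % M) 4 x y} else 0) = ∑ x ∈ atMachine M T T j, enc n 4
          ((T.filter fun y => ((E i).map (hit x y)).sum ≠ 0).val.map fun y => (x, y)) := by
      intro i
      simp only [map_sum, atMachine, Finset.sum_filter]
      refine Finset.sum_congr rfl fun x _ => ?_
      simp only [apply_ite (inboxHom (j : ℕ)), inboxHom_msg, map_zero]
      split_ifs with hx
      · rw [sum_ite_singleton]
        simp [enc]
      · simp
    simp only [this]
    abel

/-- Machine `0` knows the missing edges. -/
noncomputable def missingBox (adj : ℕ → ℕ → Prop) (E : Fin M → Multiset (ℕ × ℕ)) (C T : Finset ℕ)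
    (j : Fin M) : Box where
  e := E j
  c := plain C
  t := lab T T
  d := if (j : ℕ) = 0 then missing adj T else 0

theorem mem_missing {x y : ℕ} : (x, y) ∈ missing adj T ↔ x ∈ T ∧ y ∈ T ∧ y < x ∧ ¬ adj x y := by
  simp only [missing, Multiset.mem_sum, Multiset.mem_map, Finset.mem_val, Finset.mem_filter,
    Prod.mk.injEq]
  constructor
  · rintro ⟨x', hx, y', ⟨hy, h1, h2⟩, rfl, rfl⟩
    exact ⟨hx, hy, h1, h2⟩
  · rintro ⟨hx, hy, h1, h2⟩
    exact ⟨x, hx, y, ⟨hy, h1, h2⟩, rfl, rfl⟩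

theorem missingBox_valid (h : Setting n M cap q r R adj E t C) (hT : ∀ v ∈ T, v < n)
    (hmiss : Multiset.card (missing adj T) ≤ cap) (j : Fin M) :
    (missingBox adj E C T j).Valid n cap := by
  have hTn := card_le_of_lt hT
  refine h.valid j _ rfl rfl ?_ ?_
  · rintro ⟨x, y⟩ hp
    simp only [Multiset.mem_add] at hp
    rcases hp with (((hp | hp) | hp) | hp) | hp
    · simp [missingBox] at hp
    · have := lab_lt subset_rfl hT hp
      exact ⟨this.1, this.2.le⟩
    · simp [missingBox] at hp
    · simp only [missingBox] at hp
      split_ifs at hp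
      · obtain ⟨hx, hy, -⟩ := mem_missing.1 hp
        exact ⟨hT x hx, (hT y hy).le⟩
      · simp at hp
    · simp [missingBox] at hp
  · have h4 := h.n_le
    have h3 : Multiset.card (missingBox adj E C T j).t ≤ n := by simpa [missingBox, lab] using hTn
    have h5 : Multiset.card (missingBox adj E C T j).a = 0 ∧
      Multiset.card (missingBox adj E C T j).r = 0 ∧
      Multiset.card (missingBox adj E C T j).p = 0 := by simp [missingBox]
    have h6 : Multiset.card (missingBox adj E C T j).d ≤ cap := by
      simp only [missingBox]
      split_ifs
      · exact hmiss
      · simp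
    simp only [Multiset.card_add]
    omega

theorem reaches_missing (h : Setting n M cap q r R adj E t C) (ht : t % 8 = 5) (hT : ∀ v ∈ T, v < n)
    (hmiss : Multiset.card (missing adj T) ≤ cap)
    (hr : Reaches (.clique q (r - 1)) R n M coin input t (rowBox E C T)) :
    Reaches (.clique q (r - 1)) R n M coin input (t + 1) (missingBox adj E C T) := by
  classical
  have hb := rowBox_valid h hT hmiss
  refine hr.step h.toParams h.time hb (fun i => keepMsgs n E C
    ((lab T T).map (fun p => msg n i 2 p.1 p.2) + ∑ x ∈ T, if rk T x % M = i then
      (∑ y ∈ T, if y < x ∧ ¬ adj x y then {msg n 0 5 x y} else 0) else 0) i) ?_ ?_ _ ?_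
  · intro i
    have h1 := h.n_le
    refine card_keepMsgs h _ i ((card_keep_lab_le hT i _ (b := cap) ?_).trans (by omega))
    refine le_trans ?_ hmiss
    simp only [Multiset.card_sum, missing, Multiset.card_map, Finset.card_val, Finset.card_filter]
    refine Finset.sum_le_sum fun x _ => ?_
    split_ifs
    · rw [Multiset.card_sum]
      refine Finset.sum_le_sum fun y _ => ?_
      split_ifs <;> simp
    · simp
  · intro i I hI H
    refine Sends.clique H.one_lt h.t_lt (by intro; omega) (by intro; omega) (by intro; omega)
      (by intro; omega) (by intro; omega) (fun _ => ?_) (by intro; omega) (by intro; omega)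
    obtain ⟨s0, -, s2, s3, s4, -⟩ := sel_of_eq hI (hb i)
    have := Tr.missingRound H (by
      rw [s2]
      intro p hp
      exact (lab_lt subset_rfl hT hp).2)
    rw [s0, s2, s3, s4] at this
    have ht' : (rowBox E C T i).t = lab T T := rfl
    rw [ht'] at this
    simp only [sum_lab] at this
    refine (this.congr ?_).sends
    simp only [keepMsgs]
    congr 3
    refine Finset.sum_congr rfl fun x hx => ?_
    split_ifs with hxi
    · refine Finset.sum_congr rfl fun y hy => if_congr (and_congr_right fun _ => not_congr ?_) rfl rfl
      rw [mem_rowBox h]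
      simp [hx, hxi, hy]
    · rfl
  · intro j
    rw [sum_keepMsgs]
    simp only [map_add, Finset.sum_add_distrib]
    rw [sum_keep n 2 (fun _ => lab T T) j]
    simp only [map_sum, apply_ite (inboxHom (j : ℕ)), map_zero, inboxHom_msg]
    rw [Finset.sum_comm]
    simp only [sum_machines h.M_pos]
    have : ∑ x ∈ T, ∑ y ∈ T, (if y < x ∧ ¬ adj x y then (if 0 = (j : ℕ) then
        ({(5 * n + x, y)} : Multiset (ℕ × ℕ)) else 0) else 0) =
        enc n 5 (missingBox adj E C T j).d := by
      simp only [missingBox]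
      split_ifs with h1 h2 h2
      · rw [missing, enc_sum]
        refine Finset.sum_congr rfl fun x _ => ?_
        rw [sum_ite_singleton]
        simp [enc]
      · omega
      · omega
      · simp [enc_zero]
    rw [this]
    simp only [Box.inbox, missingBox, enc_zero, add_zero]
    abel

open Classical in
/-- The value `1` for the vertices that the greedy algorithm chooses or does not consider. -/
noncomputable def pickCell (adj : ℕ → ℕ → Prop) (n : ℕ) (T : Finset ℕ) (x : ℕ) : ℕ :=
  if x ∈ T → x ∈ greedySet adj T n then 1 else 0

theorem pickCell_le (adj : ℕ → ℕ → Prop) (n : ℕ) (T : Finset ℕ) (x : ℕ) : pickCell adj n T x ≤ 1 := by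
  unfold pickCell
  split_ifs <;> simp

theorem pickCell_ne_zero {x : ℕ} (hx : x ∈ T) : pickCell adj n T x ≠ 0 ↔ x ∈ greedySet adj T n := by
  simp [pickCell, hx]

/-- Every machine runs the greedy scan. Those other than machine `0` know no non-edges and set all
their cells to `1`, so the result is specified only for machine `0`. -/
theorem sends_greedy
    {p : Program} {i : Fin M} {I : Inbox} {L : Multiset Message} {c : Machine}
    (H : Fits c (initState n M i t I).mem n M i t I)
    (s5 : sel n 5 (I : Multiset (ℕ × ℕ)) = (missingBox adj E C T i).d)
    (hp : ∀ mem' cell, MemHolds mem' I → (∀ v < n, mem' (2 * I.length + v) = cell v) →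
      (∀ v < n, cell v ≤ 1) → ((i : ℕ) = 0 → cell = pickCell adj n T) →
      Tr c mem' p [n, M, i, t, I.length] [] L) :
    Sends c (.seq .greedy p) n M i t I L := by
  classical
  set pick : ℕ → ℕ := fun x => if (i : ℕ) = 0 then pickCell adj n T x else 1 with hpk
  refine Tr.sends_seq (A := fun mem' => MemHolds mem' I ∧ ∀ v < n, mem' (2 * I.length + v) = pick v)
    ?_ ?_ (ext := [])
  · refine (wp_greedy (pick := pick) H (fun v _ => ?_) ?_ ?_ (frame_initState n M i t I)).mono ?_
    · simp only [initState]
      rw [initState_mem_eq I _ (by omega)]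
      exact Nat.zero_le _
    · rw [s5]
      rintro ⟨x, y⟩ hp
      simp only [missingBox] at hp
      split_ifs at hp
      · exact (mem_missing.1 hp).2.2.1
      · simp at hp
    · rw [s5]
      intro x hx
      by_cases hi : (i : ℕ) = 0
      -- Cells outside `T` also become `1`, which is harmless: both ends of a missing pair lie in
      -- `T`, where the recursion is the greedy rule.
      · simp only [hpk, hi, if_true, missingBox]
        unfold pickCell
        refine if_congr ?_ rfl rfl
        simp only [mem_missing]
        constructor
        · rintro h1 y ⟨hxT, hyT, hyx, hna⟩
          rw [if_neg]
          intro h2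
          exact hna ((mem_greedySet_iff hxT hx).1 (h1 hxT) y (mem_greedySet_of_lt (h2 hyT) hyx))
        · intro h1 hxT
          rw [mem_greedySet_iff hxT hx]
          intro w hw
          have hwx := lt_of_mem_greedySet hw
          have hwT := mem_of_mem_greedySet hw
          by_contra hna
          have := h1 w ⟨hxT, hwT, hwx, hna⟩
          rw [if_pos fun _ => mem_greedySet_of_lt hw (hwx.trans hx)] at this
          exact one_ne_zero this
      · simp [hpk, hi, missingBox]
    · rintro σ ⟨mem', a1, a2, a3, a4⟩
      exact ⟨mem', a1, ⟨a2, a3⟩, a4⟩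
  · rintro mem' ⟨hm, hc⟩
    refine hp mem' pick hm hc (fun v _ => ?_) fun hi => ?_
    · simp only [hpk]
      split_ifs
      · exact pickCell_le _ _ _ _
      · exact le_rfl
    · ext x
      simp [hpk, hi]

theorem sum_pick {α : Type*} [AddCommMonoid α] (f : ℕ → α) :
    ∑ x ∈ T, (if pickCell adj n T x ≠ 0 then f x else 0) = ∑ x ∈ greedySet adj T n, f x := by
  classical
  have h1 : greedySet adj T n ⊆ T := fun x hx => mem_of_mem_greedySet hx
  rw [← Finset.sum_subset h1]
  · refine Finset.sum_congr rfl fun x hx => ?_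
    rw [if_pos ((pickCell_ne_zero (h1 hx)).2 hx)]
  · intro x hx hx'
    rw [if_neg fun h => hx' ((pickCell_ne_zero hx).1 h)]

theorem Setting.evalsTo_last (h : Setting n M cap q r R adj E t C) {c : Machine} {i : ℕ} {I : Inbox}
    (hW : c.W = R.W) : EvalsTo c.W [n, M, i, t, I.length] (.eq (.reg 3) (.const (r - 1)))
      (if t = r - 1 then 1 else 0) := by
  have h1 := h.t_lt
  have h2 := h.S_lt
  have h3 := h.r_le
  have h4 := h.n_le
  have h5 := h.cap_le
  exact .eq (.reg rfl (by omega)) (.const (by omega)) (by omega)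

theorem reaches_chosen (h : Setting n M cap q r R adj E t C) (ht : t % 8 = 6) (htr : t ≠ r - 1)
    (hT : ∀ v ∈ T, v < n) (hmiss : Multiset.card (missing adj T) ≤ cap)
    (hr : Reaches (.clique q (r - 1)) R n M coin input t (missingBox adj E C T)) :
    Reaches (.clique q (r - 1)) R n M coin input (t + 1) (labelBox E C T (greedySet adj T n)) := by
  have hb := missingBox_valid h hT hmiss
  have hg : greedySet adj T n ⊆ T := fun x hx => mem_of_mem_greedySet hx
  refine hr.step h.toParams h.time hb (fun i => keepMsgs n E C (if (i : ℕ) = 0 then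
    ∑ v ∈ greedySet adj T n, {msg n (rk T v % M) 2 (rk T v) v} else 0) i) ?_ ?_ _ ?_
  · intro i
    refine card_keepMsgs h _ i ?_
    have h1 := h.n_le
    have h2 := card_le_of_lt hT
    have h3 := Finset.card_le_card hg
    split_ifs
    · refine (card_msgs _ _ 1 fun v _ => by simp).trans ?_
      omega
    · simp
  · intro i I hI H
    refine Sends.clique H.one_lt h.t_lt (by intro; omega) (by intro; omega) (by intro; omega)
      (by intro; omega) (by intro; omega) (by intro; omega) (fun _ => ?_) (by intro; omega)
    obtain ⟨s0, -, s2, s3, -, s5, -⟩ := sel_of_eq hI (hb i)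
    refine sends_greedy H s5 fun mem' cell hm hc hc' hi => ?_
    refine Tr.ite (h.evalsTo_last rfl) (fun h' => absurd h' (by simp [htr])) fun _ => ?_
    have := Tr.chosenRound (H.change hm) (by
      rw [s2]
      intro p hp
      exact (lab_lt subset_rfl hT hp).2) hc hc'
    rw [s0, s2, s3] at this
    have ht' : (missingBox adj E C T i).t = lab T T := rfl
    rw [ht', sum_lab] at this
    refine this.congr ?_
    simp only [keepMsgs]
    by_cases h0 : (i : ℕ) = 0
    · simp only [h0, hi h0, if_true, sum_pick]
      rfl
    · simp only [h0, if_false]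
      rfl
  · intro j
    rw [sum_keepMsgs]
    simp only [apply_ite (inboxHom (j : ℕ)), map_zero]
    rw [sum_machine_zero h.M_pos, scatter_labels]
    simp only [Box.inbox, labelBox, enc_zero, add_zero]
    rw [add_right_comm]

theorem reaches_output (h : Setting n M cap q r R adj E t C) (ht : t % 8 = 6) (htr : t = r - 1)
    (hT : ∀ v ∈ T, v < n) (hmiss : Multiset.card (missing adj T) ≤ cap)
    (hr : Reaches (.clique q (r - 1)) R n M coin input t (missingBox adj E C T)) :
    ∃ cur, Run (.clique q (r - 1)) R n M coin input (t + 1) cur ∧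
      ∀ j : Fin M, (cur j : Multiset (ℕ × ℕ)) =
        if (j : ℕ) = 0 then plain C + plain (greedySet adj T n) else 0 := by
  have hb := missingBox_valid h hT hmiss
  have hg : greedySet adj T n ⊆ T := fun x hx => mem_of_mem_greedySet hx
  refine (hr.round h.toParams h.time hb (fun i => if (i : ℕ) = 0 then
    (plain C).map (fun p => msg n 0 0 p.1 0) + ∑ v ∈ greedySet adj T n, {msg n 0 0 v 0} else 0) ?_ ?_).imp ?_
  · intro i
    have h1 := h.n_le
    have h2 := card_le_of_lt hT
    have h3 := Finset.card_le_card hg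
    have h4 := h.card_le
    split_ifs
    · rw [Multiset.card_add, Multiset.card_map]
      have h5 : Multiset.card (plain C) = C.card := by simp [plain]
      have h6 := card_msgs (greedySet adj T n) (fun v => {msg n 0 0 v 0}) 1 fun v _ => by simp
      omega
    · simp
  · intro i I hI H
    refine Sends.clique H.one_lt h.t_lt (by intro; omega) (by intro; omega) (by intro; omega)
      (by intro; omega) (by intro; omega) (by intro; omega) (fun _ => ?_) (by intro; omega)
    obtain ⟨s0, -, s2, s3, -, s5, -⟩ := sel_of_eq hI (hb i)
    refine sends_greedy H s5 fun mem' cell hm hc hc' hi => ?_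
    refine Tr.ite (h.evalsTo_last rfl) (fun _ => ?_) fun h' => absurd h' (by simp [htr])
    have := Tr.outputRound (H.change hm) (by
      rw [s2]
      intro p hp
      exact (lab_lt subset_rfl hT hp).2) hc hc'
    rw [s2, s3] at this
    have ht' : (missingBox adj E C T i).t = lab T T := rfl
    rw [ht', sum_lab] at this
    refine this.congr ?_
    by_cases h0 : (i : ℕ) = 0
    · simp only [h0, hi h0, if_true, sum_pick]
      rfl
    · simp only [h0, if_false]
  · rintro cur ⟨h1, h2⟩
    refine ⟨h1, fun j => ?_⟩
    rw [h2 j]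
    simp only [apply_ite (inboxHom (j : ℕ)), map_zero]
    rw [sum_machine_zero h.M_pos, map_add, map_sum]
    rw [plain, Multiset.map_map, ← sum_map_singleton', map_multiset_sum, Multiset.map_map]
    simp only [Function.comp_def, inboxHom_msg, zero_mul, zero_add]
    split_ifs with hj hj' hj'
    · rw [sum_singleton_map, sum_map_singleton']
      rfl
    · omega
    · omega
    · simp

end stages

/-! ### Phases -/

/-- The clique before phase `i`. -/
noncomputable def cliqueAt (adj : ℕ → ℕ → Prop) (n q : ℕ) (coin : ℕ × ℕ × ℕ → Bool) : ℕ → Finset ℕ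
  | 0 => ∅
  | i + 1 => cliqueAt adj n q coin i ∪ greedySet adj (sampleSet (fun k => coin (8 * i + 2, 0, k))
      (sampleExp q n i) (active adj n (cliqueAt adj n q coin i))) n

/-- The vertices sampled in phase `i`. -/
noncomputable def sampleAt (adj : ℕ → ℕ → Prop) (n q : ℕ) (coin : ℕ × ℕ × ℕ → Bool) (i : ℕ) :
    Finset ℕ :=
  sampleSet (fun k => coin (8 * i + 2, 0, k)) (sampleExp q n i)
    (active adj n (cliqueAt adj n q coin i))

section phases

variable {n M cap q : ℕ} {R : Resources} {coin : ℕ × ℕ × ℕ → Bool} {input : Fin M → Inbox}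
  {adj : ℕ → ℕ → Prop} {E : Fin M → Multiset (ℕ × ℕ)}

theorem sampleAt_subset (adj : ℕ → ℕ → Prop) (n q : ℕ) (coin : ℕ × ℕ × ℕ → Bool) (i : ℕ) :
    sampleAt adj n q coin i ⊆ active adj n (cliqueAt adj n q coin i) := by
  classical
  exact Finset.filter_subset _ _

theorem greedySet_subset (adj : ℕ → ℕ → Prop) (T : Finset ℕ) (u : ℕ) : greedySet adj T u ⊆ T :=
  fun _ h => mem_of_mem_greedySet h

theorem cliqueAt_succ (adj : ℕ → ℕ → Prop) (n q : ℕ) (coin : ℕ × ℕ × ℕ → Bool) (i : ℕ) :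
    cliqueAt adj n q coin (i + 1) =
      cliqueAt adj n q coin i ∪ greedySet adj (sampleAt adj n q coin i) n := rfl

theorem cliqueAt_lt {i c : ℕ} (h : c ∈ cliqueAt adj n q coin i) : c < n := by
  induction i with
  | zero => simp [cliqueAt] at h
  | succ i ih =>
    rw [cliqueAt_succ, Finset.mem_union] at h
    rcases h with h | h
    · exact ih h
    · exact lt_of_mem_greedySet h

theorem cliqueAt_adj (hs : ∀ x y, adj x y → adj y x) {i v w : ℕ} (hv : v ∈ cliqueAt adj n q coin i)
    (hw : w ∈ cliqueAt adj n q coin i) (hvw : v ≠ w) : adj v w := by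
  induction i with
  | zero => simp [cliqueAt] at hv
  | succ i ih =>
    have hact : ∀ {x c}, x ∈ greedySet adj (sampleAt adj n q coin i) n →
        c ∈ cliqueAt adj n q coin i → adj x c := fun {x c} hx hc =>
      (mem_active.1 (sampleAt_subset _ _ _ _ _ (greedySet_subset _ _ _ hx))).2 c hc
    rw [cliqueAt_succ, Finset.mem_union] at hv hw
    rcases hv with hv | hv <;> rcases hw with hw | hw
    · exact ih hv hw
    · exact hs _ _ (hact hw hv)
    · exact hact hv hw
    · exact greedySet_clique hs hv hw hvw

theorem disjoint_greedy (hi : ∀ x, ¬ adj x x) (i : ℕ) :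
    Disjoint (cliqueAt adj n q coin i) (greedySet adj (sampleAt adj n q coin i) n) := by
  rw [Finset.disjoint_left]
  intro c hc hc'
  exact hi c ((mem_active.1 (sampleAt_subset _ _ _ _ _ (greedySet_subset _ _ _ hc'))).2 c hc)

theorem sampleAt_of_exp_eq_zero {i : ℕ} (h : sampleExp q n i = 0) :
    sampleAt adj n q coin i = active adj n (cliqueAt adj n q coin i) := by
  classical
  rw [sampleAt, sampleSet, Finset.filter_eq_self]
  intro v _
  simp [sampled, h]

/-- After a phase in which all active vertices are sampled, the clique is maximal. -/
theorem cliqueAt_maximal {i : ℕ} (h : sampleExp q n i = 0) {v : ℕ}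
    (hv : v < n) (hadj : ∀ c ∈ cliqueAt adj n q coin (i + 1), v ≠ c → adj v c) :
    v ∈ cliqueAt adj n q coin (i + 1) := by
  rw [cliqueAt_succ]
  by_contra hne
  rw [cliqueAt_succ] at hadj
  have h1 : ∀ c ∈ cliqueAt adj n q coin i, adj v c := fun c hc =>
    hadj c (Finset.mem_union_left _ hc) fun hvc => hne (hvc ▸ Finset.mem_union_left _ hc)
  have h2 : v ∈ sampleAt adj n q coin i := by
    rw [sampleAt_of_exp_eq_zero h, mem_active]
    exact ⟨hv, h1⟩
  apply hne
  apply Finset.mem_union_right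
  rw [mem_greedySet_iff h2 hv]
  intro w hw
  have hwv := lt_of_mem_greedySet hw
  exact hadj w (Finset.mem_union_right _ (mem_greedySet_of_lt hw (hwv.trans hv))) hwv.ne'

/-- Phases take eight rounds, but the last one ends with the seventh stage: in round `8 * p + 6`
machine `0` outputs the old clique with the newly chosen vertices instead of distributing them. -/
theorem reaches_phase {p : ℕ} (hp : Params n M cap q (8 * p + 7) R) (hE : Represents n cap adj E)
    (hT : (Program.clique q (8 * p + 6)).time R.S ≤ R.T)
    (hgood : ∀ i ≤ p, Multiset.card (missing adj (sampleAt adj n q coin i)) ≤ cap)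
    (hin : ∀ i, (input i : Multiset (ℕ × ℕ)) = E i) :
    ∃ final, Run (.clique q (8 * p + 6)) R n M coin input (8 * p + 7) final ∧
      ∀ j : Fin M, (final j : Multiset (ℕ × ℕ)) = if (j : ℕ) = 0 then
        plain (cliqueAt adj n q coin p) + plain (greedySet adj (sampleAt adj n q coin p) n) else 0 := by
  have hset : ∀ i t, t ≤ 8 * p + 7 →
      Setting n M cap q (8 * p + 7) R adj E t (cliqueAt adj n q coin i) := fun i t ht =>
    { hp with
      graph := hE
      time := hT
      round := ht
      clique_lt := fun c hc => cliqueAt_lt hc }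
  have hlt : ∀ i, ∀ v ∈ sampleAt adj n q coin i, v < n := fun i v hv =>
    active_lt (sampleAt_subset _ _ _ _ _ hv)
  have hsix : ∀ i ≤ p, Reaches (.clique q (8 * p + 6)) R n M coin input (8 * i)
      (fun j => { e := E j, c := plain (cliqueAt adj n q coin i) }) →
      Reaches (.clique q (8 * p + 6)) R n M coin input (8 * i + 6)
        (missingBox adj E (cliqueAt adj n q coin i) (sampleAt adj n q coin i)) := by
    intro i hi h0
    have h1 := reaches_count (hset i _ (by omega)) (by omega) h0
    have h2 := reaches_active (hset i _ (by omega)) (by omega) h1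
    have h3 := reaches_label (T := sampleAt adj n q coin i) (hset i _ (by omega)) (by omega) h2 (by
      rw [show (8 * i + 1 + 1) / 8 = i by omega]
      rfl)
    have h4 := reaches_share (hset i _ (by omega)) (by omega) (hlt i) h3
    have h5 := reaches_row (hset i _ (by omega)) (by omega) (hlt i) h4
    exact reaches_missing (hset i _ (by omega)) (by omega) (hlt i) (hgood i hi) h5
  have hphase : ∀ i ≤ p, Reaches (.clique q (8 * p + 6)) R n M coin input (8 * i)
      (fun j => { e := E j, c := plain (cliqueAt adj n q coin i) }) := by
    intro i
    induction i with
    | zero =>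
      intro _
      refine ⟨input, .start, fun j => ?_⟩
      simp [hin, Box.inbox, enc, cliqueAt, plain]
    | succ i ih =>
      intro hi
      have h6 := hsix i (by omega) (ih (by omega))
      have h7 := reaches_chosen (hset i _ (by omega)) (by omega) (by omega) (hlt i)
        (hgood i (by omega)) h6
      exact reaches_extend (t := 8 * i + 7) (hset i _ (by omega)) (by omega) (hlt i)
        (greedySet_subset _ _ _) (disjoint_greedy hE.irrefl i) h7
  exact reaches_output (hset p _ (by omega)) (by omega) (by omega) (hlt p) (hgood p le_rfl)
    (hsix p le_rfl (hphase p le_rfl))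

end phases

/-! ### Graphs -/

section graphs

variable {n M cap q : ℕ} {R : Resources} {coin : ℕ × ℕ × ℕ → Bool} {G : SimpleGraph (Fin n)}
  {edges : Fin M → List (Fin n × Fin n)}

/-- Adjacency of natural numbers. -/
def natAdj (G : SimpleGraph (Fin n)) (x y : ℕ) : Prop :=
  ∃ u v : Fin n, (u : ℕ) = x ∧ (v : ℕ) = y ∧ G.Adj u v

theorem natAdj_iff (u v : Fin n) : natAdj G u v ↔ G.Adj u v := by
  constructor
  · rintro ⟨u', v', hu, hv, h⟩
    rwa [Fin.ext hu, Fin.ext hv] at h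
  · exact fun h => ⟨u, v, rfl, rfl, h⟩

/-- The edges of a machine. -/
def edgePairs (edges : Fin M → List (Fin n × Fin n)) (i : Fin M) : Multiset (ℕ × ℕ) :=
  (edgeInput edges i : Multiset (ℕ × ℕ))

theorem hit_ne_zero {x y : ℕ} {p : ℕ × ℕ} (h : hit x y p ≠ 0) :
    (p.1 = x ∧ p.2 = y) ∨ (p.1 = y ∧ p.2 = x) := by
  by_contra hne
  apply h
  unfold hit
  push Not at hne
  split_ifs <;> simp_all

theorem sum_hit_edges (edges : Fin M → List (Fin n × Fin n)) (x y : ℕ) :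
    ∑ i, ((edgePairs edges i).map (hit x y)).sum =
      (((List.finRange M).flatMap edges).map fun p => hit x y (p.1, p.2)).sum := by
  rw [Fin.sum_univ_def]
  induction List.finRange M with
  | nil => simp
  | cons i l ih =>
    rw [List.map_cons, List.sum_cons, ih, List.flatMap_cons, List.map_append, List.sum_append]
    congr 1
    simp [edgePairs, edgeInput, Function.comp_def]

theorem countP_eq_sum_map {α : Type*} (p : α → Bool) (l : List α) :
    l.countP p = (l.map fun x => if p x then 1 else 0).sum := by
  induction l with
  | nil => rfl
  | cons a l ih => rw [List.countP_cons, List.map_cons, List.sum_cons, ih, add_comm]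

theorem represents (h : IsEdgeDistribution G cap edges) :
    Represents n cap (natAdj G) (edgePairs edges) := by
  obtain ⟨h1, h2, h3⟩ := h
  refine ⟨?_, ?_, ?_, ?_, ?_, ?_⟩
  · rintro x y ⟨u, v, hu, hv, h⟩
    exact ⟨v, u, hv, hu, h.symm⟩
  · rintro x ⟨u, v, hu, hv, h⟩
    exact h.ne (Fin.ext (hu.trans hv.symm))
  · intro i p hp
    simp only [edgePairs, edgeInput, Multiset.mem_coe, List.mem_map] at hp
    obtain ⟨p, -, rfl⟩ := hp
    exact ⟨p.1.2, p.2.2⟩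
  · intro i
    simpa [edgePairs, edgeInput] using h1 i
  · rintro x y ⟨u, v, rfl, rfl, h⟩
    rw [sum_hit_edges]
    -- The edge occurs exactly once in the list without duplicates. Since `u ≠ v`, a stored pair
    -- cannot match in both orders, so `hit` is the indicator of this edge.
    have hc := List.count_eq_one_of_mem h2 ((h3 s(u, v)).2 h)
    rw [← hc, List.count_eq_countP, List.countP_map, countP_eq_sum_map]
    · congr 1
      refine List.map_congr_left fun p _ => ?_
      have hne : (u : ℕ) ≠ v := fun h' => h.ne (Fin.ext h')
      simp only [hit, Function.comp_apply, beq_iff_eq, Sym2.eq_iff, Fin.ext_iff]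
      split_ifs <;> simp_all
  · intro x y h
    rw [sum_hit_edges]
    rw [List.sum_eq_zero_iff]
    intro z hz
    obtain ⟨p, hp, rfl⟩ := List.mem_map.1 hz
    by_contra hne
    have hadj : G.Adj p.1 p.2 := (h3 s(p.1, p.2)).1 (List.mem_map_of_mem hp)
    rcases hit_ne_zero hne with ⟨rfl, rfl⟩ | ⟨rfl, rfl⟩
    · exact h ⟨_, _, rfl, rfl, hadj⟩
    · exact h ⟨_, _, rfl, rfl, hadj.symm⟩

/-- The deterministic part of the proof: randomness enters only through `hgood`, and `hq` says that
the last phase samples all active vertices. -/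
theorem findsMaximalClique {p : ℕ} (hp : Params n M cap q (8 * p + 7) R)
    (h : IsEdgeDistribution G cap edges) (hT : (Program.clique q (8 * p + 6)).time R.S ≤ R.T)
    (hgood : ∀ i ≤ p, Multiset.card (missing (natAdj G) (sampleAt (natAdj G) n q coin i)) ≤ cap)
    (hq : sampleExp q n p = 0) :
    FindsMaximalClique (.clique q (8 * p + 6)) R G edges (8 * p + 7) coin := by
  have hE := represents h
  obtain ⟨final, hrun, hfin⟩ := reaches_phase (input := edgeInput edges) hp hE hT hgood fun _ => rfl
  set C := cliqueAt (natAdj G) n q coin p with hC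
  set D := greedySet (natAdj G) (sampleAt (natAdj G) n q coin p) n with hD
  have hCD : cliqueAt (natAdj G) n q coin (p + 1) = C ∪ D := cliqueAt_succ _ _ _ _ _
  have hcard : C.card ≤ n ∧ D.card ≤ n :=
    ⟨card_le_of_lt fun c hc => cliqueAt_lt hc, card_le_of_lt fun c hc => lt_of_mem_greedySet hc⟩
  refine ⟨final, hrun, fun j => ?_, {v | (v : ℕ) ∈ C ∪ D}, ?_, ?_⟩
  · have h1 : (final j).length ≤ 2 * n := by
      rw [← Multiset.coe_card, hfin j]
      split_ifs
      · simp [plain]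
        omega
      · simp
    have := hp.n_le
    have := hp.cap_le
    omega
  · constructor
    · intro u hu v hv huv
      rw [← natAdj_iff]
      simp only [Set.mem_ofPred_eq] at hu hv
      rw [← hCD] at hu hv
      exact cliqueAt_adj hE.symm hu hv fun h' => huv (Fin.ext h')
    · intro Q hQ hle v hv
      simp only [Set.mem_ofPred_eq]
      rw [← hCD]
      refine cliqueAt_maximal hq v.2 fun c hc hvc => ?_
      have hcn := cliqueAt_lt hc
      have hcQ : (⟨c, hcn⟩ : Fin n) ∈ Q := hle (by
        simp only [Set.mem_ofPred_eq]
        rwa [← hCD])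
      exact (natAdj_iff v ⟨c, hcn⟩).2 (hQ hv hcQ fun h' => hvc (congrArg Fin.val h'))
  · have hmem : ∀ (j : Fin M) (p : ℕ × ℕ), p ∈ final j ↔
        (j : ℕ) = 0 ∧ (p ∈ plain C ∨ p ∈ plain D) := by
      intro j p
      rw [← Multiset.mem_coe, hfin j]
      split_ifs with hj <;> simp [hj]
    have hplain : ∀ (S : Finset ℕ) (p : ℕ × ℕ), p ∈ plain S ↔ p.1 ∈ S ∧ p.2 = 0 := by
      rintro S ⟨a, b⟩
      simp only [plain, Multiset.mem_map, Finset.mem_val, Prod.mk.injEq]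
      constructor
      · rintro ⟨c, hc, rfl, rfl⟩
        exact ⟨hc, rfl⟩
      · rintro ⟨ha, rfl⟩
        exact ⟨a, ha, rfl, rfl⟩
    ext k
    simp only [Set.mem_ofPred_eq, hmem, hplain, Set.mem_image]
    constructor
    · rintro ⟨j, p, ⟨-, hp⟩, rfl⟩
      have hk : p.1 ∈ C ∪ D := Finset.mem_union.2 (hp.imp And.left And.left)
      have hkn : p.1 < n := by
        rw [← hCD] at hk
        exact cliqueAt_lt hk
      exact ⟨⟨p.1, hkn⟩, hk, rfl⟩
    · rintro ⟨v, hv, rfl⟩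
      refine ⟨⟨0, hp.M_pos⟩, (v, 0), ⟨rfl, ?_⟩, rfl⟩
      exact (Finset.mem_union.1 hv).imp (fun h => ⟨h, rfl⟩) fun h => ⟨h, rfl⟩

end graphs

/-! ### Fair bits -/

section bits

open scoped ENNReal

instance : IsProbabilityMeasure fairCoins := by
  unfold fairCoins
  infer_instance

theorem uniformBool_map_not :
    ((PMF.uniformOfFintype Bool).toMeasure).map not = (PMF.uniformOfFintype Bool).toMeasure := by
  ext s hs
  rw [Measure.map_apply measurable_from_top hs, PMF.toMeasure_apply_fintype,
    PMF.toMeasure_apply_fintype]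
  simp only [Set.indicator, Set.mem_preimage, Fintype.sum_bool, PMF.uniformOfFintype_apply,
    Bool.not_true, Bool.not_false]
  exact add_comm _ _

/-- The bits with one of them inverted. -/
def invert (c : ℕ × ℕ × ℕ) (ω : ℕ × ℕ × ℕ → Bool) : ℕ × ℕ × ℕ → Bool :=
  Function.update ω c (!ω c)

theorem invert_invert (c : ℕ × ℕ × ℕ) (ω : ℕ × ℕ × ℕ → Bool) : invert c (invert c ω) = ω := by
  simp [invert]

theorem measurable_invert (c : ℕ × ℕ × ℕ) : Measurable (invert c) := by
  refine measurable_pi_iff.2 fun d => ?_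
  by_cases hd : d = c
  · subst hd
    have h : Measurable fun ω : ℕ × ℕ × ℕ → Bool => !ω d :=
      (measurable_of_finite not).comp (measurable_pi_apply d)
    simpa [invert] using h
  · simpa [invert, hd] using measurable_pi_apply d

/-- The map acts coordinatewise, and each factor of the product measure is invariant under negation
or the identity. This symmetry replaces explicit independence arguments. -/
theorem map_invert (c : ℕ × ℕ × ℕ) : fairCoins.map (invert c) = fairCoins := by
  have h : invert c = fun ω d => (if d = c then not else id) (ω d) := by
    funext ω d
    by_cases hd : d = c
    · subst hd
      simp [invert]
    · simp [invert, hd]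
  rw [h, fairCoins, Measure.infinitePi_map_pi _ fun d => measurable_from_top]
  congr 1
  funext d
  split_ifs
  · exact uniformBool_map_not
  · exact Measure.map_id

/-- Inverting a bit is a measurable equivalence, so `f` need not be measurable. -/
theorem lintegral_invert (c : ℕ × ℕ × ℕ) (f : (ℕ × ℕ × ℕ → Bool) → ℝ≥0∞) :
    ∫⁻ ω, f (invert c ω) ∂fairCoins = ∫⁻ ω, f ω ∂fairCoins := by
  let e : (ℕ × ℕ × ℕ → Bool) ≃ᵐ (ℕ × ℕ × ℕ → Bool) :=
    { toFun := invert c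
      invFun := invert c
      left_inv := invert_invert c
      right_inv := invert_invert c
      measurable_toFun := measurable_invert c
      measurable_invFun := measurable_invert c }
  conv_rhs => rw [← map_invert c]
  exact (lintegral_map_equiv f e).symm

/-- Averaging over one bit. -/
theorem lintegral_le_average (c : ℕ × ℕ × ℕ) (f : (ℕ × ℕ × ℕ → Bool) → ℝ≥0∞) :
    ∫⁻ ω, f ω ∂fairCoins ≤ ∫⁻ ω, (2⁻¹ * f (Function.update ω c true) +
      2⁻¹ * f (Function.update ω c false)) ∂fairCoins := by
  have h : ∀ ω, 2⁻¹ * f (Function.update ω c true) + 2⁻¹ * f (Function.update ω c false) =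
      2⁻¹ * (f ω + f (invert c ω)) := by
    intro ω
    rw [mul_add]
    cases hc : ω c
    · rw [add_comm, invert, hc, ← hc, Function.update_eq_self, hc]
      rfl
    · rw [invert, hc, ← hc, Function.update_eq_self, hc]
      rfl
  simp only [h]
  rw [lintegral_const_mul' _ _ (by simp)]
  calc ∫⁻ ω, f ω ∂fairCoins = 2⁻¹ * (∫⁻ ω, f ω ∂fairCoins + ∫⁻ ω, f (invert c ω) ∂fairCoins) := by
        rw [lintegral_invert, ← two_mul, ← mul_assoc, ENNReal.inv_mul_cancel (by simp) (by simp),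
          one_mul]
    _ ≤ _ := by
        gcongr
        -- The lower integral is superadditive for arbitrary functions; hence only an inequality,
        -- but no measurability assumption.
        exact le_lintegral_add _ _

theorem half_add_half (x : ℝ≥0∞) : 2⁻¹ * x + 2⁻¹ * x = x := by
  rw [← add_mul, ENNReal.inv_two_add_inv_two, one_mul]

open Classical in
/-- Averaging over the conjunction of `e` bits. -/
theorem lintegral_le_average_forall (e : ℕ) (c : ℕ → ℕ × ℕ × ℕ)
    (hc : ∀ j < e, ∀ k < e, c j = c k → j = k)
    (F : (ℕ × ℕ × ℕ → Bool) → Prop → ℝ≥0∞)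
    (hF : ∀ ω z b, ∀ j < e, F (Function.update ω (c j) b) z = F ω z) :
    ∫⁻ ω, F ω (∀ j < e, ω (c j) = true) ∂fairCoins ≤
      ∫⁻ ω, (2⁻¹ ^ e * F ω True + (1 - 2⁻¹ ^ e) * F ω False) ∂fairCoins := by
  induction e generalizing F with
  | zero => simp
  | succ e ih =>
    refine (lintegral_le_average (c e) _).trans ?_
    have h1 : ∀ ω, (2⁻¹ * F (Function.update ω (c e) true)
          (∀ j < e + 1, Function.update ω (c e) true (c j) = true) +
        2⁻¹ * F (Function.update ω (c e) false)
          (∀ j < e + 1, Function.update ω (c e) false (c j) = true)) =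
        2⁻¹ * F ω (∀ j < e, ω (c j) = true) + 2⁻¹ * F ω False := by
      intro ω
      rw [hF _ _ _ _ (lt_add_one e), hF _ _ _ _ (lt_add_one e)]
      congr 3
      · apply propext
        rw [Nat.forall_lt_succ_right]
        simp only [Function.update_self, and_true]
        refine forall₂_congr fun j hj => ?_
        rw [Function.update_of_ne]
        exact fun h => absurd (hc j (by omega) e (by omega) h) hj.ne
      · simp only [eq_iff_iff, iff_false]
        intro h
        simpa using h e (lt_add_one e)
    simp only [h1]
    -- After averaging over the last bit, the induction hypothesis is applied to the averaged
    -- functional: with probability one half the conjunction is already false.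
    refine (ih (fun j hj k hk => hc j (by omega) k (by omega))
      (fun ω z => 2⁻¹ * F ω z + 2⁻¹ * F ω False) fun ω z b j hj => ?_).trans ?_
    · simp only [hF _ _ _ _ (hj.trans (lt_add_one e))]
    · refine lintegral_mono fun ω => le_of_eq ?_
      have h2 : (1 : ℝ≥0∞) - 2⁻¹ ^ (e + 1) = 2⁻¹ ^ e * 2⁻¹ + (1 - 2⁻¹ ^ e) := by
        have h3 : (2⁻¹ : ℝ≥0∞) ^ e ≤ 1 := pow_le_one₀ zero_le (by simp)
        refine ENNReal.sub_eq_of_eq_add (by simp) ?_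
        rw [pow_succ, add_right_comm, ← mul_add, ENNReal.inv_two_add_inv_two, mul_one,
          add_tsub_cancel_of_le h3]
      rw [half_add_half, h2, mul_add, add_mul, pow_succ]
      ring

end bits

/-! ### The random process of one phase -/

section process

open scoped ENNReal

variable {adj : ℕ → ℕ → Prop} {n q : ℕ}

theorem sampleExp_le (q n i : ℕ) : sampleExp q n i ≤ Nat.log 2 n + 1 := Nat.sub_le _ _

theorem mul_add_lt_mul {v u e k : ℕ} (h : v < u) (hk : k < e) : v * e + k < u * e := by
  have := Nat.mul_le_mul_right e (Nat.succ_le_of_lt h)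
  rw [Nat.succ_mul] at this
  omega

theorem sampleSet_congr {coin coin' : ℕ → Bool} {e : ℕ} {A : Finset ℕ}
    (h : ∀ v ∈ A, ∀ j < e, coin (v * e + j) = coin' (v * e + j)) :
    sampleSet coin e A = sampleSet coin' e A := by
  classical
  exact Finset.filter_congr fun v hv => forall₂_congr fun j hj => by rw [h v hv j hj]

/-- Only finitely many bits, all from rounds before phase `i`, matter. This gives measurability, and
it lets the bits of phase `i` be averaged with the clique held fixed. -/
theorem cliqueAt_congr {coin coin' : ℕ × ℕ × ℕ → Bool} {i : ℕ}
    (h : ∀ t < 8 * i, ∀ k < n * (Nat.log 2 n + 1), coin (t, 0, k) = coin' (t, 0, k)) :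
    cliqueAt adj n q coin i = cliqueAt adj n q coin' i := by
  classical
  induction i with
  | zero => rfl
  | succ i ih =>
    rw [cliqueAt, cliqueAt, ih fun t ht => h t (by omega)]
    congr 2
    exact sampleSet_congr fun v hv j hj => h _ (by omega) _
      ((mul_add_lt_mul (active_lt hv) hj).trans_le (Nat.mul_le_mul_left _ (sampleExp_le q n i)))

theorem sampleAt_congr {coin coin' : ℕ × ℕ × ℕ → Bool} {i : ℕ}
    (h : ∀ t < 8 * (i + 1), ∀ k < n * (Nat.log 2 n + 1), coin (t, 0, k) = coin' (t, 0, k)) :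
    sampleAt adj n q coin i = sampleAt adj n q coin' i := by
  classical
  rw [sampleAt, sampleAt, cliqueAt_congr fun t ht => h t (by omega)]
  exact sampleSet_congr fun v hv j hj => h _ (by omega) _
    ((mul_add_lt_mul (active_lt hv) hj).trans_le (Nat.mul_le_mul_left _ (sampleExp_le q n i)))

/-- An event that depends on finitely many bits is measurable. -/
theorem measurableSet_of_congr (s : Finset (ℕ × ℕ × ℕ)) {B : Set (ℕ × ℕ × ℕ → Bool)}
    (h : ∀ ω ω', (∀ c ∈ s, ω c = ω' c) → ω ∈ B → ω' ∈ B) : MeasurableSet B := by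
  have hB : B = s.restrict ⁻¹' (s.restrict (π := fun _ => Bool) '' B) := by
    ext ω
    constructor
    · exact fun hω => ⟨ω, hω, rfl⟩
    · rintro ⟨ω', hω', he⟩
      exact h ω' ω (fun c hc => congrFun he ⟨c, hc⟩) hω'
  rw [hB]
  exact (Finset.measurable_restrict s) (Set.toFinite _).measurableSet

theorem measurableSet_phase (i : ℕ) (P : Finset ℕ → Finset ℕ → Prop) :
    MeasurableSet {ω | P (cliqueAt adj n q ω i) (sampleAt adj n q ω i)} := by
  refine measurableSet_of_congr (Finset.range (8 * (i + 1)) ×ˢ ({0} : Finset ℕ) ×ˢ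
    Finset.range (n * (Nat.log 2 n + 1))) fun ω ω' h hω => ?_
  have h' : ∀ t < 8 * (i + 1), ∀ k < n * (Nat.log 2 n + 1), ω (t, 0, k) = ω' (t, 0, k) :=
    fun t ht k hk => h _ (by simp [ht, hk])
  have h1 := cliqueAt_congr (adj := adj) (q := q) (i := i) fun t ht => h' t (by omega)
  have h2 := sampleAt_congr (adj := adj) (q := q) (i := i) h'
  simpa only [Set.mem_ofPred_eq, h1, h2] using hω

open Classical in
/-- If the expectation of a potential does not increase when the next vertex is sampled, then its
expectation after a phase is at most that before the phase. -/
theorem lintegral_potential_le (i : ℕ) (ψ : ℕ → Finset ℕ → Finset ℕ → ℝ≥0∞)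
    (hψ : ∀ u < n, ∀ A T : Finset ℕ, T ⊆ A → (∀ v ∈ T, v < u) →
      2⁻¹ ^ sampleExp q n i * ψ (u + 1) A (if u ∈ A then insert u T else T) +
        (1 - 2⁻¹ ^ sampleExp q n i) * ψ (u + 1) A T ≤ ψ u A T) :
    ∫⁻ ω, ψ n (active adj n (cliqueAt adj n q ω i)) (sampleAt adj n q ω i) ∂fairCoins ≤
      ∫⁻ ω, ψ 0 (active adj n (cliqueAt adj n q ω i)) ∅ ∂fairCoins := by
  set e := sampleExp q n i
  have hstep : ∀ u ≤ n, ∫⁻ ω, ψ u (active adj n (cliqueAt adj n q ω i))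
      ((sampleAt adj n q ω i).filter (· < u)) ∂fairCoins ≤
      ∫⁻ ω, ψ 0 (active adj n (cliqueAt adj n q ω i)) ∅ ∂fairCoins := by
    intro u
    induction u with
    | zero => simp
    | succ u ih =>
      intro hu
      refine le_trans ?_ (ih (by omega))
      have hsplit : ∀ ω, (sampleAt adj n q ω i).filter (· < u + 1) =
          if u ∈ active adj n (cliqueAt adj n q ω i) ∧ ∀ j < e, ω (8 * i + 2, 0, u * e + j) = true
          then insert u ((sampleAt adj n q ω i).filter (· < u))
          else (sampleAt adj n q ω i).filter (· < u) := by
        intro ω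
        have hmem : (u ∈ active adj n (cliqueAt adj n q ω i) ∧
            ∀ j < e, ω (8 * i + 2, 0, u * e + j) = true) ↔ u ∈ sampleAt adj n q ω i := by
          simp [sampleAt, sampleSet, sampled, e]
        simp only [hmem]
        ext v
        split_ifs with h
        · simp only [Finset.mem_filter, Finset.mem_insert, Nat.lt_succ_iff_lt_or_eq]
          constructor
          · rintro ⟨h1, h2 | rfl⟩
            · exact Or.inr ⟨h1, h2⟩
            · exact Or.inl rfl
          · rintro (rfl | ⟨h1, h2⟩)
            · exact ⟨h, Or.inr rfl⟩
            · exact ⟨h1, Or.inl h2⟩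
        · simp only [Finset.mem_filter, Nat.lt_succ_iff_lt_or_eq]
          constructor
          · rintro ⟨h1, h2 | rfl⟩
            · exact ⟨h1, h2⟩
            · exact absurd h1 h
          · rintro ⟨h1, h2⟩
            exact ⟨h1, Or.inl h2⟩
      -- The bits of vertex `u` in this phase influence neither the earlier clique nor the sampled
      -- vertices below `u`.
      have hup : ∀ (ω : ℕ × ℕ × ℕ → Bool) (b : Bool), ∀ j < e,
          cliqueAt adj n q (Function.update ω (8 * i + 2, 0, u * e + j) b) i =
            cliqueAt adj n q ω i ∧
          (sampleAt adj n q (Function.update ω (8 * i + 2, 0, u * e + j) b) i).filter (· < u) =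
            (sampleAt adj n q ω i).filter (· < u) := by
        intro ω b j hj
        have h1 : cliqueAt adj n q (Function.update ω (8 * i + 2, 0, u * e + j) b) i =
            cliqueAt adj n q ω i := by
          refine cliqueAt_congr fun t ht k _ => Function.update_of_ne ?_ _ _
          simp only [ne_eq, Prod.mk.injEq, not_and]
          omega
        refine ⟨h1, ?_⟩
        rw [sampleAt, sampleAt, h1, sampleSet, sampleSet, Finset.filter_filter,
          Finset.filter_filter]
        refine Finset.filter_congr fun v _ => ?_
        refine and_congr_left fun hv => forall₂_congr fun k hk => ?_
        have := mul_add_lt_mul (e := e) hv hk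
        beta_reduce
        rw [Function.update_of_ne]
        simp only [ne_eq, Prod.mk.injEq, true_and]
        change k < e at hk
        change ¬ v * e + k = u * e + j
        omega
      -- The outcome of the bits of `u` becomes a separate argument `z`, so that only `z` depends on
      -- them.
      let F : (ℕ × ℕ × ℕ → Bool) → Prop → ℝ≥0∞ := fun ω z =>
        ψ (u + 1) (active adj n (cliqueAt adj n q ω i))
          (if u ∈ active adj n (cliqueAt adj n q ω i) ∧ z
          then insert u ((sampleAt adj n q ω i).filter (· < u))
          else (sampleAt adj n q ω i).filter (· < u))
      have := lintegral_le_average_forall e (fun j => (8 * i + 2, 0, u * e + j))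
        (fun j _ k _ h => by simpa using h) F fun ω z b j hj => by
          simp only [F, (hup ω b j hj).1, (hup ω b j hj).2]
      refine (lintegral_mono fun ω => ?_).trans (this.trans (lintegral_mono fun ω => ?_))
      · rw [hsplit]
        refine le_of_eq ?_
        simp only [F]
        congr
      · have h := hψ u (by omega) (active adj n (cliqueAt adj n q ω i))
          ((sampleAt adj n q ω i).filter (· < u))
          ((Finset.filter_subset _ _).trans (sampleAt_subset _ _ _ _ _))
          fun v hv => (Finset.mem_filter.1 hv).2
        simpa only [F, and_true, and_false, if_false] using h
  refine le_trans (lintegral_mono fun ω => le_of_eq ?_) (hstep n le_rfl)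
  congr 1
  refine (Finset.filter_true_of_mem fun v hv => ?_).symm
  exact active_lt (sampleAt_subset _ _ _ _ _ hv)

end process

/-! ### Bounds for one phase -/

section bounds

open scoped ENNReal

variable {adj : ℕ → ℕ → Prop} {n q : ℕ}

theorem inv_two_pow_eq_ofReal (e : ℕ) : (2⁻¹ : ℝ≥0∞) ^ e = ENNReal.ofReal ((2 ^ e)⁻¹) := by
  rw [← inv_pow, ENNReal.ofReal_pow (by norm_num), ENNReal.ofReal_inv_of_pos (by norm_num)]
  norm_num

theorem one_add_inv_pow_le (e : ℕ) : (1 + (2⁻¹ : ℝ≥0∞) ^ e) ^ 2 ^ e ≤ 4 := by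
  rw [inv_two_pow_eq_ofReal, ← ENNReal.ofReal_one, ← ENNReal.ofReal_add (by simp) (by positivity),
    ← ENNReal.ofReal_pow (by positivity), show (4 : ℝ≥0∞) = ENNReal.ofReal 4 by norm_num]
  refine ENNReal.ofReal_le_ofReal ?_
  calc (1 + ((2 : ℝ) ^ e)⁻¹) ^ 2 ^ e ≤ Real.exp ((2 ^ e)⁻¹) ^ 2 ^ e := by
        gcongr
        rw [add_comm]
        exact Real.add_one_le_exp _
    _ = Real.exp 1 := by
        rw [← Real.exp_nat_mul]
        congr 1
        push_cast
        exact mul_inv_cancel₀ (by positivity)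
    _ ≤ 4 := by linarith [Real.exp_one_lt_d9]

theorem one_sub_inv_pow_le (e : ℕ) : (1 - (2⁻¹ : ℝ≥0∞) ^ e) ^ 2 ^ e ≤ 2⁻¹ := by
  have hle : ((2 : ℝ) ^ e)⁻¹ ≤ 1 := inv_le_one_of_one_le₀ (one_le_pow₀ (by norm_num))
  rw [inv_two_pow_eq_ofReal, ← ENNReal.ofReal_one, ← ENNReal.ofReal_sub _ (by positivity),
    ← ENNReal.ofReal_pow (by linarith), show (2⁻¹ : ℝ≥0∞) = ENNReal.ofReal 2⁻¹ by
      rw [ENNReal.ofReal_inv_of_pos (by norm_num)]; norm_num]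
  refine ENNReal.ofReal_le_ofReal ?_
  calc (1 - ((2 : ℝ) ^ e)⁻¹) ^ 2 ^ e ≤ Real.exp (-(2 ^ e)⁻¹) ^ 2 ^ e := by
        exact pow_le_pow_left₀ (by linarith) (Real.one_sub_le_exp_neg _) _
    _ = Real.exp (-1) := by
        rw [← Real.exp_nat_mul]
        congr 1
        push_cast
        rw [mul_neg, mul_inv_cancel₀ (by positivity)]
    _ ≤ 2⁻¹ := by
        rw [Real.exp_neg]
        gcongr
        linarith [Real.exp_one_gt_d9]

/-- Markov's inequality: the final potential dominates the indicator of the event, and its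
expectation is at most the initial value. -/
theorem measure_le_of_potential (i : ℕ) {P : Finset ℕ → Finset ℕ → Prop}
    {ψ : ℕ → Finset ℕ → Finset ℕ → ℝ≥0∞} {b : ℝ≥0∞}
    (hψ : ∀ u < n, ∀ A T : Finset ℕ, T ⊆ A → (∀ v ∈ T, v < u) →
      2⁻¹ ^ sampleExp q n i * ψ (u + 1) A (if u ∈ A then insert u T else T) +
        (1 - 2⁻¹ ^ sampleExp q n i) * ψ (u + 1) A T ≤ ψ u A T)
    (hP : ∀ C T, P C T → 1 ≤ ψ n (active adj n C) T) (hb : ∀ A, ψ 0 A ∅ ≤ b) :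
    fairCoins {ω | P (cliqueAt adj n q ω i) (sampleAt adj n q ω i)} ≤ b := by
  classical
  rw [← lintegral_indicator_one (measurableSet_phase i P)]
  refine le_trans (lintegral_mono fun ω => ?_) ((lintegral_potential_le (adj := adj) (n := n) (q := q) i ψ
    fun u hu A T hTA hT => ?_).trans ((lintegral_mono fun ω => hb _).trans (by simp)))
  · rw [Set.indicator_apply]
    split_ifs with h
    · exact hP _ _ h
    · exact zero_le
  · convert hψ u hu A T hTA hT

theorem inv_two_pow_add (e : ℕ) : (2⁻¹ : ℝ≥0∞) ^ e + (1 - 2⁻¹ ^ e) = 1 :=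
  add_tsub_cancel_of_le (pow_le_one₀ zero_le (by simp))

theorem lt_two_pow_log (n : ℕ) : n < 2 ^ (Nat.log 2 n + 1) := Nat.lt_pow_succ_log_self (by simp) n

/-- The sample of a phase is not much larger than expected. -/
theorem measure_card_sampleAt_ge (i : ℕ) :
    fairCoins {ω | 4 * 2 ^ (Nat.log 2 n + 1 - sampleExp q n i) ≤ (sampleAt adj n q ω i).card} ≤
      2⁻¹ ^ 2 ^ (Nat.log 2 n + 1 - sampleExp q n i) := by
  classical
  set e := sampleExp q n i with he
  set s := 2 ^ (Nat.log 2 n + 1 - e) with hs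
  have hn : n ≤ 2 ^ e * s := by
    rw [hs, ← pow_add, Nat.add_sub_cancel' (sampleExp_le q n i)]
    exact (lt_two_pow_log n).le
  -- Exponential moment: an undecided vertex multiplies the expectation of `2 ^ T.card` by at most
  -- `1 + 2⁻¹ ^ e`. The scaling by `2⁻¹ ^ (4 * s)` makes the final potential at least `1` on the
  -- event.
  refine measure_le_of_potential (P := fun _ T => 4 * s ≤ T.card) (ψ := fun u _ T =>
    (2⁻¹ ^ (4 * s) * (1 + 2⁻¹ ^ e) ^ (n - u)) * 2 ^ T.card) i ?_ ?_ ?_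
  · intro u hu A T hTA hT
    obtain ⟨m, hm⟩ : ∃ m, n - u = m + 1 := ⟨n - u - 1, by omega⟩
    have hm' : n - (u + 1) = m := by omega
    simp only [hm, hm', ← he]
    have hcard : (if u ∈ A then insert u T else T).card ≤ T.card + 1 := by
      split_ifs
      · exact Finset.card_insert_le _ _
      · omega
    set x : ℝ≥0∞ := 2⁻¹ ^ (4 * s) * (1 + 2⁻¹ ^ e) ^ m
    calc _ ≤ 2⁻¹ ^ e * (x * 2 ^ (T.card + 1)) + (1 - 2⁻¹ ^ e) * (x * 2 ^ T.card) := by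
          gcongr
          simp
      _ = x * 2 ^ T.card * (2⁻¹ ^ e + (2⁻¹ ^ e + (1 - 2⁻¹ ^ e))) := by ring
      _ = x * 2 ^ T.card * (1 + 2⁻¹ ^ e) := by rw [inv_two_pow_add, add_comm]
      _ = _ := by
          simp only [x]
          ring
      _ ≤ _ := le_rfl
  · intro C T h
    rw [Nat.sub_self, pow_zero, mul_one]
    calc (1 : ℝ≥0∞) = (2⁻¹ * 2) ^ (4 * s) := by
          rw [ENNReal.inv_mul_cancel (by simp) (by simp), one_pow]
      _ ≤ _ := by
          rw [mul_pow]
          gcongr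
          simp
  · intro A
    rw [Finset.card_empty, pow_zero, mul_one, Nat.sub_zero]
    -- Since `n ≤ 2 ^ e * s`, the second factor is at most `4 ^ s`, leaving `2⁻¹ ^ (2 * s)`.
    calc (2⁻¹ : ℝ≥0∞) ^ (4 * s) * (1 + 2⁻¹ ^ e) ^ n
        ≤ 2⁻¹ ^ (4 * s) * (1 + 2⁻¹ ^ e) ^ (2 ^ e * s) := by
          gcongr
          exact le_self_add
      _ ≤ 2⁻¹ ^ (4 * s) * 4 ^ s := by
          rw [pow_mul (1 + _)]
          gcongr
          exact one_add_inv_pow_le e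
      _ = 2⁻¹ ^ s * ((2⁻¹ * 2⁻¹ * 4) ^ s * 2⁻¹ ^ s) := by
          rw [mul_pow, mul_pow, show 4 * s = s + s + s + s by ring, pow_add, pow_add, pow_add]
          ring
      _ ≤ 2⁻¹ ^ s := by
          have h4 : (2⁻¹ : ℝ≥0∞) * 2⁻¹ * 4 = 1 := by
            rw [← ENNReal.mul_inv (by simp) (by simp), show (2 : ℝ≥0∞) * 2 = 4 by norm_num]
            exact ENNReal.inv_mul_cancel (by simp) (by simp)
          rw [h4, one_pow, one_mul]
          exact mul_le_of_le_one_right zero_le (pow_le_one₀ zero_le (by simp))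

open Classical in
/-- The number of other vertices of `A` that are not adjacent to `v`. -/
noncomputable def codegree (adj : ℕ → ℕ → Prop) (A : Finset ℕ) (v : ℕ) : ℕ :=
  (A.filter fun w => w ≠ v ∧ ¬ adj w v).card

/-- The choices below `v ≤ u` never inspect `u`. -/
theorem greedySet_insert {T : Finset ℕ} {u v : ℕ} (h : v ≤ u) :
    greedySet adj (insert u T) v = greedySet adj T v := by
  classical
  induction v with
  | zero => rfl
  | succ v ih =>
    rw [greedySet, greedySet, ih (by omega)]
    congr 1
    simp only [Finset.mem_insert, eq_iff_iff]
    refine and_congr_left fun _ => ?_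
    constructor
    · rintro (rfl | h')
      · omega
      · exact h'
    · exact Or.inr

theorem mem_active_union {C D : Finset ℕ} {v : ℕ} :
    v ∈ active adj n (C ∪ D) ↔ v ∈ active adj n C ∧ ∀ c ∈ D, adj v c := by
  simp only [mem_active, Finset.mem_union]
  constructor
  · exact fun h => ⟨⟨h.1, fun c hc => h.2 c (Or.inl hc)⟩, fun c hc => h.2 c (Or.inr hc)⟩
  · exact fun h => ⟨h.1.1, fun c hc => hc.elim (h.1.2 c) (h.2 c)⟩

open Classical in
/-- The vertices below `u`, other than `v` and not adjacent to it, that are adjacent to all vertices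
chosen before them. -/
noncomputable def survivors (adj : ℕ → ℕ → Prop) (v u : ℕ) (A T : Finset ℕ) : Finset ℕ :=
  A.filter fun w => w < u ∧ (w ≠ v ∧ ¬ adj w v) ∧ ∀ c ∈ greedySet adj T w, adj w c

theorem survivors_insert {A T : Finset ℕ} {u v u' : ℕ} (h : u ≤ u' + 1) :
    survivors adj v u A (insert u' T) = survivors adj v u A T := by
  classical
  refine Finset.filter_congr fun w _ => and_congr_right fun hw => ?_
  rw [greedySet_insert (by omega)]

theorem card_survivors_succ_le {A T : Finset ℕ} {u v : ℕ} :
    (survivors adj v (u + 1) A T).card ≤ (survivors adj v u A T).card + 1 := by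
  classical
  refine le_trans (Finset.card_le_card fun w hw => ?_) (Finset.card_insert_le u _)
  simp only [survivors, Finset.mem_filter, Finset.mem_insert, Nat.lt_succ_iff_lt_or_eq] at hw ⊢
  obtain ⟨h1, h2 | h2, h3⟩ := hw
  · exact Or.inr ⟨h1, h2, h3⟩
  · exact Or.inl h2

theorem survivors_mono {A T : Finset ℕ} {u v : ℕ} :
    survivors adj v u A T ⊆ survivors adj v (u + 1) A T := by
  classical
  intro w hw
  simp only [survivors, Finset.mem_filter] at hw ⊢
  exact ⟨hw.1, by omega, hw.2.2⟩

/-- After a phase every active vertex is nonadjacent to few active vertices. -/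
theorem measure_codegree_ge (hsymm : ∀ x y, adj x y → adj y x) (i v L : ℕ) :
    fairCoins {ω | v ∈ active adj n (cliqueAt adj n q ω (i + 1)) ∧
      L * 2 ^ sampleExp q n i ≤ codegree adj (active adj n (cliqueAt adj n q ω (i + 1))) v} ≤
      2⁻¹ ^ L := by
  classical
  set e := sampleExp q n i with he
  set Δ := L * 2 ^ e with hΔ
  set x : ℝ≥0∞ := 1 - 2⁻¹ ^ e with hx
  have hx1 : x ≤ 1 := tsub_le_self
  have hpx : (2⁻¹ : ℝ≥0∞) ^ e + x = 1 := inv_two_pow_add e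
  -- The potential is zero once `v` has lost its active status. Before that it bounds the
  -- probability that enough further survivors escape sampling to bring their number up to `Δ`.
  refine measure_le_of_potential (P := fun C T => v ∈ active adj n (C ∪ greedySet adj T n) ∧
    Δ ≤ codegree adj (active adj n (C ∪ greedySet adj T n)) v) (ψ := fun u A T =>
    if ∀ c ∈ greedySet adj T u, adj v c then x ^ (Δ - (survivors adj v u A T).card) else 0) i ?_ ?_ ?_
  · intro u hu A T hTA hT
    have huT : u ∉ T := fun h => (hT u h).ne rfl
    have hg : greedySet adj T (u + 1) = greedySet adj T u := by
      rw [greedySet, if_neg fun h => huT h.1]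
    have hins : survivors adj v (u + 1) A (if u ∈ A then insert u T else T) =
        survivors adj v (u + 1) A T := by
      split_ifs
      · exact survivors_insert le_rfl
      · rfl
    have hsub : greedySet adj T u ⊆
        greedySet adj (if u ∈ A then insert u T else T) (u + 1) := by
      split_ifs
      · rw [← greedySet_insert (le_refl u)]
        exact greedySet_mono (by omega)
      · exact greedySet_mono (by omega)
    simp only [hins, hg, ← he, ← hx]
    by_cases hv : ∀ c ∈ greedySet adj T u, adj v c
    swap
    · rw [if_neg hv, if_neg fun h => hv fun c hc => h c (hsub hc)]
      simp
    rw [if_pos hv, if_pos hv]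
    by_cases hs : (survivors adj v (u + 1) A T) = survivors adj v u A T
    · rw [hs]
      calc _ ≤ 2⁻¹ ^ e * x ^ (Δ - (survivors adj v u A T).card) +
            x * x ^ (Δ - (survivors adj v u A T).card) := by
            gcongr
            exact (ite_le_sup _ _ _).trans (by simp)
        _ = _ := by rw [← add_mul, hpx, one_mul]
    -- The remaining case: `u` is a new survivor. If it is sampled, the greedy scan takes it and `v`
    -- drops out; otherwise the factor `x` pays for the exponent decreasing by at most one.
    · have hu' : u ∈ A ∧ (u ≠ v ∧ ¬ adj u v) ∧ ∀ c ∈ greedySet adj T u, adj u c := by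
        by_contra hne
        apply hs
        refine Finset.Subset.antisymm (fun w hw => ?_) survivors_mono
        simp only [survivors, Finset.mem_filter, Nat.lt_succ_iff_lt_or_eq] at hw ⊢
        obtain ⟨h1, h2 | rfl, h3⟩ := hw
        · exact ⟨h1, h2, h3⟩
        · exact absurd ⟨h1, h3⟩ hne
      have hchosen : u ∈ greedySet adj (if u ∈ A then insert u T else T) (u + 1) := by
        rw [if_pos hu'.1, greedySet, greedySet_insert le_rfl,
          if_pos ⟨Finset.mem_insert_self _ _, hu'.2.2⟩]
        exact Finset.mem_insert_self _ _
      rw [if_neg fun h => hu'.2.1.2 (hsymm _ _ (h u hchosen)), mul_zero, zero_add, ← pow_succ']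
      refine pow_le_pow_of_le_one zero_le hx1 ?_
      have := card_survivors_succ_le (adj := adj) (v := v) (u := u) (A := A) (T := T)
      omega
  · rintro C T ⟨hv, hd⟩
    -- A vertex that is active after the phase is adjacent to everything chosen, so the active
    -- non-neighbours of `v` are all survivors.
    have hle : Δ ≤ (survivors adj v n (active adj n C) T).card := by
      refine hd.trans (Finset.card_le_card fun w hw => ?_)
      simp only [survivors, Finset.mem_filter, mem_active_union] at hw ⊢
      exact ⟨hw.1.1, active_lt hw.1.1, hw.2,
        fun c hc => hw.1.2 c (greedySet_mono (active_lt hw.1.1).le hc)⟩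
    rw [if_pos (mem_active_union.1 hv).2, Nat.sub_eq_zero_of_le hle, pow_zero]
  · intro A
    have h0 : survivors adj v 0 A ∅ = ∅ := by simp [survivors]
    -- The initial potential is `x ^ (L * 2 ^ e)`, and `x ^ 2 ^ e ≤ 1 / 2`.
    rw [if_pos (by simp [greedySet]), h0, Finset.card_empty, Nat.sub_zero, hΔ, mul_comm, pow_mul]
    gcongr
    exact one_sub_inv_pow_le e

end bounds

/-! ### All phases -/

section all

open scoped ENNReal

variable {adj : ℕ → ℕ → Prop} {n q : ℕ}

/-- Each non-edge is charged to its larger end point. -/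
theorem card_missing_le (hsymm : ∀ x y, adj x y → adj y x) {A T : Finset ℕ} {a d : ℕ} (hTA : T ⊆ A)
    (hT : T.card ≤ a) (hd : ∀ v ∈ A, codegree adj A v ≤ d) :
    Multiset.card (missing adj T) ≤ a * d := by
  classical
  rw [missing, Multiset.card_sum]
  refine (Finset.sum_le_card_nsmul _ _ d fun x hx => ?_).trans ?_
  · rw [Multiset.card_map]
    refine le_trans (Finset.card_le_card fun y hy => ?_) (hd x (hTA hx))
    simp only [Finset.mem_filter] at hy ⊢
    exact ⟨hTA hy.1, hy.2.1.ne, fun h => hy.2.2 (hsymm _ _ h)⟩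
  · rw [smul_eq_mul]
    exact Nat.mul_le_mul_right _ hT

theorem two_pow_sub_mul_le {a b c h : ℕ} (hb : b ≤ a) (hc : c ≤ b + h) :
    2 ^ (a - b) * 2 ^ c ≤ 2 ^ (a + h) := by
  rw [← pow_add]
  exact Nat.pow_le_pow_right (by omega) (by omega)

/-- Sample size times the codegree left by the preceding phase. Consecutive exponents differ by at
most `(Nat.log 2 n + 1) / q`, so the powers of two nearly cancel. In phase `0` the trivial codegree
bound `n` takes the place of the preceding phase. -/
theorem card_missing_sampleAt_le (hsymm : ∀ x y, adj x y → adj y x) {coin : ℕ × ℕ × ℕ → Bool}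
    {L p : ℕ} (hL : 0 < L)
    (hcard : ∀ i ≤ p, (sampleAt adj n q coin i).card <
      4 * 2 ^ (Nat.log 2 n + 1 - sampleExp q n i))
    (hdeg : ∀ i < p, ∀ v ∈ active adj n (cliqueAt adj n q coin (i + 1)),
      codegree adj (active adj n (cliqueAt adj n q coin (i + 1))) v < L * 2 ^ sampleExp q n i)
    {i : ℕ} (hi : i ≤ p) :
    Multiset.card (missing adj (sampleAt adj n q coin i)) ≤
      4 * L * 2 ^ (Nat.log 2 n + 1 + (Nat.log 2 n + 1) / q) := by
  classical
  cases i with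
  | zero =>
    refine (card_missing_le hsymm (sampleAt_subset _ _ _ _ _) (hcard 0 hi).le
      (d := 2 ^ (Nat.log 2 n + 1)) fun v _ => ?_).trans ?_
    · refine (Finset.card_filter_le _ _).trans ?_
      exact (card_le_of_lt fun c hc => active_lt hc).trans (lt_two_pow_log n).le
    · have h := two_pow_sub_mul_le (a := Nat.log 2 n + 1) (b := sampleExp q n 0)
        (c := Nat.log 2 n + 1) (h := (Nat.log 2 n + 1) / q) (sampleExp_le q n 0)
        (by rw [sampleExp]; omega)
      rw [mul_assoc, mul_assoc]
      exact Nat.mul_le_mul_left _ (h.trans (Nat.le_mul_of_pos_left _ hL))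
  | succ i =>
    refine (card_missing_le hsymm (sampleAt_subset _ _ _ _ _) (hcard _ hi).le
      fun v hv => (hdeg i (by omega) v hv).le).trans ?_
    have h := two_pow_sub_mul_le (a := Nat.log 2 n + 1) (b := sampleExp q n (i + 1))
      (c := sampleExp q n i) (h := (Nat.log 2 n + 1) / q) (sampleExp_le q n _)
      (by
        rw [sampleExp, sampleExp, Nat.succ_mul (i + 1)]
        generalize (Nat.log 2 n + 1) / q = h
        omega)
    calc _ = 4 * L * (2 ^ (Nat.log 2 n + 1 - sampleExp q n (i + 1)) * 2 ^ sampleExp q n i) := by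
          ring
      _ ≤ _ := Nat.mul_le_mul_left _ h

/-- Union bound over `p + 1` phases, each with one event for the sample size and `n` events for the
codegrees. -/
theorem measure_missing_gt (hsymm : ∀ x y, adj x y → adj y x) {L p : ℕ} (hL : 0 < L)
    (hLq : L ≤ 2 ^ ((Nat.log 2 n + 1) / q)) :
    fairCoins {ω | ¬ ∀ i ≤ p, Multiset.card (missing adj (sampleAt adj n q ω i)) ≤
      4 * L * 2 ^ (Nat.log 2 n + 1 + (Nat.log 2 n + 1) / q)} ≤
      ((p + 1) * (n + 1) : ℕ) * 2⁻¹ ^ L := by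
  set X : ℕ → Set (ℕ × ℕ × ℕ → Bool) := fun i =>
    {ω | 4 * 2 ^ (Nat.log 2 n + 1 - sampleExp q n i) ≤ (sampleAt adj n q ω i).card} with hX
  set Y : ℕ → ℕ → Set (ℕ × ℕ × ℕ → Bool) := fun i v =>
    {ω | v ∈ active adj n (cliqueAt adj n q ω (i + 1)) ∧
      L * 2 ^ sampleExp q n i ≤ codegree adj (active adj n (cliqueAt adj n q ω (i + 1))) v} with hY
  have hsub : {ω | ¬ ∀ i ≤ p, Multiset.card (missing adj (sampleAt adj n q ω i)) ≤
      4 * L * 2 ^ (Nat.log 2 n + 1 + (Nat.log 2 n + 1) / q)} ⊆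
      ⋃ i ∈ Finset.range (p + 1), (X i ∪ ⋃ v ∈ Finset.range n, Y i v) := by
    intro ω hω
    by_contra hne
    simp only [Set.mem_iUnion, Finset.mem_range, Set.mem_union, not_exists, not_or] at hne
    refine hω fun i hi => card_missing_sampleAt_le hsymm hL (fun i hi => ?_) (fun i hi v hv => ?_) hi
    · exact not_le.1 (hne i (by omega)).1
    · exact not_le.1 fun h => (hne i (by omega)).2 v (active_lt hv) ⟨hv, h⟩
  have hXi : ∀ i, fairCoins (X i) ≤ 2⁻¹ ^ L := by
    intro i
    refine (measure_card_sampleAt_ge i).trans ?_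
    -- The size bound fails with probability at most `2⁻¹ ^ 2 ^ (l - e)`, and `l - e ≥ l / q` in
    -- every phase; hence the hypothesis on `L`.
    refine pow_le_pow_of_le_one zero_le (by simp) (hLq.trans ?_)
    refine Nat.pow_le_pow_right (by omega) ?_
    have := Nat.div_le_self (Nat.log 2 n + 1) q
    rw [sampleExp, Nat.succ_mul]
    omega
  have hYi : ∀ i v, fairCoins (Y i v) ≤ 2⁻¹ ^ L := fun i v => measure_codegree_ge hsymm i v L
  refine (measure_mono hsub).trans ((measure_biUnion_finset_le _ _).trans ?_)
  calc ∑ i ∈ Finset.range (p + 1), fairCoins (X i ∪ ⋃ v ∈ Finset.range n, Y i v)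
      ≤ ∑ i ∈ Finset.range (p + 1), ((n + 1 : ℕ) * 2⁻¹ ^ L : ℝ≥0∞) := by
        refine Finset.sum_le_sum fun i _ => (measure_union_le _ _).trans ?_
        rw [Nat.cast_add, add_mul, add_comm]
        refine add_le_add ?_ (by simpa using hXi i)
        refine (measure_biUnion_finset_le _ _).trans ((Finset.sum_le_sum fun v _ => hYi i v).trans ?_)
        simp
    _ = _ := by
        rw [Finset.sum_const, Finset.card_range, nsmul_eq_mul, ← mul_assoc, Nat.cast_mul]

/-- With `p + 1` phases all samples miss few pairs with high probability. -/
theorem measure_missing_gt_le_inv_pow (hsymm : ∀ x y, adj x y → adj y x) {κ p cap : ℕ} (hn : 0 < n)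
    (hp : p + 1 ≤ n) (hκ : (κ + 2) * (Nat.log 2 n + 1) ≤ 2 ^ ((Nat.log 2 n + 1) / q))
    (hcap : 4 * ((κ + 2) * (Nat.log 2 n + 1)) *
      2 ^ (Nat.log 2 n + 1 + (Nat.log 2 n + 1) / q) ≤ cap) :
    fairCoins {ω | ¬ ∀ i ≤ p, Multiset.card (missing adj (sampleAt adj n q ω i)) ≤ cap} ≤
      ENNReal.ofReal (((n : ℝ) ^ κ)⁻¹) := by
  set l := Nat.log 2 n + 1 with hl
  have hn2 : n < 2 ^ l := lt_two_pow_log n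
  refine le_trans (measure_mono fun ω hω => ?_) ((measure_missing_gt (adj := adj) (n := n) (q := q)
    hsymm (L := (κ + 2) * l) (p := p) (by positivity) hκ).trans ?_)
  · exact fun h => hω fun i hi => (h i hi).trans hcap
  · rw [inv_two_pow_eq_ofReal, ← ENNReal.ofReal_natCast, ← ENNReal.ofReal_mul (by positivity)]
    refine ENNReal.ofReal_le_ofReal ?_
    rw [mul_inv_le_iff₀ (by positivity), ← div_eq_inv_mul, le_div_iff₀ (by positivity)]
    norm_cast
    -- Each of `p + 1`, `n + 1` and `n` is at most `2 ^ l`; this is why `L = (κ + 2) * l`.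
    calc (p + 1) * (n + 1) * n ^ κ ≤ 2 ^ l * 2 ^ l * (2 ^ l) ^ κ := by
          gcongr
          · omega
          · omega
      _ = 2 ^ ((κ + 2) * l) := by
          rw [← pow_mul, ← pow_add, ← pow_add]
          congr 1
          ring

end all

/-! ### Asymptotics -/

theorem depth_clique (q last : ℕ) : (Program.clique q last).depth ≤ 3 :=
  le_of_eq rfl

theorem size_clique (q last : ℕ) : (Program.clique q last).size ≤ 512 :=
  Nat.le_of_ble_eq_true rfl

theorem eventually_log_le_rpow (c : ℝ) {a : ℝ} (ha : 0 < a) :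
    ∀ᶠ n : ℕ in Filter.atTop, c * ((Nat.log 2 n + 1 : ℕ) : ℝ) ≤ (n : ℝ) ^ a := by
  have hc : (0 : ℝ) < 3 * (|c| + 1) := by positivity
  have h := ((isLittleO_log_rpow_atTop ha).def (inv_pos.2 hc)).natCast_atTop
  filter_upwards [h, Filter.eventually_ge_atTop 3] with n hn h3
  have h3' : (3 : ℝ) ≤ n := by exact_mod_cast h3
  have hlog1 : 1 ≤ Real.log n := by
    rw [Real.le_log_iff_exp_le (by linarith)]
    linarith [Real.exp_one_lt_d9]
  have hlog : ((Nat.log 2 n : ℕ) : ℝ) ≤ 2 * Real.log n := by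
    have h1 := Real.natLog_le_logb n 2
    rw [Real.logb, Nat.cast_ofNat] at h1
    refine h1.trans ?_
    rw [div_le_iff₀ (Real.log_pos (by norm_num))]
    nlinarith [Real.log_two_gt_d9]
  rw [Real.norm_of_nonneg (by linarith), Real.norm_of_nonneg (by positivity),
    ← div_eq_inv_mul, le_div_iff₀ hc] at hn
  calc c * ((Nat.log 2 n + 1 : ℕ) : ℝ) ≤ (|c| + 1) * (3 * Real.log n) := by
        push_cast
        gcongr
        · linarith [le_abs_self c]
        · linarith
    _ = Real.log n * (3 * (|c| + 1)) := by ring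
    _ ≤ _ := hn

section asymptotics

variable {μ : ℝ} {n q : ℕ}

/-- Here `q` must not be too large: each phase must still gain a power of `n`, which then exceeds
the logarithmic `L`. -/
theorem rpow_le_two_mul_two_pow_div (hμ : 0 < μ) (hq : 0 < q) (hqμ : q * μ ≤ 3) :
    (n : ℝ) ^ (μ / 3) ≤ 2 * 2 ^ ((Nat.log 2 n + 1) / q) := by
  set h := (Nat.log 2 n + 1) / q with hh
  have h1 : n ≤ (2 ^ (h + 1)) ^ q := by
    rw [← pow_mul]
    refine (lt_two_pow_log n).le.trans (Nat.pow_le_pow_right (by omega) ?_)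
    rw [mul_comm]
    exact (Nat.lt_mul_div_succ _ hq).le
  have h2 : (n : ℝ) ≤ (2 ^ (h + 1)) ^ q := by exact_mod_cast h1
  calc (n : ℝ) ^ (μ / 3) ≤ ((2 ^ (h + 1)) ^ q) ^ (μ / 3) := by gcongr
    _ = (2 ^ (h + 1)) ^ (q * (μ / 3)) := by
        rw [← Real.rpow_natCast, ← Real.rpow_mul (by positivity)]
    _ ≤ (2 ^ (h + 1)) ^ (1 : ℝ) :=
        Real.rpow_le_rpow_of_exponent_le (one_le_pow₀ (by norm_num)) (by linarith)
    _ = _ := by rw [Real.rpow_one, pow_succ']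

theorem two_pow_log_le (hn : 0 < n) : 2 ^ (Nat.log 2 n + 1) ≤ 2 * n := by
  rw [pow_succ']
  exact Nat.mul_le_mul_left _ (Nat.pow_log_le_self 2 hn.ne')

/-- Here `q` must not be too small: the loss from one phase to the next is to be at most about `n ^
(μ / 2)`. -/
theorem two_pow_div_le_rpow (hn : 0 < n) (hμ : 0 < μ) (hμ1 : μ ≤ 1) (hqμ : 2 ≤ q * μ) :
    (2 : ℝ) ^ ((Nat.log 2 n + 1) / q) ≤ 2 * (n : ℝ) ^ (μ / 2) := by
  set h := (Nat.log 2 n + 1) / q with hh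
  have h1 : (2 ^ h) ^ q ≤ 2 * n := by
    rw [← pow_mul]
    exact (Nat.pow_le_pow_right (by omega) (Nat.div_mul_le_self _ _)).trans (two_pow_log_le hn)
  have h2 : ((2 : ℝ) ^ h) ^ q ≤ 2 * n := by exact_mod_cast h1
  calc (2 : ℝ) ^ h = (2 ^ h) ^ (1 : ℝ) := (Real.rpow_one _).symm
    _ ≤ (2 ^ h) ^ (q * (μ / 2)) :=
        Real.rpow_le_rpow_of_exponent_le (one_le_pow₀ (by norm_num)) (by linarith)
    _ = ((2 ^ h) ^ q) ^ (μ / 2) := by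
        rw [Real.rpow_mul (by positivity), Real.rpow_natCast]
    _ ≤ (2 * n) ^ (μ / 2) := by gcongr
    _ = 2 ^ (μ / 2) * (n : ℝ) ^ (μ / 2) := Real.mul_rpow (by norm_num) (by positivity)
    _ ≤ 2 ^ (1 : ℝ) * (n : ℝ) ^ (μ / 2) := by
        gcongr
        · norm_num
        · linarith
    _ = _ := by rw [Real.rpow_one]

/-- The non-edges cost `n ^ (1 + μ / 2)` up to a logarithm, and `n ^ (μ / 3)` absorbs the logarithm
and the constants, as `μ / 2 + μ / 3 ≤ μ`. -/
theorem four_mul_log_mul_le {κ : ℕ} (hn : 0 < n) (hμ : 0 < μ) (hμ1 : μ ≤ 1) (hqμ : 2 ≤ q * μ)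
    (hlog : (16 * (κ + 2) : ℝ) * ((Nat.log 2 n + 1 : ℕ) : ℝ) ≤ (n : ℝ) ^ (μ / 3)) :
    4 * ((κ + 2) * (Nat.log 2 n + 1)) * 2 ^ (Nat.log 2 n + 1 + (Nat.log 2 n + 1) / q) ≤
      ⌈(n : ℝ) ^ (1 + μ)⌉₊ := by
  have hn1 : (1 : ℝ) ≤ n := by exact_mod_cast hn
  have h1 : (2 : ℝ) ^ (Nat.log 2 n + 1) ≤ 2 * n := by exact_mod_cast two_pow_log_le hn
  have h2 := two_pow_div_le_rpow hn hμ hμ1 hqμ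
  rw [← Nat.cast_le (α := ℝ)]
  refine le_trans ?_ (Nat.le_ceil _)
  rw [pow_add]
  generalize Nat.log 2 n + 1 = l at *
  push_cast
  calc (4 * ((κ + 2) * l) * (2 ^ l * 2 ^ (l / q)) : ℝ)
      ≤ 4 * ((κ + 2) * l) * ((2 * n) * (2 * (n : ℝ) ^ (μ / 2))) := by gcongr
    _ = (16 * (κ + 2) * l) * (n * (n : ℝ) ^ (μ / 2)) := by ring
    _ ≤ (n : ℝ) ^ (μ / 3) * (n * (n : ℝ) ^ (μ / 2)) := by gcongr
    _ = (n : ℝ) ^ (μ / 3 + (1 + μ / 2)) := by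
        rw [Real.rpow_add (by linarith), Real.rpow_add (by linarith), Real.rpow_one]
    _ ≤ _ := Real.rpow_le_rpow_of_exponent_le hn1 (by linarith)

theorem numMachines_le (hμ : 0 < μ) (hn : 0 < n) (G : SimpleGraph (Fin n)) :
    numMachines μ G ≤ n := by
  classical
  have hn1 : (1 : ℝ) ≤ n := by exact_mod_cast hn
  refine max_le hn (Nat.ceil_le.2 ?_)
  rw [div_le_iff₀ (by positivity)]
  have h1 : G.edgeSet.ncard ≤ n ^ 2 := by
    rw [Set.ncard_eq_toFinset_card']
    refine (SimpleGraph.card_edgeFinset_le_card_choose_two (G := G)).trans ?_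
    rw [Fintype.card_fin]
    exact Nat.choose_le_pow n 2
  calc (G.edgeSet.ncard : ℝ) ≤ n ^ 2 := by exact_mod_cast h1
    _ = n * (n : ℝ) ^ (1 : ℝ) := by rw [Real.rpow_one, sq]
    _ ≤ _ := by
        gcongr
        linarith

/-- Rounding down loses less than a factor of two, `l < 2 * q * (l / q)`; therefore `2 * q` phases
suffice where `q` might not. -/
theorem sampleExp_eq_zero (hq : 0 < q) (h : q ≤ Nat.log 2 n + 1) :
    sampleExp q n (2 * q - 1) = 0 := by
  rw [sampleExp, Nat.sub_add_cancel (by omega), Nat.sub_eq_zero_iff_le]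
  generalize Nat.log 2 n + 1 = l at *
  have h1 := Nat.lt_mul_div_succ l hq
  have h2 : q * 1 ≤ q * (l / q) := Nat.mul_le_mul_left _ (Nat.div_pos h hq)
  rw [Nat.mul_add] at h1
  rw [mul_assoc]
  omega

theorem graphResources_S_le (hn : 0 < n) (hμ1 : μ ≤ 1) :
    (graphResources μ 128 6 10 n).S ≤ 128 * n ^ 2 := by
  have hn1 : (1 : ℝ) ≤ n := by exact_mod_cast hn
  refine Nat.floor_le_of_le ?_
  push_cast
  gcongr
  calc (n : ℝ) ^ (1 + μ) ≤ (n : ℝ) ^ (2 : ℝ) :=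
        Real.rpow_le_rpow_of_exponent_le hn1 (by linarith)
    _ = _ := by norm_num

/-- `128` is `64` doubled, since `⌈n ^ (1 + μ)⌉` is at most `2 * n ^ (1 + μ)`. Six logarithms per
word suffice because `S ≤ 128 * n ^ 2` and a word must hold `4 * S ^ 2 + 8`. -/
theorem params_of_le {r M : ℕ} (hn : 512 ≤ n) (hμ : 0 < μ) (hμ1 : μ ≤ 1) (hM : 0 < M) (hMn : M ≤ n)
    (hq : q ≤ n) (hr : r ≤ n) :
    Params n M ⌈(n : ℝ) ^ (1 + μ)⌉₊ q r (graphResources μ 128 6 10 n) := by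
  have hn1 : (1 : ℝ) ≤ n := by exact_mod_cast (by omega : 1 ≤ n)
  have hN : (n : ℝ) ≤ (n : ℝ) ^ (1 + μ) := by
    calc (n : ℝ) = (n : ℝ) ^ (1 : ℝ) := (Real.rpow_one _).symm
      _ ≤ _ := Real.rpow_le_rpow_of_exponent_le hn1 (by linarith)
  refine ⟨by omega, hM, hMn, ?_, ?_, ?_, hq, hr⟩
  · exact_mod_cast hN.trans (Nat.le_ceil _)
  · refine Nat.le_floor ?_
    push_cast
    have := Nat.ceil_lt_add_one (a := (n : ℝ) ^ (1 + μ)) (by positivity)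
    linarith
  · have hS := graphResources_S_le (by omega : 0 < n) hμ1
    have hW : n ^ 6 ≤ (graphResources μ 128 6 10 n).W := by
      change n ^ 6 ≤ 2 ^ (6 * (Nat.log 2 n + 1))
      rw [mul_comm, pow_mul]
      exact Nat.pow_le_pow_left (lt_two_pow_log n).le 6
    calc 4 * (graphResources μ 128 6 10 n).S * (graphResources μ 128 6 10 n).S + 8
        ≤ 4 * (128 * n ^ 2) * (128 * n ^ 2) + 8 := by gcongr
      _ = n ^ 4 * (256 * 256) + 8 := by ring
      _ < n ^ 4 * (512 * 512) := by
          have : 0 < n ^ 4 := by positivity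
          omega
      _ ≤ n ^ 4 * (n * n) := by gcongr
      _ = n ^ 6 := by ring
      _ ≤ _ := hW

theorem time_le (hn : 512 ≤ n) (hμ1 : μ ≤ 1) (last : ℕ) :
    (Program.clique q last).time (graphResources μ 128 6 10 n).S ≤
      (graphResources μ 128 6 10 n).T := by
  have hS := graphResources_S_le (by omega : 0 < n) hμ1
  have hS1 : (graphResources μ 128 6 10 n).S + 1 ≤ n ^ 3 := by
    have : 0 < n ^ 2 := by positivity
    calc _ ≤ n ^ 2 * 512 := by omega
      _ ≤ n ^ 2 * n := by gcongr
      _ = _ := by ring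
  refine (Program.time_le _ _).trans ?_
  calc _ ≤ n * ((graphResources μ 128 6 10 n).S + 1) ^ 3 := by
        gcongr
        · exact (size_clique q last).trans (by omega)
        · omega
        · exact depth_clique q last
    _ ≤ n * (n ^ 3) ^ 3 := by gcongr
    _ = n ^ 10 := by ring

end asymptotics

end MapReduce

/-! ### Choice of the constants and conclusion -/

theorem mainTheorem10 :
    ∃ A K b d : ℕ, ∀ μ : ℝ, 0 < μ → μ ≤ 1 →
      ∃ (P : MapReduce.Program) (r : ℕ), (r : ℝ) ≤ A / μ ∧
        ∀ κ : ℕ, ∃ n₀ : ℕ, ∀ n ≥ n₀, ∀ (G : SimpleGraph (Fin n))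
          (edges : Fin (MapReduce.numMachines μ G) → List (Fin n × Fin n)),
          MapReduce.IsEdgeDistribution G ⌈(n : ℝ) ^ (1 + μ)⌉₊ edges →
            MapReduce.fairCoins {coin | ¬ MapReduce.FindsMaximalClique P
                (MapReduce.graphResources μ K b d n) G edges r coin} ≤
              ENNReal.ofReal (((n : ℝ) ^ κ)⁻¹) := by
  -- `48 = 16 * 3`, from fewer than `16 * q` rounds and `q * μ ≤ 3`. The exponent `10 = 1 + 3 * 3`
  -- comes from size at most `n`, loop depth `3` and loop bound below `n ^ 3`.
  refine ⟨48, 128, 6, 10, fun μ hμ hμ1 => ?_⟩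
  set q := ⌈2 / μ⌉₊ with hq
  have hq0 : 0 < q := Nat.ceil_pos.2 (by positivity)
  have hqμ : 2 ≤ q * μ := (div_le_iff₀ hμ).1 (Nat.le_ceil _)
  have hqμ3 : q * μ ≤ 3 := by
    have h1 := Nat.ceil_lt_add_one (a := 2 / μ) (by positivity)
    have h2 : 2 / μ * μ = 2 := div_mul_cancel₀ _ hμ.ne'
    nlinarith
  refine ⟨.clique q (8 * (2 * q - 1) + 6), 8 * (2 * q - 1) + 7, ?_, fun κ => ?_⟩
  · rw [le_div_iff₀ hμ]
    have h1 : ((8 * (2 * q - 1) + 7 : ℕ) : ℝ) ≤ 16 * q := by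
      exact_mod_cast (by omega : 8 * (2 * q - 1) + 7 ≤ 16 * q)
    calc ((8 * (2 * q - 1) + 7 : ℕ) : ℝ) * μ ≤ 16 * q * μ := by gcongr
      _ ≤ (48 : ℕ) := by
        push_cast
        linarith
  · obtain ⟨n₁, hn₁⟩ := Filter.eventually_atTop.1
      (MapReduce.eventually_log_le_rpow (16 * (κ + 2)) (a := μ / 3) (by positivity))
    -- `n₁` makes the logarithms small, `512` handles the numerical constants, `16 * q ≤ n` bounds
    -- the rounds by `n`, and `2 ^ q ≤ n` gives `q ≤ Nat.log 2 n`.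
    refine ⟨max (max n₁ 512) (max (16 * q) (2 ^ q)), fun n hn G edges hedges => ?_⟩
    simp only [ge_iff_le, max_le_iff] at hn
    obtain ⟨⟨hn1, hn512⟩, hn16, hnq⟩ := hn
    have hn0 : 0 < n := by omega
    have hlog := hn₁ n hn1
    have hql : q ≤ Nat.log 2 n := Nat.le_log_of_pow_le (by omega) hnq
    have hgood := MapReduce.measure_missing_gt_le_inv_pow (adj := MapReduce.natAdj G) (q := q)
      (MapReduce.represents hedges).symm (κ := κ) (p := 2 * q - 1) hn0 (by omega) ?_
      (MapReduce.four_mul_log_mul_le hn0 hμ hμ1 hqμ hlog)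
    · refine (measure_mono fun coin hcoin => ?_).trans hgood
      refine fun hg => hcoin (MapReduce.findsMaximalClique
        (MapReduce.params_of_le hn512 hμ hμ1 ?_ (MapReduce.numMachines_le hμ hn0 G) (by omega)
          (by omega)) hedges (MapReduce.time_le hn512 hμ1 _) hg
        (MapReduce.sampleExp_eq_zero hq0 (by omega)))
      exact lt_of_lt_of_le one_pos (le_max_left _ _)
    · have h1 := MapReduce.rpow_le_two_mul_two_pow_div (n := n) hμ hq0 hqμ3
      rw [← Nat.cast_le (α := ℝ)]
      generalize Nat.log 2 n + 1 = l at *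
      push_cast
      have : (0 : ℝ) ≤ (κ + 2) * l := by positivity
      nlinarith
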